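/- Let $n\ge 3$. Put $\Delta(z)=1-2|z|^2+|z^\top z|^2$ for $z\in\mathbb C^n$, and let $$D=\{z\in\mathbb{C}^n : |z|<1,\ 2|z|^2<1+|z^\top z|^2\}$$ be the Cartan domain of type IV. The group $\mathrm{SO}(n)\times\mathrm{SO}(2)$ acts on $D$ by $(A,t)\cdot z=tAz$, where $\mathrm{SO}(2)$ is identified with the unit circle $\mathbb T\subset\mathbb{C}$ by $\begin{pmatrix}\cos\vartheta&\sin\vartheta\\-\sin\vartheta&\cos\vartheta\end{pmatrix}\mapsto e^{i\vartheta}$; regard $\mathrm{SO}(n-1)$ as a subgroup of $\mathrm{SO}(n)$ through the upper left corner embedding $B\mapsto\mathrm{diag}(B,1)$. For $\lambda>n-1$ let $v_\lambda$ be the probability measure on $D$ proportional to $\Delta(z)^{\lambda-n}\,dz$ ($dz$ Lebesgue measure), let $\mathcal A^2_\lambda(D)$ be the (closed) subspace of holomorphic functions in $L^2(D,v_\lambda)$, and let $B_\lambda: L^2(D,v_\lambda)\to\mathcal A^2_\lambda(D)$ be the orthogonal projection. For $a\in L^\infty(D)$ let $T^{(\lambda)}_a f=B_\lambda(af)$ be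 the Toeplitz operator with symbol $a$ on $\mathcal A^2_\lambda(D)$. For a subgroup $H\subset\mathrm{SO}(n)\times\mathrm{SO}(2)$ let $L^\infty(D)^H$ be the space of all $a\in L^\infty(D)$ such that $a\circ h^{-1}=a$ almost everywhere for every $h\in H$, and let $\mathcal T^{(\lambda)}(L^\infty(D)^H)$ be the unital Banach algebra (which is also the unital $C^*$-algebra) of bounded operators on $\mathcal A^2_\lambda(D)$ generated by the $T^{(\lambda)}_a$ with $a\in L^\infty(D)^H$. Then: 1. $\mathrm{SO}(n-1)\times\mathrm{SO}(2)$ is a maximal connected subgroup of $\mathrm{SO}(n)\times\mathrm{SO}(2)$, that is, it is maximal with respect to inclusion among the proper connected subgroups; 2. for every $\lambda>n-1$, the algebra $\mathcal T^{(\lambda)}(L^\infty(D)^{\mathrm{SO}(n)\times\mathrm{SO}(2)})$ is commutative; 3. for every $\lambda>n-1$, the algebra $\mathcal T^{(\lambda)}(L^\infty(D)^{\mathrm{SO}(n-1)\times\mathrm{SO}(2)})$ is not commutative. -/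

import Mathlib

open MeasureTheory
open scoped ENNReal

noncomputable section

namespace TypeIV

/-! ### The groups `SO(n) × SO(2)` and `SO(n - 1) × SO(2)` -/

/-- The compact group `SO(n)`, with the topology of the space of matrices. -/
abbrev SO (n : ℕ) := ↥(Matrix.specialOrthogonalGroup (Fin n) ℝ)

/-- The group `SO(n) × SO(2)`. -/
abbrev G (n : ℕ) := SO n × SO 2

/-- The upper left corner embedding `B ↦ diag(B, 1)` of matrices of size `n - 1` into matrices
of size `n`. -/
def cornerEmb (n : ℕ) (B : Matrix (Fin (n - 1)) (Fin (n - 1)) ℝ) : Matrix (Fin n) (Fin n) ℝ :=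
  Matrix.of fun i j =>
    if h : i.1 < n - 1 ∧ j.1 < n - 1 then B ⟨i.1, h.1⟩ ⟨j.1, h.2⟩ else if i = j then 1 else 0

theorem cornerEmb_one (n : ℕ) : cornerEmb n 1 = 1 := by
  ext i j
  simp only [cornerEmb, Matrix.of_apply, Matrix.one_apply, Fin.ext_iff]
  split_ifs <;> rfl

theorem cornerEmb_mul (n : ℕ) (B C : Matrix (Fin (n - 1)) (Fin (n - 1)) ℝ) :
    cornerEmb n (B * C) = cornerEmb n B * cornerEmb n C := by
  cases n with
  | zero => ext i; exact i.elim0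
  | succ k =>
    ext i j
    rw [Matrix.mul_apply, Fin.sum_univ_castSucc]
    induction i using Fin.lastCases <;> induction j using Fin.lastCases <;>
      simp [cornerEmb, Matrix.mul_apply, Fin.ext_iff]
    · exact Finset.sum_eq_zero fun x _ => by simp [x.2.ne]
    · exact Finset.sum_eq_zero fun x _ => by simp [x.2.ne']
    · exact Finset.sum_eq_zero fun x _ => by simp [x.2.ne]
    · exact fun h => absurd h (Fin.is_lt _).ne'

theorem cornerEmb_transpose (n : ℕ) (B : Matrix (Fin (n - 1)) (Fin (n - 1)) ℝ) :
    cornerEmb n B.transpose = (cornerEmb n B).transpose := by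
  ext i j
  simp only [cornerEmb, Matrix.of_apply, Matrix.transpose_apply, eq_comm (a := i), and_comm]

/-- `SO(n - 1)` as a subgroup of `SO(n)`, through the upper left corner embedding. -/
def cornerSO (n : ℕ) : Subgroup (SO n) where
  carrier := {A | ∃ B : SO (n - 1), (A : Matrix (Fin n) (Fin n) ℝ) = cornerEmb n B}
  one_mem' := ⟨1, (cornerEmb_one n).symm⟩
  mul_mem' := by
    rintro A A' ⟨B, hB⟩ ⟨B', hB'⟩
    exact ⟨B * B', by simp [hB, hB', cornerEmb_mul]⟩
  inv_mem' := by
    rintro A ⟨B, hB⟩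
    refine ⟨B⁻¹, ?_⟩
    change (A : Matrix (Fin n) (Fin n) ℝ).transpose = cornerEmb n (B : Matrix _ _ ℝ).transpose
    rw [hB, cornerEmb_transpose]

/-- The subgroup `SO(n - 1) × SO(2)` of `SO(n) × SO(2)`. -/
def cornerProd (n : ℕ) : Subgroup (G n) := (cornerSO n).prod ⊤

/-- `H` is a maximal connected subgroup: it is maximal among the proper connected subgroups
(no closedness is required of the competing subgroups). -/
def IsMaximalConnected {Γ : Type*} [Group Γ] [TopologicalSpace Γ] (H : Subgroup Γ) : Prop :=
  Maximal (fun K : Subgroup Γ => IsConnected (K : Set Γ) ∧ K ≠ ⊤) H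

/-! ### The linear action on `ℂⁿ` -/

/-- The isomorphism of `SO(2)` with the unit circle in `ℂ`, inverse to
`exp(iθ) ↦ !![cos θ, sin θ; -sin θ, cos θ]`. -/
def phase (t : SO 2) : ℂ :=
  ⟨(t : Matrix (Fin 2) (Fin 2) ℝ) 0 0, (t : Matrix (Fin 2) (Fin 2) ℝ) 0 1⟩

theorem phase_rotation (t : SO 2) (θ : ℝ)
    (h : (t : Matrix (Fin 2) (Fin 2) ℝ) = !![θ.cos, θ.sin; -θ.sin, θ.cos]) :
    phase t = Complex.exp (θ * Complex.I) := by
  simp [phase, h, Complex.ext_iff, Complex.exp_ofReal_mul_I_re, Complex.exp_ofReal_mul_I_im]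

theorem phase_one : phase 1 = 1 := by
  simp [phase, Complex.ext_iff]

theorem phase_mul (s t : SO 2) : phase (s * t) = phase s * phase t := by
  have hs := Matrix.mem_specialOrthogonalGroup_fin_two_iff.1 s.2
  have ht := Matrix.mem_specialOrthogonalGroup_fin_two_iff.1 t.2
  apply Complex.ext
  · simp only [phase, Submonoid.coe_mul, Matrix.mul_apply, Fin.sum_univ_two, Complex.mul_re]
    rw [ht.2.1]; ring
  · simp only [phase, Submonoid.coe_mul, Matrix.mul_apply, Fin.sum_univ_two, Complex.mul_im]
    rw [ht.1]

/-- The action `(A, t) · z = t A z`. -/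
def act {n : ℕ} (g : G n) (z : Fin n → ℂ) : Fin n → ℂ :=
  phase g.2 • ((g.1 : Matrix (Fin n) (Fin n) ℝ).map Complex.ofReal).mulVec z

theorem act_one {n : ℕ} (z : Fin n → ℂ) : act 1 z = z := by
  have : ((1 : Matrix (Fin n) (Fin n) ℝ).map Complex.ofReal) = 1 :=
    Matrix.map_one _ Complex.ofReal_zero Complex.ofReal_one
  simp [act, phase_one, this]

theorem act_mul {n : ℕ} (g h : G n) (z : Fin n → ℂ) : act (g * h) z = act g (act h z) := by
  have : ((g.1 : Matrix (Fin n) (Fin n) ℝ) * (h.1 : Matrix (Fin n) (Fin n) ℝ)).map Complex.ofReal =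
      (g.1 : Matrix (Fin n) (Fin n) ℝ).map Complex.ofReal *
        (h.1 : Matrix (Fin n) (Fin n) ℝ).map Complex.ofReal :=
    Matrix.map_mul (f := Complex.ofRealHom)
  simp [act, phase_mul, this, Matrix.mulVec_smul, mul_smul, Matrix.mulVec_mulVec]

/-! ### The Cartan domain of type IV -/

/-- `|z|²`. -/
def absSq {n : ℕ} (z : Fin n → ℂ) : ℝ := ∑ i, ‖z i‖ ^ 2

/-- `zᵀ z`. -/
def quad {n : ℕ} (z : Fin n → ℂ) : ℂ := ∑ i, z i ^ 2

/-- The Cartan domain of type IV: `|z| < 1` (written as `|z|² < 1`) and `2|z|² < 1 + |zᵀ z|²`. -/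
def D (n : ℕ) : Set (Fin n → ℂ) := {z | absSq z < 1 ∧ 2 * absSq z < 1 + ‖quad z‖ ^ 2}

/-- `Δ(z) = 1 - 2|z|² + |zᵀ z|²`. -/
def Δ {n : ℕ} (z : Fin n → ℂ) : ℝ := 1 - 2 * absSq z + ‖quad z‖ ^ 2

theorem map_gram {n : ℕ} (A : SO n) :
    ((A : Matrix (Fin n) (Fin n) ℝ).map Complex.ofReal).transpose *
      (A : Matrix (Fin n) (Fin n) ℝ).map Complex.ofReal = 1 := by
  have h : (A : Matrix (Fin n) (Fin n) ℝ).transpose * (A : Matrix (Fin n) (Fin n) ℝ) = 1 :=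
    (Matrix.mem_orthogonalGroup_iff' (Fin n) ℝ).1 (Matrix.mem_specialOrthogonalGroup_iff.1 A.2).1
  have h2 := congrArg (fun M : Matrix (Fin n) (Fin n) ℝ => M.map Complex.ofRealHom) h
  rw [Matrix.map_mul, Matrix.map_one _ (map_zero _) (map_one _)] at h2
  exact h2

theorem norm_phase (t : SO 2) : ‖phase t‖ = 1 := by
  have h := (Matrix.mem_specialOrthogonalGroup_fin_two_iff.1 t.2).2.2
  have : ‖phase t‖ ^ 2 = 1 := by
    rw [← Complex.normSq_eq_norm_sq, Complex.normSq_apply, phase]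
    simp only; rw [← h]; ring
  exact (pow_eq_one_iff_of_nonneg (norm_nonneg _) two_ne_zero).1 this

theorem quad_eq {n : ℕ} (z : Fin n → ℂ) : quad z = z ⬝ᵥ z := by
  simp [quad, dotProduct, sq]

theorem absSq_eq {n : ℕ} (z : Fin n → ℂ) : (absSq z : ℂ) = star z ⬝ᵥ z := by
  simp [absSq, dotProduct, Complex.conj_mul']

theorem norm_quad_act {n : ℕ} (g : G n) (z : Fin n → ℂ) : ‖quad (act g z)‖ = ‖quad z‖ := by
  rw [quad_eq, quad_eq, act, smul_dotProduct, dotProduct_smul, Matrix.dotProduct_mulVec,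
    ← Matrix.mulVec_transpose, Matrix.mulVec_mulVec, map_gram, Matrix.one_mulVec]
  simp [norm_phase]

theorem absSq_act {n : ℕ} (g : G n) (z : Fin n → ℂ) : absSq (act g z) = absSq z := by
  have h : (((g.1 : Matrix (Fin n) (Fin n) ℝ).map Complex.ofReal).conjTranspose) =
      ((g.1 : Matrix (Fin n) (Fin n) ℝ).map Complex.ofReal).transpose := by
    ext i j; simp
  have h1 : absSq (act g z) = ‖phase g.2‖ ^ 2 *
      absSq (((g.1 : Matrix (Fin n) (Fin n) ℝ).map Complex.ofReal).mulVec z) := by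
    simp [absSq, act, mul_pow, Finset.mul_sum]
  rw [h1, norm_phase, one_pow, one_mul]
  apply Complex.ofReal_injective
  rw [absSq_eq, absSq_eq, Matrix.star_mulVec, h, Matrix.dotProduct_mulVec, Matrix.vecMul_vecMul,
    map_gram, Matrix.vecMul_one]

theorem act_mem_D {n : ℕ} (g : G n) (z : Fin n → ℂ) : act g z ∈ D n ↔ z ∈ D n := by
  simp [D, absSq_act, norm_quad_act]

theorem Δ_act {n : ℕ} (g : G n) (z : Fin n → ℂ) : Δ (act g z) = Δ z := by
  simp [Δ, absSq_act, norm_quad_act]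

theorem continuous_absSq {n : ℕ} : Continuous (absSq (n := n)) := by
  unfold absSq; fun_prop

theorem continuous_quad {n : ℕ} : Continuous (quad (n := n)) := by
  unfold quad; fun_prop

theorem continuous_Δ {n : ℕ} : Continuous (Δ (n := n)) := by
  have := continuous_absSq (n := n)
  have := continuous_quad (n := n)
  unfold Δ; fun_prop

theorem isOpen_D (n : ℕ) : IsOpen (D n) := by
  have := continuous_absSq (n := n)
  have := continuous_quad (n := n)
  refine IsOpen.and (isOpen_lt (by fun_prop) continuous_const) (isOpen_lt ?_ ?_) <;> fun_prop

theorem Δ_pos {n : ℕ} {z : Fin n → ℂ} (hz : z ∈ D n) : 0 < Δ z := by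
  have := hz.2; unfold Δ; linarith

/-! ### The weighted measures -/

/-- The measure `Δ(z) ^ (l - n) dz` on the domain, where `dz` is Lebesgue measure. -/
def v₀ (n : ℕ) (l : ℝ) : Measure (Fin n → ℂ) :=
  (volume.restrict (D n)).withDensity fun z => ENNReal.ofReal (Δ z ^ (l - n))

/-- The probability measure on the domain proportional to `Δ(z) ^ (l - n) dz`. -/
def v (n : ℕ) (l : ℝ) : Measure (Fin n → ℂ) := (v₀ n l Set.univ)⁻¹ • v₀ n l

theorem measurable_weight (n : ℕ) (l : ℝ) :
    Measurable fun z : Fin n → ℂ => ENNReal.ofReal (Δ z ^ (l - n)) :=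
  (continuous_Δ.measurable.pow_const _).ennreal_ofReal

theorem v_eq_zero_or (n : ℕ) (l : ℝ) :
    v n l = 0 ∨ (v₀ n l Set.univ)⁻¹ ≠ 0 ∧ (v₀ n l Set.univ)⁻¹ ≠ ∞ := by
  by_cases h0 : v₀ n l Set.univ = 0
  · left; rw [v, Measure.measure_univ_eq_zero.1 h0, smul_zero]
  · by_cases h1 : v₀ n l Set.univ = ∞
    · left; rw [v, h1, ENNReal.inv_top, zero_smul]
    · exact Or.inr ⟨ENNReal.inv_ne_zero.2 h1, ENNReal.inv_ne_top.2 h0⟩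

theorem ae_v₀_iff {n : ℕ} {l : ℝ} {p : (Fin n → ℂ) → Prop} :
    (∀ᵐ z ∂v₀ n l, p z) ↔ ∀ᵐ z, z ∈ D n → p z := by
  rw [v₀, ae_withDensity_iff (measurable_weight n l), ae_restrict_iff' (isOpen_D n).measurableSet]
  refine Filter.eventually_congr (Filter.Eventually.of_forall fun z => ?_)
  refine forall_congr' fun hz => ?_
  simp [Real.rpow_pos_of_pos (Δ_pos hz)]

theorem ae_act {n : ℕ} {l : ℝ} (g : G n) {p : (Fin n → ℂ) → Prop} (hp : ∀ᵐ z ∂v n l, p z) :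
    ∀ᵐ z ∂v n l, p (act g z) := by
  rcases v_eq_zero_or n l with h | ⟨h0, -⟩
  · simp [h]
  rw [v, Measure.ae_ennreal_smul_measure_iff h0, ae_v₀_iff] at hp ⊢
  let e : (Fin n → ℂ) ≃ₗ[ℝ] (Fin n → ℂ) :=
    { toFun := act g
      invFun := act g⁻¹
      left_inv := fun z => by rw [← act_mul, inv_mul_cancel, act_one]
      right_inv := fun z => by rw [← act_mul, mul_inv_cancel, act_one]
      map_add' := fun z w => by simp [act, Matrix.mulVec_add]
      map_smul' := fun c z => by
        simp only [act, RingHom.id_apply, Matrix.mulVec_smul]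
        rw [smul_comm] }
  have hq : ∀ᵐ z, act g z ∈ D n → p (act g z) := by
    have h1 := Measure.addHaar_preimage_continuousLinearEquiv volume e.toContinuousLinearEquiv
      {z | ¬ (z ∈ D n → p z)}
    rw [ae_iff] at hp ⊢
    rw [hp, mul_zero] at h1
    exact h1
  filter_upwards [hq] with z hz hzD using hz ((act_mem_D g z).2 hzD)

theorem restrict_le_v₀ (n : ℕ) (l : ℝ) {K : Set (Fin n → ℂ)} (hK : K ⊆ D n) (hc : IsCompact K) :
    ∃ C : ℝ≥0∞, C ≠ ∞ ∧ volume.restrict K ≤ C • v₀ n l := by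
  rcases K.eq_empty_or_nonempty with rfl | hne
  · exact ⟨0, ENNReal.zero_ne_top, by simp⟩
  have hcont : ContinuousOn (fun z : Fin n → ℂ => Δ z ^ (l - n)) K :=
    continuous_Δ.continuousOn.rpow_const fun z hz => Or.inl (Δ_pos (hK hz)).ne'
  obtain ⟨z, hz, hmin⟩ := hc.exists_isMinOn hne hcont
  have hpos : 0 < Δ z ^ (l - n) := Real.rpow_pos_of_pos (Δ_pos (hK hz)) _
  set δ := ENNReal.ofReal (Δ z ^ (l - n)) with hδ
  have hδ0 : δ ≠ 0 := by simp [hδ, hpos]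
  have hδt : δ ≠ ∞ := ENNReal.ofReal_ne_top
  refine ⟨δ⁻¹, ENNReal.inv_ne_top.2 hδ0, Measure.le_iff.2 fun s hs => ?_⟩
  have h1 : δ * volume (s ∩ K) ≤ v₀ n l s := by
    rw [v₀, withDensity_apply _ hs, Measure.restrict_restrict hs]
    calc δ * volume (s ∩ K) = ∫⁻ _ in s ∩ K, δ := (setLIntegral_const _ _).symm
      _ ≤ ∫⁻ w in s ∩ K, ENNReal.ofReal (Δ w ^ (l - n)) :=
          setLIntegral_mono' (hs.inter hc.measurableSet) fun w hw =>
            ENNReal.ofReal_le_ofReal (hmin hw.2)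
      _ ≤ _ := lintegral_mono_set (Set.inter_subset_inter_right s hK)
  rw [Measure.restrict_apply hs, Measure.smul_apply, smul_eq_mul]
  calc volume (s ∩ K) = δ⁻¹ * (δ * volume (s ∩ K)) := by
        rw [← mul_assoc, ENNReal.inv_mul_cancel hδ0 hδt, one_mul]
    _ ≤ _ := by gcongr

/-! ### Classes of holomorphic functions form a closed subspace of `L²` -/

section Closed

open Metric Set Filter Topology

theorem mv_point {n : ℕ} {U : Set (Fin n → ℂ)} {F : (Fin n → ℂ) → ℂ}
    (hF : DifferentiableOn ℂ F U) {x w : Fin n → ℂ} {r : ℝ}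
    (hb : closedBall x r ⊆ U) (hw : w ∈ closedBall (0 : Fin n → ℂ) r) :
    ENNReal.ofReal (2 * Real.pi) * ‖F x‖ₑ ≤
      ∫⁻ θ in Ioc 0 (2 * Real.pi), ‖F (x + circleMap 0 1 θ • w)‖ₑ := by
  have hmap : ∀ ζ ∈ closedBall (0 : ℂ) |1|, x + ζ • w ∈ U := by
    intro ζ hζ
    apply hb
    simp only [mem_closedBall, dist_zero_right, abs_one] at hζ hw
    simp only [mem_closedBall, dist_eq_norm, add_sub_cancel_left, norm_smul]
    calc ‖ζ‖ * ‖w‖ ≤ 1 * r := by gcongr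
      _ = r := one_mul r
  have hd : DifferentiableOn ℂ (fun ζ : ℂ => F (x + ζ • w)) (closedBall 0 |1|) := by
    refine hF.comp (t := U) (f := fun ζ : ℂ => x + ζ • w) ?_ hmap
    fun_prop
  have h := (DifferentiableOn.diffContOnCl (f := fun ζ : ℂ => F (x + ζ • w)) (s := ball 0 |1|)
    (by rw [closure_ball _ (by simp)]; exact hd)).circleAverage
  simp only [zero_smul, add_zero] at h
  rw [Real.circleAverage_def] at h
  have h2 : ((2 * Real.pi : ℝ) : ℂ) * F x = ∫ θ in (0)..2 * Real.pi, F (x + circleMap 0 1 θ • w) := by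
    rw [← h, Complex.real_smul, ← mul_assoc, ← Complex.ofReal_mul, mul_inv_cancel₀ (by positivity)]
    simp
  have h3 : ENNReal.ofReal (2 * Real.pi) * ‖F x‖ₑ = ‖((2 * Real.pi : ℝ) : ℂ) * F x‖ₑ := by
    rw [enorm_mul, ← Real.enorm_of_nonneg (by positivity)]
    congr 1
    rw [← ofReal_norm, ← ofReal_norm, Complex.norm_real]
  rw [h3, h2, intervalIntegral.integral_of_le (by positivity)]
  exact enorm_integral_le_lintegral_enorm _

theorem mp_unit {n : ℕ} {c : ℂ} (hc : ‖c‖ = 1) :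
    MeasurePreserving (fun w : Fin n → ℂ => c • w) volume volume := by
  have h1 : MeasurePreserving (fun z : ℂ => c * z) volume volume := by
    have := (rotation (⟨c, mem_sphere_zero_iff_norm.2 hc⟩ : Circle)).measurePreserving
    exact this
  exact volume_preserving_pi (fun _ => h1)

theorem mv_ball {n : ℕ} {U : Set (Fin n → ℂ)} {F : (Fin n → ℂ) → ℂ}
    (hF : DifferentiableOn ℂ F U) {x : Fin n → ℂ} {r : ℝ} (hb : closedBall x r ⊆ U) :
    volume (closedBall (0 : Fin n → ℂ) r) * ‖F x‖ₑ ≤ ∫⁻ w in closedBall x r, ‖F w‖ₑ := by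
  set B := closedBall (0 : Fin n → ℂ) r with hB
  have hBm : MeasurableSet B := isClosed_closedBall.measurableSet
  have hrot : ∀ θ : ℝ, ∫⁻ w in B, ‖F (x + circleMap 0 1 θ • w)‖ₑ = ∫⁻ w in closedBall x r, ‖F w‖ₑ := by
    intro θ
    have h1 : MeasurePreserving (fun w : Fin n → ℂ => x + circleMap 0 1 θ • w) volume volume :=
      (measurePreserving_add_left volume x).comp (mp_unit (by simp))
    have h2 : B = (fun w : Fin n → ℂ => x + circleMap 0 1 θ • w) ⁻¹' closedBall x r := by
      ext w; simp [hB, dist_eq_norm, norm_smul]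
    rw [h2]
    have hne : circleMap 0 1 θ ≠ 0 := by simp
    refine h1.setLIntegral_comp_preimage_emb ?_ (fun w => ‖F w‖ₑ) (closedBall x r)
    exact ((Homeomorph.smulOfNeZero _ hne).trans (Homeomorph.addLeft x)).measurableEmbedding
  have hcont : ContinuousOn (fun p : (Fin n → ℂ) × ℝ => F (x + circleMap 0 1 p.2 • p.1))
      (B ×ˢ Ioc 0 (2 * Real.pi)) := by
    refine hF.continuousOn.comp (t := U) (f := fun p : (Fin n → ℂ) × ℝ => x + circleMap 0 1 p.2 • p.1)
      ?_ ?_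
    · have : Continuous (circleMap 0 1) := continuous_circleMap 0 1
      fun_prop
    · rintro ⟨w, θ⟩ ⟨hw, -⟩
      apply hb
      simpa [dist_eq_norm, norm_smul, hB] using hw
  have hswap := lintegral_lintegral_swap (μ := volume.restrict B)
    (ν := volume.restrict (Ioc 0 (2 * Real.pi)))
    (f := fun w θ => ‖F (x + circleMap 0 1 θ • w)‖ₑ) (by
      rw [Measure.prod_restrict]
      exact (hcont.aestronglyMeasurable (hBm.prod measurableSet_Ioc)).enorm)
  have hle : ENNReal.ofReal (2 * Real.pi) * (volume B * ‖F x‖ₑ) ≤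
      ENNReal.ofReal (2 * Real.pi) * ∫⁻ w in closedBall x r, ‖F w‖ₑ := by
    calc _ = ∫⁻ w in B, ENNReal.ofReal (2 * Real.pi) * ‖F x‖ₑ := by
            rw [setLIntegral_const]; ring
      _ ≤ ∫⁻ w in B, ∫⁻ θ in Ioc 0 (2 * Real.pi), ‖F (x + circleMap 0 1 θ • w)‖ₑ :=
            setLIntegral_mono' hBm fun w hw => mv_point hF hb hw
      _ = _ := by
            rw [hswap]; simp_rw [hrot]
            rw [setLIntegral_const]; simp [mul_comm]
  exact (ENNReal.mul_le_mul_iff_right (by simp [Real.pi_pos]) ENNReal.ofReal_ne_top).1 hle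

/-- Norms of holomorphic functions are controlled, locally uniformly, by the `L²` norm. -/
theorem local_bound {n : ℕ} {U : Set (Fin n → ℂ)} {ν : Measure (Fin n → ℂ)}
    (hν : ∀ K ⊆ U, IsCompact K → ∃ C : ℝ≥0∞, C ≠ ∞ ∧ volume.restrict K ≤ C • ν)
    {z : Fin n → ℂ} {r : ℝ} (hr : 0 < r) (hb : closedBall z (2 * r) ⊆ U) :
    ∃ A : ℝ≥0∞, A ≠ ∞ ∧ ∀ F : (Fin n → ℂ) → ℂ, DifferentiableOn ℂ F U →
      ∀ x ∈ ball z r, ‖F x‖ₑ ≤ A * eLpNorm F 2 ν := by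
  obtain ⟨C, hC, hle⟩ := hν _ hb (isCompact_closedBall z (2 * r))
  have hpos : volume (closedBall (0 : Fin n → ℂ) r) ≠ 0 :=
    (measure_closedBall_pos volume _ hr).ne'
  have hfin : volume (closedBall (0 : Fin n → ℂ) r) ≠ ∞ := (isCompact_closedBall _ _).measure_ne_top
  have hfin2 : volume (closedBall z (2 * r)) ≠ ∞ := (isCompact_closedBall _ _).measure_ne_top
  refine ⟨(volume (closedBall (0 : Fin n → ℂ) r))⁻¹ *
    (C ^ (1 / (2 : ℝ)) * volume (closedBall z (2 * r)) ^ (1 / (2 : ℝ))), ?_, ?_⟩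
  · refine ENNReal.mul_ne_top (ENNReal.inv_ne_top.2 hpos) (ENNReal.mul_ne_top ?_ ?_)
    · exact ENNReal.rpow_ne_top_of_nonneg (by norm_num) hC
    · exact ENNReal.rpow_ne_top_of_nonneg (by norm_num) hfin2
  · intro F hF x hx
    have hsub : closedBall x r ⊆ closedBall z (2 * r) := by
      apply closedBall_subset_closedBall'
      have := mem_ball.1 hx
      linarith
    have hm : AEStronglyMeasurable F (volume.restrict (closedBall z (2 * r))) :=
      (hF.continuousOn.mono hb).aestronglyMeasurable isClosed_closedBall.measurableSet
    have h1 := mv_ball hF (hsub.trans hb)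
    have h2 : ∫⁻ w in closedBall x r, ‖F w‖ₑ ≤
        eLpNorm F 2 ν * (C ^ (1 / (2 : ℝ)) * volume (closedBall z (2 * r)) ^ (1 / (2 : ℝ))) := by
      calc _ ≤ ∫⁻ w in closedBall z (2 * r), ‖F w‖ₑ := lintegral_mono_set hsub
        _ = eLpNorm F 1 (volume.restrict (closedBall z (2 * r))) := eLpNorm_one_eq_lintegral_enorm.symm
        _ ≤ eLpNorm F 2 (volume.restrict (closedBall z (2 * r))) *
              volume (closedBall z (2 * r)) ^ (1 / (2 : ℝ)) := by
            have := eLpNorm_le_eLpNorm_mul_rpow_measure_univ (p := 1) (q := 2) one_le_two hm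
            refine this.trans (le_of_eq ?_)
            norm_num
        _ ≤ (C ^ (1 / (2 : ℝ)) * eLpNorm F 2 ν) * volume (closedBall z (2 * r)) ^ (1 / (2 : ℝ)) := by
            gcongr
            refine (eLpNorm_mono_measure F hle).trans (le_of_eq ?_)
            rw [eLpNorm_smul_measure_of_ne_top (by norm_num)]
            norm_num
        _ = _ := by ring
    calc ‖F x‖ₑ = (volume (closedBall (0 : Fin n → ℂ) r))⁻¹ *
            (volume (closedBall (0 : Fin n → ℂ) r) * ‖F x‖ₑ) := by
          rw [← mul_assoc, ENNReal.inv_mul_cancel hpos hfin, one_mul]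
      _ ≤ (volume (closedBall (0 : Fin n → ℂ) r))⁻¹ * (eLpNorm F 2 ν *
            (C ^ (1 / (2 : ℝ)) * volume (closedBall z (2 * r)) ^ (1 / (2 : ℝ)))) := by
          exact mul_le_mul_right (h1.trans h2) _
      _ = _ := by ring

theorem fderiv_bound {n : ℕ} {F : (Fin n → ℂ) → ℂ} {z x : Fin n → ℂ} {r ε : ℝ} (hr : 0 < r)
    (hF : DifferentiableOn ℂ F (ball z r)) (hε : ∀ y ∈ ball z r, ‖F y‖ ≤ ε) (hx : x ∈ ball z (r / 2)) :
    ‖fderiv ℂ F x‖ ≤ 2 * ε / (r / 2) := by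
  have hsub : ball x (r / 2) ⊆ ball z r := by
    apply ball_subset_ball'
    have := mem_ball.1 hx
    linarith
  refine Complex.norm_fderiv_le_div_of_mapsTo_ball (hF.mono hsub) ?_ (by positivity)
  intro y hy
  rw [mem_closedBall, dist_eq_norm]
  have h1 := hε y (hsub hy)
  have h2 := hε x (hsub (mem_ball_self (by positivity)))
  linarith [norm_sub_le (F y) (F x)]

/-- A sequence of holomorphic functions which is locally uniformly Cauchy converges to a
holomorphic function. -/
theorem limit_holo {n : ℕ} {U : Set (Fin n → ℂ)} (hU : IsOpen U) {F : ℕ → (Fin n → ℂ) → ℂ}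
    (hF : ∀ k, DifferentiableOn ℂ (F k) U)
    (hc : ∀ z ∈ U, ∃ r > 0, ball z r ⊆ U ∧ UniformCauchySeqOn F atTop (ball z r)) :
    ∃ G : (Fin n → ℂ) → ℂ, DifferentiableOn ℂ G U ∧
      ∀ z ∈ U, Tendsto (fun k => F k z) atTop (𝓝 (G z)) := by
  have hpt : ∀ z : Fin n → ℂ, ∃ y, z ∈ U → Tendsto (fun k => F k z) atTop (𝓝 y) := by
    intro z
    by_cases hz : z ∈ U
    · obtain ⟨r, hr, -, h⟩ := hc z hz
      obtain ⟨y, hy⟩ := cauchySeq_tendsto_of_complete (h.cauchySeq (mem_ball_self hr))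
      exact ⟨y, fun _ => hy⟩
    · exact ⟨0, fun h => absurd h hz⟩
  choose G hG using hpt
  refine ⟨G, fun z hz => ?_, hG⟩
  obtain ⟨r, hr, hsub, h⟩ := hc z hz
  have hd : UniformCauchySeqOn (fun k => fderiv ℂ (F k)) atTop (ball z (r / 2)) := by
    rw [Metric.uniformCauchySeqOn_iff] at h ⊢
    intro ε hε
    obtain ⟨N, hN⟩ := h (ε * r / 8) (by positivity)
    refine ⟨N, fun k hk m hm x hx => ?_⟩
    have hxU : U ∈ 𝓝 x :=
      hU.mem_nhds (hsub (ball_subset_ball (by linarith) hx))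
    rw [dist_eq_norm, ← fderiv_sub ((hF k).differentiableAt hxU) ((hF m).differentiableAt hxU)]
    have := fderiv_bound (F := F k - F m) (ε := ε * r / 8) hr (((hF k).sub (hF m)).mono hsub)
      (fun y hy => by
        have := hN k hk m hm y hy
        rw [dist_eq_norm] at this
        exact this.le) hx
    refine this.trans_lt ?_
    have : 2 * (ε * r / 8) / (r / 2) = ε / 2 := by field_simp; norm_num
    rw [this]; linarith
  have hpt2 : ∀ x : Fin n → ℂ, ∃ y, x ∈ ball z (r / 2) →
      Tendsto (fun k => fderiv ℂ (F k) x) atTop (𝓝 y) := by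
    intro x
    by_cases hx : x ∈ ball z (r / 2)
    · obtain ⟨y, hy⟩ := cauchySeq_tendsto_of_complete (hd.cauchySeq hx)
      exact ⟨y, fun _ => hy⟩
    · exact ⟨0, fun h => absurd h hx⟩
  choose G' hG' using hpt2
  have hmem : ∀ x ∈ ball z (r / 2), x ∈ U := fun x hx =>
    hsub (ball_subset_ball (by linarith) hx)
  have hfin := hasFDerivAt_of_tendstoUniformlyOn (𝕜 := ℂ) isOpen_ball
    (hd.tendstoUniformlyOn_of_tendsto fun x hx => hG' x hx)
    (fun k x hx => ((hF k).differentiableAt (hU.mem_nhds (hmem x hx))).hasFDerivAt)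
    (fun x hx => hG x (hmem x hx)) (mem_ball_self (by positivity : 0 < r / 2))
  exact hfin.differentiableAt.differentiableWithinAt

/-- Classes of holomorphic functions form a closed set in `L²`. -/
theorem isClosed_holo {n : ℕ} {U : Set (Fin n → ℂ)} (hU : IsOpen U) {ν : Measure (Fin n → ℂ)}
    (hν : ∀ K ⊆ U, IsCompact K → ∃ C : ℝ≥0∞, C ≠ ∞ ∧ volume.restrict K ≤ C • ν)
    (hs : ∀ᵐ z ∂ν, z ∈ U) :
    IsClosed {f : Lp ℂ 2 ν | ∃ F : (Fin n → ℂ) → ℂ, DifferentiableOn ℂ F U ∧ f =ᵐ[ν] F} := by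
  refine isClosed_of_closure_subset fun f hf => ?_
  obtain ⟨u, hu, hlim⟩ := mem_closure_iff_seq_limit.1 hf
  choose F hF hFu using hu
  have hdist : ∀ k m, eLpNorm (F k - F m) 2 ν = edist (u k) (u m) := by
    intro k m
    rw [Lp.edist_def]
    exact eLpNorm_congr_ae ((hFu k).symm.sub (hFu m).symm)
  have hcau := hlim.cauchySeq
  obtain ⟨G, hG, hlimG⟩ := limit_holo hU hF (by
    intro z hz
    obtain ⟨R, hR, hRU⟩ := Metric.isOpen_iff.1 hU z hz
    have hb : closedBall z (2 * (R / 4)) ⊆ U :=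
      (closedBall_subset_ball (by linarith)).trans hRU
    obtain ⟨A, hA, hbound⟩ := local_bound hν (by positivity : 0 < R / 4) hb
    refine ⟨R / 4, by positivity, (ball_subset_ball (by linarith)).trans hRU, ?_⟩
    rw [Metric.uniformCauchySeqOn_iff]
    intro ε hε
    obtain ⟨N, hN⟩ := Metric.cauchySeq_iff.1 hcau (ε / (A.toReal + 1)) (by positivity)
    refine ⟨N, fun k hk m hm x hx => ?_⟩
    have h1 := hbound (F k - F m) ((hF k).sub (hF m)) x hx
    rw [hdist, Pi.sub_apply, ← edist_eq_enorm_sub] at h1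
    have h2 := ENNReal.toReal_mono (ENNReal.mul_ne_top hA (edist_ne_top _ _)) h1
    rw [ENNReal.toReal_mul, ← dist_edist, ← dist_edist] at h2
    have h3 := hN k hk m hm
    rw [lt_div_iff₀ (by positivity)] at h3
    nlinarith [dist_nonneg (x := u k) (y := u m)])
  refine ⟨G, hG, ?_⟩
  obtain ⟨ns, hns, hae⟩ := (tendstoInMeasure_of_tendsto_Lp hlim).exists_seq_tendsto_ae
  have hall : ∀ᵐ z ∂ν, ∀ k, u k z = F k z := ae_all_iff.2 hFu
  filter_upwards [hae, hall, hs] with z h1 h2 h3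
  refine tendsto_nhds_unique h1 ?_
  simp only [h2]
  exact (hlimG z h3).comp hns.tendsto_atTop

end Closed

/-! ### Bergman spaces and Toeplitz operators -/

/-- The weighted Bergman space: the holomorphic functions on the domain that belong to `L²(v)`. -/
def bergman (n : ℕ) (l : ℝ) : Submodule ℂ (Lp ℂ 2 (v n l)) where
  carrier := {f | ∃ F : (Fin n → ℂ) → ℂ, DifferentiableOn ℂ F (D n) ∧ f =ᵐ[v n l] F}
  zero_mem' := ⟨0, differentiableOn_const 0, Lp.coeFn_zero _ _ _⟩
  add_mem' := by
    rintro f g ⟨F, hF, hf⟩ ⟨K, hK, hg⟩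
    exact ⟨F + K, hF.add hK, (Lp.coeFn_add f g).trans (hf.add hg)⟩
  smul_mem' := by
    rintro c f ⟨F, hF, hf⟩
    exact ⟨c • F, hF.const_smul c, (Lp.coeFn_smul c f).trans (hf.const_smul c)⟩

theorem isClosed_bergman (n : ℕ) (l : ℝ) : IsClosed (bergman n l : Set (Lp ℂ 2 (v n l))) := by
  rcases v_eq_zero_or n l with h | ⟨h0, ht⟩
  · convert isClosed_univ
    refine Set.eq_univ_of_forall fun f => ⟨0, differentiableOn_const 0, ?_⟩
    have hz : ae (v n l) = ⊥ := ae_eq_bot.2 h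
    change ∀ᵐ z ∂v n l, _
    rw [hz]
    exact Filter.eventually_bot
  · refine isClosed_holo (isOpen_D n) (fun K hK hc => ?_) ?_
    · obtain ⟨C, hC, hle⟩ := restrict_le_v₀ n l hK hc
      refine ⟨C * v₀ n l Set.univ, ENNReal.mul_ne_top hC (ENNReal.inv_ne_zero.1 h0), ?_⟩
      rw [v, smul_smul, mul_assoc,
        ENNReal.mul_inv_cancel (ENNReal.inv_ne_top.1 ht) (ENNReal.inv_ne_zero.1 h0), mul_one]
      exact hle
    · rw [v, Measure.ae_ennreal_smul_measure_iff h0, ae_v₀_iff]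
      exact Filter.Eventually.of_forall fun z hz => hz

instance (n : ℕ) (l : ℝ) : CompleteSpace (bergman n l) :=
  (isClosed_bergman n l).completeSpace_coe

/-- The space `L^∞` of the domain (the measures `v n l`, `l > n - 1`, have the same null sets). -/
abbrev Linf (n : ℕ) (l : ℝ) := Lp ℂ ∞ (v n l)

/-- The multiplication operator `M_a` on `L²(v)`. -/
def mulOp {n : ℕ} {l : ℝ} (a : Linf n l) : Lp ℂ 2 (v n l) →L[ℂ] Lp ℂ 2 (v n l) :=
  (ContinuousLinearMap.mul ℂ ℂ).holderL (v n l) ∞ 2 2 a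

/-- The Toeplitz operator `T_a f = B (a f)` on the Bergman space, where `B` is the orthogonal
projection of `L²(v)` onto the Bergman space. -/
def toeplitz {n : ℕ} {l : ℝ} (a : Linf n l) : bergman n l →L[ℂ] bergman n l :=
  (bergman n l).orthogonalProjectionOnto ∘L mulOp a ∘L (bergman n l).subtypeL

/-- The essentially bounded symbols `a` such that `a ∘ h⁻¹ = a` in `L^∞` for all `h ∈ H`. -/
def invSymbols {n : ℕ} (l : ℝ) (H : Subgroup (G n)) : Set (Linf n l) :=
  {a | ∀ h ∈ H, (fun z => a (act h⁻¹ z)) =ᵐ[v n l] a}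

theorem star_toeplitz {n : ℕ} {l : ℝ} (a : Linf n l) : star (toeplitz a) = toeplitz (star a) := by
  rw [ContinuousLinearMap.star_eq_adjoint]
  symm
  rw [ContinuousLinearMap.eq_adjoint_iff]
  intro f g
  change inner ℂ ((bergman n l).orthogonalProjectionOnto (mulOp (star a) f)) g =
    inner ℂ f ((bergman n l).orthogonalProjectionOnto (mulOp a g))
  rw [Submodule.inner_orthogonalProjectionOnto_eq_of_mem_right,
    Submodule.inner_orthogonalProjectionOnto_eq_of_mem_left]
  simp only [L2.inner_def]
  refine integral_congr_ae ?_
  have h1 := ContinuousLinearMap.coeFn_holder (r := 2) (ContinuousLinearMap.mul ℂ ℂ) (star a)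
    (f : Lp ℂ 2 (v n l))
  have h2 := ContinuousLinearMap.coeFn_holder (r := 2) (ContinuousLinearMap.mul ℂ ℂ) a
    (g : Lp ℂ 2 (v n l))
  filter_upwards [h1, h2, Lp.coeFn_star a] with z h1 h2 h3
  have h1' : (mulOp (star a) f : Lp ℂ 2 (v n l)) z = _ := h1
  have h2' : (mulOp a g : Lp ℂ 2 (v n l)) z = _ := h2
  rw [h1', h2', h3]
  simp
  ring

theorem star_mem_invSymbols {n : ℕ} {l : ℝ} {H : Subgroup (G n)} {a : Linf n l}
    (ha : a ∈ invSymbols l H) : star a ∈ invSymbols l H := by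
  intro h hh
  have h1 := Lp.coeFn_star a
  filter_upwards [ha h hh, h1, ae_act (h⁻¹) h1] with z h2 h3 h4
  rw [h4, h3, Pi.star_apply, Pi.star_apply]
  exact congrArg star h2

theorem isSemitop_aux {E : Type*} [NormedAddCommGroup E] [InnerProductSpace ℂ E] :
    IsSemitopologicalSemiring (E →L[ℂ] E) := inferInstance
theorem contStar_aux {E : Type*} [NormedAddCommGroup E] [InnerProductSpace ℂ E] [CompleteSpace E] :
    ContinuousStar (E →L[ℂ] E) := inferInstance

instance (n : ℕ) (l : ℝ) : IsSemitopologicalSemiring (bergman n l →L[ℂ] bergman n l) :=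
  isSemitop_aux

instance (n : ℕ) (l : ℝ) : ContinuousStar (bergman n l →L[ℂ] bergman n l) := contStar_aux

/-- The unital Banach algebra generated by the Toeplitz operators with `H`-invariant symbols (the
operator norm closure of the unital algebra that they generate). It is closed under adjoints, so
that it is also the unital C⋆-algebra generated by these operators. -/
def toeplitzAlgebra {n : ℕ} (l : ℝ) (H : Subgroup (G n)) :
    StarSubalgebra ℂ (bergman n l →L[ℂ] bergman n l) where
  toSubalgebra := (Algebra.adjoin ℂ (toeplitz '' invSymbols l H)).topologicalClosure
  star_mem' := by
    intro T hT
    refine map_mem_closure continuous_star hT ?_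
    intro S hS
    induction hS using Algebra.adjoin_induction with
    | mem S hS =>
      obtain ⟨a, ha, rfl⟩ := hS
      rw [star_toeplitz]
      exact Algebra.subset_adjoin ⟨star a, star_mem_invSymbols ha, rfl⟩
    | algebraMap c =>
      rw [← algebraMap_star_comm]
      exact Subalgebra.algebraMap_mem _ _
    | add S T _ _ hS hT => rw [star_add]; exact add_mem hS hT
    | mul S T _ _ hS hT => rw [star_mul]; exact mul_mem hT hS

end TypeIV

end

/-! Maximality. The last entry of the last column is a continuous height on `SO(n) × SO(2)`, and it
equals 1 exactly on the corner subgroup. For n ≥ 3 two elements of equal height lie in the same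
double coset of that subgroup, because `SO(n - 1)` is transitive on spheres. A connected K strictly
above the corner subgroup attains an interval of heights ending at 1. It therefore contains a
neighbourhood of the identity, so it is clopen in a connected group, hence everything
(`cornerProd_maximal`).

Commutativity. Let J be the conjugation f ↦ conj (f (conj z)). For n ≥ 3 every conj z lies in the
orbit of z (`exists_act_eq_star`). If T commutes with the full group, then the adjoint of T and J T
J have the same Berezin transform ⟨k_z, · k_z⟩, where k_z is the reproducing kernel. Since an
operator is determined by its Berezin transform (`eq_zero_of_berezin`), taking adjoints coincides
with T ↦ J T J (`star_eq_conjConj`). One map reverses products and the other preserves them, so a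
star algebra of such operators is commutative.

Noncommutativity. For the corner group, Toeplitz operators with invariant symbols preserve the plane
spanned by the quadratic forms z_1² + ... + z_{n-1}² and z_n² (`exists_toeplitz_eq`). Take the
orthogonal basis F₁ = z_n² and F₂ of this plane. If all the operators commuted, an off-diagonal
entry of the commutator of T_a and T_b would give, for fixed a, a linear relation between the
integrals of b against conj F₁ · F₂, |F₁|² and |F₂|². As b is an arbitrary invariant symbol, the
relation holds pointwise on the domain (`conj_mul_relation`). At a point where F₂ = 0 ≠ F₁ it gives
⟨F₁, T_a F₂⟩ = 0 for every a. Then conj F₁ · F₂ vanishes on the domain, which is absurd.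

All of this needs `v` to be a probability measure, that is, Δ ^ (l - n) to be integrable for l > n -
1 (`lintegral_Δ_rpow_lt_top`). -/

noncomputable section

namespace TypeIV

/-! ### Rotations, connectedness of SO(m), and maximality of the corner subgroup. -/

section Rotations

open Matrix

/-- The reflection in the hyperplane orthogonal to `v`. -/
def householder {m : ℕ} (v : Fin m → ℝ) : Matrix (Fin m) (Fin m) ℝ :=
  1 - (2 / (v ⬝ᵥ v)) • Matrix.vecMulVec v v

theorem householder_mulVec {m : ℕ} (v x : Fin m → ℝ) :
    householder v *ᵥ x = x - (2 / (v ⬝ᵥ v) * (v ⬝ᵥ x)) • v := by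
  ext i
  simp [householder, sub_mulVec, smul_mulVec, vecMulVec_mulVec]
  ring

theorem householder_transpose {m : ℕ} (v : Fin m → ℝ) : (householder v)ᵀ = householder v := by
  simp [householder, transpose_vecMulVec]

theorem householder_mul_self {m : ℕ} (v : Fin m → ℝ) : householder v * householder v = 1 := by
  by_cases hv : v = 0
  · simp [hv, householder]
  have h : v ⬝ᵥ v ≠ 0 := by simpa using hv
  rw [householder, sub_mul, mul_sub, mul_sub, one_mul, mul_one, smul_mul_smul_comm,
    vecMulVec_mul_vecMulVec]
  ext i j
  simp [vecMulVec_apply]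
  field_simp
  ring

theorem det_householder {m : ℕ} {v : Fin m → ℝ} (hv : v ≠ 0) : (householder v).det = -1 := by
  have h : v ⬝ᵥ v ≠ 0 := by simpa using hv
  have : householder v = 1 + replicateCol Unit (-(2 / (v ⬝ᵥ v)) • v) * replicateRow Unit v := by
    rw [← vecMulVec_eq, smul_vecMulVec, neg_smul, householder, sub_eq_add_neg]
  rw [this, det_one_add_replicateCol_mul_replicateRow, dotProduct_smul, smul_eq_mul]
  field_simp
  ring

/-- The product of two reflections is a rotation. -/
def rotation₂ {m : ℕ} {u v : Fin m → ℝ} (hu : u ≠ 0) (hv : v ≠ 0) : SO m :=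
  ⟨householder u * householder v, by
    rw [mem_specialOrthogonalGroup_iff, det_mul, det_householder hu, det_householder hv,
      mem_orthogonalGroup_iff]
    refine ⟨?_, by norm_num⟩
    rw [transpose_mul,
      householder_transpose, householder_transpose, Matrix.mul_assoc,
      ← Matrix.mul_assoc (householder v), householder_mul_self, Matrix.one_mul,
      householder_mul_self]⟩

theorem exists_orthogonal {k m : ℕ} (h : k < m) (w : Fin k → Fin m → ℝ) :
    ∃ f : Fin m → ℝ, f ≠ 0 ∧ ∀ i, w i ⬝ᵥ f = 0 := by
  have h1 := LinearMap.ker_ne_bot_of_finrank_lt (f := (Matrix.of w).mulVecLin) (by simpa using h)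
  obtain ⟨f, hf, hf0⟩ := (Submodule.ne_bot_iff _).1 h1
  exact ⟨f, hf0, fun i => congrFun (LinearMap.mem_ker.1 hf) i⟩

/-- `SO(m)` acts transitively on spheres. -/
theorem exists_SO_mulVec {m : ℕ} (hm : 2 ≤ m) {x y : Fin m → ℝ} (h : x ⬝ᵥ x = y ⬝ᵥ y) :
    ∃ A : SO m, (A : Matrix (Fin m) (Fin m) ℝ) *ᵥ x = y := by
  by_cases hxy : x = y
  · exact ⟨1, by simp [hxy]⟩
  obtain ⟨f, hf, hfx⟩ := exists_orthogonal (show 1 < m by omega) (fun _ => x)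
  have hne : x - y ≠ 0 := sub_ne_zero.2 hxy
  -- The reflection along x - y carries x to y. The reflection along f, which is orthogonal to x,
  -- fixes x and only restores the determinant to 1.
  refine ⟨rotation₂ hne hf, ?_⟩
  change (householder (x - y) * householder f) *ᵥ x = y
  rw [← mulVec_mulVec, householder_mulVec f, dotProduct_comm f x, hfx 0, mul_zero, zero_smul, sub_zero,
    householder_mulVec]
  have h0 : (x - y) ⬝ᵥ (x - y) ≠ 0 := fun h => hne (dotProduct_self_eq_zero.1 h)
  have h2 : (x - y) ⬝ᵥ (x - y) = 2 * ((x - y) ⬝ᵥ x) := by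
    simp only [sub_dotProduct, dotProduct_sub, dotProduct_comm y x, ← h]
    ring
  have h3 : 2 / ((x - y) ⬝ᵥ (x - y)) * ((x - y) ⬝ᵥ x) = 1 := by
    rw [div_mul_eq_mul_div, ← h2, div_self h0]
  rw [h3, one_smul]
  abel

theorem SO.transpose_mul_self {m : ℕ} (A : SO m) :
    (A : Matrix (Fin m) (Fin m) ℝ)ᵀ * (A : Matrix (Fin m) (Fin m) ℝ) = 1 :=
  (mem_orthogonalGroup_iff' (Fin m) ℝ).1 (mem_specialOrthogonalGroup_iff.1 A.2).1

theorem SO.mul_transpose_self {m : ℕ} (A : SO m) :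
    (A : Matrix (Fin m) (Fin m) ℝ) * (A : Matrix (Fin m) (Fin m) ℝ)ᵀ = 1 :=
  (mem_orthogonalGroup_iff (Fin m) ℝ).1 (mem_specialOrthogonalGroup_iff.1 A.2).1

theorem SO.dotProduct_mulVec {m : ℕ} (A : SO m) (x y : Fin m → ℝ) :
    ((A : Matrix (Fin m) (Fin m) ℝ) *ᵥ x) ⬝ᵥ ((A : Matrix (Fin m) (Fin m) ℝ) *ᵥ y) = x ⬝ᵥ y := by
  rw [Matrix.dotProduct_mulVec, ← mulVec_transpose, mulVec_mulVec, A.transpose_mul_self,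
    one_mulVec]

/-- Compactness makes the map onto the sphere in the connectedness proof closed, hence a quotient
map. -/
instance (m : ℕ) : CompactSpace (SO m) := by
  refine isCompact_iff_compactSpace.1 ?_
  refine (isCompact_univ_pi fun _ : Fin m => isCompact_univ_pi fun _ : Fin m =>
    isCompact_Icc (a := (-1 : ℝ)) (b := 1)).of_isClosed_subset ?_ ?_
  · have : ((specialOrthogonalGroup (Fin m) ℝ : Submonoid _) : Set (Matrix (Fin m) (Fin m) ℝ)) =
        {A | A * Aᵀ = 1 ∧ A.det = 1} := by
      ext A
      exact mem_specialOrthogonalGroup_iff.trans (and_congr_left' (mem_orthogonalGroup_iff _ _))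
    rw [this]
    refine IsClosed.and (isClosed_eq ?_ continuous_const) (isClosed_eq ?_ continuous_const)
    · exact continuous_id.matrix_mul continuous_id.matrix_transpose
    · exact continuous_id.matrix_det
  · intro A hA i _ j _
    have := entry_norm_bound_of_unitary (mem_specialOrthogonalGroup_iff.1 hA).1 i j
    exact abs_le.1 this

/-- The upper left corner embedding of matrices of size `k`. -/
def corner {k : ℕ} (B : Matrix (Fin k) (Fin k) ℝ) : Matrix (Fin (k + 1)) (Fin (k + 1)) ℝ :=
  cornerEmb (k + 1) B

theorem corner_one (k : ℕ) : corner (1 : Matrix (Fin k) (Fin k) ℝ) = 1 := cornerEmb_one (k + 1)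

theorem corner_mul {k : ℕ} (B C : Matrix (Fin k) (Fin k) ℝ) :
    corner (B * C) = corner B * corner C := cornerEmb_mul (k + 1) B C

theorem corner_transpose {k : ℕ} (B : Matrix (Fin k) (Fin k) ℝ) : corner Bᵀ = (corner B)ᵀ :=
  cornerEmb_transpose (k + 1) B

theorem corner_apply_castSucc {k : ℕ} (B : Matrix (Fin k) (Fin k) ℝ) (i j : Fin k) :
    corner B i.castSucc j.castSucc = B i j := by
  simp [corner, cornerEmb]

theorem corner_apply_last {k : ℕ} (B : Matrix (Fin k) (Fin k) ℝ) (j : Fin (k + 1)) :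
    corner B (Fin.last k) j = if j = Fin.last k then 1 else 0 := by
  simp [corner, cornerEmb, eq_comm]

theorem corner_apply_last' {k : ℕ} (B : Matrix (Fin k) (Fin k) ℝ) (j : Fin (k + 1)) :
    corner B j (Fin.last k) = if j = Fin.last k then 1 else 0 := by
  simp [corner, cornerEmb]

theorem det_corner {k : ℕ} (B : Matrix (Fin k) (Fin k) ℝ) :
    (corner B).det = B.det := by
  rw [det_succ_row _ (Fin.last k), Finset.sum_eq_single (Fin.last k)]
  · have : (corner B).submatrix (Fin.last k).succAbove (Fin.last k).succAbove = B := by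
      ext i j
      simp [corner_apply_castSucc]
    rw [this]
    simp [corner_apply_last, ← two_mul]
  · intro j _ hj
    simp [corner_apply_last, hj]
  · simp

theorem corner_injective (k : ℕ) : Function.Injective (corner (k := k)) := by
  intro B C h
  ext i j
  rw [← corner_apply_castSucc B, h, corner_apply_castSucc]

theorem corner_mem_iff {k : ℕ} (B : Matrix (Fin k) (Fin k) ℝ) :
    corner B ∈ specialOrthogonalGroup (Fin (k + 1)) ℝ ↔
      B ∈ specialOrthogonalGroup (Fin k) ℝ := by
  rw [mem_specialOrthogonalGroup_iff, mem_specialOrthogonalGroup_iff, det_corner,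
    mem_orthogonalGroup_iff, mem_orthogonalGroup_iff]
  refine and_congr_left' ?_
  change corner B * (corner B)ᵀ = 1 ↔ B * Bᵀ = 1
  rw [← corner_transpose, ← corner_mul, ← corner_one]
  exact (corner_injective k).eq_iff

/-- The corner embedding of `SO(k)` into `SO(k + 1)`. -/
def cornerSOEmb {k : ℕ} (B : SO k) : SO (k + 1) := ⟨corner B, (corner_mem_iff _).2 B.2⟩

theorem continuous_cornerSOEmb (k : ℕ) : Continuous (cornerSOEmb (k := k)) := by
  refine Continuous.subtype_mk ?_ _
  refine continuous_matrix fun i j => ?_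
  change Continuous fun B : SO k => corner (B : Matrix (Fin k) (Fin k) ℝ) i j
  simp only [corner, cornerEmb, of_apply]
  split_ifs
  · exact (continuous_subtype_val.matrix_elem _ _)
  · exact continuous_const
  · exact continuous_const

theorem mem_cornerSO {k : ℕ} (A : SO (k + 1)) : A ∈ cornerSO (k + 1) ↔ ∃ B : SO k, A = cornerSOEmb B :=
  exists_congr fun B => (Subtype.ext_iff (a1 := A) (a2 := cornerSOEmb B)).symm

/-- The subgroup `SO(k)` is the stabilizer of the last basis vector. -/
theorem mem_cornerSO_iff {k : ℕ} (A : SO (k + 1)) :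
    A ∈ cornerSO (k + 1) ↔ (A : Matrix _ _ ℝ) (Fin.last k) (Fin.last k) = 1 := by
  constructor
  · rintro ⟨B, hB⟩
    rw [hB]
    exact (corner_apply_last _ _).trans (if_pos rfl)
  intro h
  set M := (A : Matrix (Fin (k + 1)) (Fin (k + 1)) ℝ) with hM
  -- The last row and the last column are unit vectors, so a corner entry 1 forces their other
  -- entries to vanish.
  have hrow : ∑ j : Fin k, M (Fin.last k) j.castSucc ^ 2 = 0 := by
    have := congrFun (congrFun A.mul_transpose_self (Fin.last k)) (Fin.last k)
    rw [mul_apply, Fin.sum_univ_castSucc] at this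
    simp only [transpose_apply, one_apply_eq, ← hM, h] at this
    simp only [sq]
    linarith
  have hcol : ∑ j : Fin k, M j.castSucc (Fin.last k) ^ 2 = 0 := by
    have := congrFun (congrFun A.transpose_mul_self (Fin.last k)) (Fin.last k)
    rw [mul_apply, Fin.sum_univ_castSucc] at this
    simp only [transpose_apply, one_apply_eq, ← hM, h] at this
    simp only [sq]
    linarith
  rw [Finset.sum_eq_zero_iff_of_nonneg fun _ _ => sq_nonneg _] at hrow hcol
  have hMB : M = corner (of fun i j : Fin k => M i.castSucc j.castSucc) := by
    ext i j
    induction i using Fin.lastCases with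
    | last =>
      rw [corner_apply_last]
      induction j using Fin.lastCases with
      | last => simp [h]
      | cast j => simpa [(Fin.castSucc_lt_last j).ne] using hrow j (Finset.mem_univ _)
    | cast i =>
      induction j using Fin.lastCases with
      | last =>
        rw [corner_apply_last']
        simpa [(Fin.castSucc_lt_last i).ne] using hcol i (Finset.mem_univ _)
      | cast j => rw [corner_apply_castSucc]; rfl
  refine ⟨⟨of fun i j : Fin k => M i.castSucc j.castSucc, ?_⟩, hMB⟩
  rw [← corner_mem_iff, ← hMB]
  exact A.2

/-- The last column of a matrix. -/
def lastCol {k : ℕ} (A : SO (k + 1)) : Fin (k + 1) → ℝ :=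
  fun i => (A : Matrix (Fin (k + 1)) (Fin (k + 1)) ℝ) i (Fin.last k)

theorem lastCol_eq {k : ℕ} (A : SO (k + 1)) :
    lastCol A = (A : Matrix _ _ ℝ) *ᵥ Pi.single (Fin.last k) 1 := by
  ext i; simp [lastCol]

/-- The last column is the image of the last basis vector, so the fibres of `lastCol` are the left
cosets of the stabilizer `SO(k)`. -/
theorem inv_mul_mem_cornerSO {k : ℕ} {A A' : SO (k + 1)} (h : lastCol A = lastCol A') :
    A⁻¹ * A' ∈ cornerSO (k + 1) := by
  rw [mem_cornerSO_iff]
  have h2 : ((A⁻¹ * A' : SO (k + 1)) : Matrix (Fin (k + 1)) (Fin (k + 1)) ℝ) *ᵥ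
      Pi.single (Fin.last k) 1 = Pi.single (Fin.last k) 1 := by
    rw [Submonoid.coe_mul, ← mulVec_mulVec, ← lastCol_eq, ← h, lastCol_eq, mulVec_mulVec,
      ← Submonoid.coe_mul, inv_mul_cancel, Submonoid.coe_one, one_mulVec]
  simpa using congrFun h2 (Fin.last k)

theorem lastCol_mul_cornerSOEmb {k : ℕ} (A : SO (k + 1)) (B : SO k) :
    lastCol (A * cornerSOEmb B) = lastCol A := by
  have : ((cornerSOEmb B : SO (k + 1)) : Matrix (Fin (k + 1)) (Fin (k + 1)) ℝ) *ᵥ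
      Pi.single (Fin.last k) 1 = Pi.single (Fin.last k) 1 := by
    ext i
    simp [cornerSOEmb, corner_apply_last', Pi.single_apply]
  rw [lastCol_eq, lastCol_eq, Submonoid.coe_mul, ← mulVec_mulVec, this]

theorem lastCol_cornerSOEmb_mul {k : ℕ} (B : SO k) (A : SO (k + 1)) (i : Fin k) :
    lastCol (cornerSOEmb B * A) i.castSucc =
      ((B : Matrix (Fin k) (Fin k) ℝ) *ᵥ fun j => lastCol A j.castSucc) i := by
  change (corner (B : Matrix (Fin k) (Fin k) ℝ) * (A : Matrix _ _ ℝ) :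
    Matrix (Fin (k + 1)) (Fin (k + 1)) ℝ) i.castSucc (Fin.last k) = _
  rw [mul_apply, Fin.sum_univ_castSucc, corner_apply_last']
  simp [corner_apply_castSucc, (Fin.castSucc_lt_last i).ne, mulVec, dotProduct, lastCol]

theorem lastCol_cornerSOEmb_mul_last {k : ℕ} (B : SO k) (A : SO (k + 1)) :
    lastCol (cornerSOEmb B * A) (Fin.last k) = lastCol A (Fin.last k) := by
  change (corner (B : Matrix (Fin k) (Fin k) ℝ) * (A : Matrix _ _ ℝ) :
    Matrix (Fin (k + 1)) (Fin (k + 1)) ℝ) (Fin.last k) (Fin.last k) = _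
  rw [mul_apply, Finset.sum_eq_single (Fin.last k)]
  · simp [corner_apply_last, lastCol]
  · intro j _ hj; simp [corner_apply_last, hj]
  · simp

theorem lastCol_dotProduct_self {k : ℕ} (A : SO (k + 1)) : lastCol A ⬝ᵥ lastCol A = 1 := by
  rw [lastCol_eq, A.dotProduct_mulVec]
  simp

theorem continuous_lastCol (k : ℕ) : Continuous (lastCol (k := k)) :=
  continuous_pi fun _ => continuous_subtype_val.matrix_elem _ _

/-- Induction through the fibration of `SO(k + 1)` over the unit sphere by the last column: a
quotient map with connected base and with fibres the cosets of `SO(k)`. The case `SO(1)` is separate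
because the sphere in ℝ is disconnected. -/
instance (m : ℕ) : ConnectedSpace (SO m) := by
  induction m with
  | zero =>
    have : Subsingleton (SO 0) := ⟨fun A B => Subtype.ext (Subsingleton.elim _ _)⟩
    exact { toPreconnectedSpace := inferInstance, toNonempty := ⟨1⟩ }
  | succ k ih =>
    rcases Nat.eq_zero_or_pos k with rfl | hk
    · have : Subsingleton (SO 1) := by
        have h1 : ∀ A : SO 1, A = 1 := fun A => by
          have h := (mem_specialOrthogonalGroup_iff.1 A.2).2
          rw [det_unique] at h
          apply Subtype.ext
          ext i j
          rw [Subsingleton.elim i default, Subsingleton.elim j default, h]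
          rfl
        exact ⟨fun A B => (h1 A).trans (h1 B).symm⟩
      exact { toPreconnectedSpace := inferInstance, toNonempty := ⟨1⟩ }
    let S := Metric.sphere (0 : EuclideanSpace ℝ (Fin (k + 1))) 1
    have hS : ∀ x : Fin (k + 1) → ℝ, WithLp.toLp 2 x ∈ S ↔ x ⬝ᵥ x = 1 := by
      intro x
      rw [mem_sphere_zero_iff_norm, EuclideanSpace.norm_eq, Real.sqrt_eq_one]
      simp [dotProduct, sq]
    have hSc : IsConnected S := isConnected_sphere (by
      rw [← Module.finrank_eq_rank, finrank_euclideanSpace_fin]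
      exact_mod_cast (by omega : 1 < k + 1)) 0 zero_le_one
    have : ConnectedSpace S := isConnected_iff_connectedSpace.1 hSc
    let f : SO (k + 1) → S := fun A => ⟨WithLp.toLp 2 (lastCol A), (hS _).2 (lastCol_dotProduct_self A)⟩
    have hf : Continuous f :=
      ((PiLp.continuous_toLp 2 _).comp (continuous_lastCol k)).subtype_mk _
    have hsurj : Function.Surjective f := by
      rintro ⟨x, hx⟩
      have hx' : x.ofLp ⬝ᵥ x.ofLp = 1 := (hS _).1 hx
      obtain ⟨A, hA⟩ := exists_SO_mulVec (show 2 ≤ k + 1 by omega)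
        (x := Pi.single (Fin.last k) 1) (y := x.ofLp) (by rw [hx']; simp)
      refine ⟨A, Subtype.ext ?_⟩
      change WithLp.toLp 2 (lastCol A) = x
      rw [lastCol_eq, hA]
    have hq := hf.isClosedMap.isQuotientMap hf hsurj
    have hfib : ∀ t, IsConnected (f ⁻¹' {t}) := by
      intro t
      obtain ⟨A, rfl⟩ := hsurj t
      have : f ⁻¹' {f A} = Set.range fun B : SO k => A * cornerSOEmb B := by
        ext A'
        constructor
        · intro h
          have h2 : lastCol A' = lastCol A := congrArg WithLp.ofLp (Subtype.ext_iff.1 h)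
          obtain ⟨B, hB⟩ := (mem_cornerSO _).1 (inv_mul_mem_cornerSO h2.symm)
          exact ⟨B, by simp only [← hB, mul_inv_cancel_left]⟩
        · rintro ⟨B, rfl⟩
          refine Subtype.ext ?_
          change WithLp.toLp 2 _ = WithLp.toLp 2 _
          rw [lastCol_mul_cornerSOEmb]
      rw [this]
      exact isConnected_range (continuous_const.mul (continuous_cornerSOEmb k))
    have := hq.isCoinducing.isConnected_preimage_of_isClosed hfib isClosed_univ isConnected_univ
    exact connectedSpace_iff_univ.2 this

theorem isConnected_cornerProd (n : ℕ) (hn : 3 ≤ n) : IsConnected (cornerProd n : Set (G n)) := by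
  obtain ⟨k, rfl⟩ : ∃ k, n = k + 1 := ⟨n - 1, by omega⟩
  have : (cornerProd (k + 1) : Set (G (k + 1))) =
      Set.range fun p : SO k × SO 2 => (cornerSOEmb p.1, p.2) := by
    ext ⟨A, t⟩
    constructor
    · rintro ⟨h, -⟩
      obtain ⟨B, rfl⟩ := (mem_cornerSO A).1 h
      exact ⟨(B, t), rfl⟩
    · rintro ⟨⟨B, s⟩, h⟩
      obtain ⟨rfl, rfl⟩ := Prod.ext_iff.1 h
      exact ⟨(mem_cornerSO _).2 ⟨B, rfl⟩, trivial⟩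
  rw [this]
  exact isConnected_range
    (((continuous_cornerSOEmb k).comp continuous_fst).prodMk continuous_snd)

theorem cornerProd_ne_top (n : ℕ) (hn : 3 ≤ n) : cornerProd n ≠ ⊤ := by
  obtain ⟨k, rfl⟩ : ∃ k, n = k + 1 := ⟨n - 1, by omega⟩
  intro h
  obtain ⟨A, hA⟩ := exists_SO_mulVec (show 2 ≤ k + 1 by omega)
    (x := Pi.single (Fin.last k) 1) (y := Pi.single 0 1) (by simp)
  have h1 : ((A, 1) : G (k + 1)) ∈ cornerProd (k + 1) := h ▸ Subgroup.mem_top _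
  have h2 := (mem_cornerSO_iff A).1 h1.1
  have h3 : lastCol A (Fin.last k) = 1 := h2
  rw [lastCol_eq, hA, Pi.single_apply, if_neg] at h3
  · exact zero_ne_one h3
  · simp [Fin.ext_iff]; omega

/-- A connected K that leaves the corner subgroup reaches an interval of heights below 1, and each
height is a single double coset, so K contains a neighbourhood of 1. An open subgroup is closed, so
K would be the whole connected group. -/
theorem cornerProd_maximal {k : ℕ} (hk : 2 ≤ k) {K : Subgroup (G (k + 1))}
    (hK : IsConnected (K : Set (G (k + 1)))) (hle : cornerProd (k + 1) ≤ K) (hne : K ≠ ⊤) :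
    K ≤ cornerProd (k + 1) := by
  let height : G (k + 1) → ℝ := fun g => lastCol g.1 (Fin.last k)
  have hcont : Continuous height :=
    ((continuous_pi_iff.1 (continuous_lastCol k)) (Fin.last k)).comp continuous_fst
  have h1 : height 1 = 1 := by simp [height, lastCol]
  have hle1 : ∀ g, height g ≤ 1 := fun g =>
    (abs_le.1 (entry_norm_bound_of_unitary (mem_specialOrthogonalGroup_iff.1 g.1.2).1 _ _)).2
  by_contra hnot
  obtain ⟨g, hgK, hg⟩ := SetLike.not_le_iff_exists.1 hnot
  have hc : height g < 1 := lt_of_le_of_ne (hle1 g) fun h =>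
    hg ⟨(mem_cornerSO_iff g.1).2 h, trivial⟩
  have hI : Set.Icc (height g) (height 1) ⊆ height '' (K : Set (G (k + 1))) :=
    (hK.isPreconnected.image _ hcont.continuousOn).ordConnected.out ⟨g, hgK, rfl⟩
      ⟨1, K.one_mem, rfl⟩
  -- By connectedness K has an element y of the same height as x. The first k entries of the two
  -- last columns then have equal length, so some B in `SO(k)` matches them, and x lies in (corner)
  -- y (corner).
  have hU : {x | height g < height x} ⊆ (K : Set (G (k + 1))) := by
    intro x hx
    obtain ⟨y, hyK, hy⟩ := hI ⟨(show height g < height x from hx).le, (hle1 x).trans h1.ge⟩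
    have hsum : ∀ A : SO (k + 1), (fun j : Fin k => lastCol A j.castSucc) ⬝ᵥ
        (fun j : Fin k => lastCol A j.castSucc) = 1 - lastCol A (Fin.last k) ^ 2 := by
      intro A
      rw [← lastCol_dotProduct_self A, dotProduct, dotProduct, Fin.sum_univ_castSucc]
      ring
    obtain ⟨B, hB⟩ := exists_SO_mulVec hk (x := fun j => lastCol y.1 j.castSucc)
      (y := fun j => lastCol x.1 j.castSucc) (by
        rw [hsum, hsum]
        have : lastCol y.1 (Fin.last k) = lastCol x.1 (Fin.last k) := hy
        rw [this])
    have hcol : lastCol (cornerSOEmb B * y.1) = lastCol x.1 := by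
      ext i
      induction i using Fin.lastCases with
      | last => rw [lastCol_cornerSOEmb_mul_last]; exact hy
      | cast i => rw [lastCol_cornerSOEmb_mul, hB]
    have hmem := inv_mul_mem_cornerSO hcol
    have hb : ((cornerSOEmb B, 1) : G (k + 1)) ∈ K :=
      hle ⟨(mem_cornerSO _).2 ⟨B, rfl⟩, trivial⟩
    have hz : (((cornerSOEmb B * y.1)⁻¹ * x.1, y.2⁻¹ * x.2) : G (k + 1)) ∈ K :=
      hle ⟨hmem, trivial⟩
    have : x = (cornerSOEmb B, 1) * y * ((cornerSOEmb B * y.1)⁻¹ * x.1, y.2⁻¹ * x.2) := by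
      ext1 <;> simp [mul_assoc]
    rw [this]
    exact K.mul_mem (K.mul_mem hb hyK) hz
  have hopen : IsOpen (K : Set (G (k + 1))) :=
    K.isOpen_of_mem_nhds (g := 1) (Filter.mem_of_superset
      ((isOpen_lt continuous_const hcont).mem_nhds (by simpa [h1] using hc)) hU)
  have huniv := IsClopen.eq_univ ⟨K.isClosed_of_isOpen hopen, hopen⟩ ⟨1, K.one_mem⟩
  exact hne (SetLike.coe_injective (by simpa using huniv))

theorem isMaximalConnected_cornerProd (n : ℕ) (hn : 3 ≤ n) :
    IsMaximalConnected (cornerProd n) := by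
  refine ⟨⟨isConnected_cornerProd n hn, cornerProd_ne_top n hn⟩, ?_⟩
  rintro K ⟨hK, hne⟩ hle
  obtain ⟨k, rfl⟩ : ∃ k, n = k + 1 := ⟨n - 1, by omega⟩
  exact cornerProd_maximal (by omega) hK hle hne

end Rotations

/-! ### Finiteness of the weighted measure for l > n - 1. -/

section FiniteMeasure

open Metric Set

theorem lintegral_unit_disc_lt_top {s : ℝ} (hs : -1 < s) :
    ∫⁻ w in ball (0 : ℂ) 1, ENNReal.ofReal ((1 - ‖w‖ ^ 2) ^ s) < ∞ := by
  -- An antiderivative of the radial density in polar coordinates; it is continuous up to y = 1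
  -- precisely because s + 1 > 0.
  let g : ℝ → ℝ := fun y => -(1 - y ^ 2) ^ (s + 1) / (2 * (s + 1))
  have hd : ∀ y ∈ Ioo (0 : ℝ) 1, HasDerivAt g (y * (1 - y ^ 2) ^ s) y := by
    intro y hy
    have hy1 : 0 < 1 - y ^ 2 := by nlinarith [hy.1, hy.2]
    have h1 : HasDerivAt (fun y : ℝ => 1 - y ^ 2) (-(2 * y)) y := by
      simpa using (hasDerivAt_pow 2 y).const_sub 1
    have h2 := ((h1.rpow_const (p := s + 1) (Or.inl hy1.ne')).neg.div_const (2 * (s + 1)))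
    refine h2.congr_deriv ?_
    have : s + 1 ≠ 0 := by linarith
    rw [add_sub_cancel_right]
    field_simp
  have hc : ContinuousOn g (Icc 0 1) := by
    refine ContinuousOn.div_const (ContinuousOn.neg ?_) _
    exact ContinuousOn.rpow_const (by fun_prop) fun y _ => Or.inr (by linarith)
  have hint : IntegrableOn (fun y : ℝ => y * (1 - y ^ 2) ^ s) (Ioc 0 1) :=
    intervalIntegral.integrableOn_deriv_of_nonneg hc hd fun y hy =>
      mul_nonneg hy.1.le (Real.rpow_nonneg (by nlinarith [hy.1, hy.2]) _)
  let f : ℝ → ℝ := (Iio 1).indicator fun y => (1 - y ^ 2) ^ s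
  have hf : Integrable (fun w : ℂ => f ‖w‖) := by
    rw [integrable_fun_norm_addHaar volume (f := f)]
    have h1 : IntegrableOn ((Iio 1).indicator fun y : ℝ => y * (1 - y ^ 2) ^ s) (Ioi 0) := by
      rw [integrableOn_indicator_iff measurableSet_Iio]
      exact hint.mono_set fun y hy => ⟨hy.2, (mem_Iio.1 hy.1).le⟩
    refine h1.congr_fun (fun y _ => ?_) measurableSet_Ioi
    by_cases hy : y ∈ Iio 1 <;> simp [f, hy]
  have h2 := hf.lintegral_lt_top
  rw [← lintegral_indicator measurableSet_ball]
  convert h2 using 3 with w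
  by_cases hw : ‖w‖ < 1 <;> simp [f, hw]

/-- The integral of `(E - m |w - c|²) ^ s` over the disc where the base is positive. -/
theorem exists_lintegral_disc_le {s : ℝ} (hs : -1 < s) : ∃ C : ℝ≥0∞, C ≠ ∞ ∧
    ∀ (c : ℂ) (E m : ℝ), 0 < E → 0 < m →
      ∫⁻ w, {w : ℂ | m * ‖w - c‖ ^ 2 < E}.indicator
        (fun w => ENNReal.ofReal ((E - m * ‖w - c‖ ^ 2) ^ s)) w ≤
      C * ENNReal.ofReal (E ^ (s + 1) / m) := by
  refine ⟨_, (lintegral_unit_disc_lt_top hs).ne, fun c E m hE hm => ?_⟩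
  let F : ℂ → ℝ≥0∞ := {w : ℂ | m * ‖w‖ ^ 2 < E}.indicator
    fun w => ENNReal.ofReal ((E - m * ‖w‖ ^ 2) ^ s)
  have h1 : ∫⁻ w, {w : ℂ | m * ‖w - c‖ ^ 2 < E}.indicator
        (fun w => ENNReal.ofReal ((E - m * ‖w - c‖ ^ 2) ^ s)) w = ∫⁻ w, F w :=
    lintegral_sub_right_eq_self F c
  -- After translation by c the set is the disc of radius √(E/m); rescaling to the unit disc yields
  -- E ^ s from the integrand and E / m from the area.
  set r := Real.sqrt (E / m) with hr
  have hr0 : 0 < r := Real.sqrt_pos.2 (by positivity)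
  have hr2 : r ^ 2 = E / m := Real.sq_sqrt (by positivity)
  have hFr : ∀ w : ℂ, F (r • w) = ENNReal.ofReal (E ^ s) *
      (ball (0 : ℂ) 1).indicator (fun w => ENNReal.ofReal ((1 - ‖w‖ ^ 2) ^ s)) w := by
    intro w
    have h2 : m * ‖r • w‖ ^ 2 = E * ‖w‖ ^ 2 := by
      rw [norm_smul, mul_pow, Real.norm_eq_abs, sq_abs, hr2]
      field_simp
    have h3 : (m * ‖r • w‖ ^ 2 < E) ↔ ‖w‖ < 1 := by
      rw [h2, mul_lt_iff_lt_one_right hE, sq_lt_one_iff₀ (norm_nonneg _)]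
    by_cases hw : ‖w‖ < 1
    · have h4 : r • w ∈ {w : ℂ | m * ‖w‖ ^ 2 < E} := h3.2 hw
      have h5 : 0 ≤ 1 - ‖w‖ ^ 2 := by nlinarith [norm_nonneg w]
      simp only [F, indicator_of_mem h4]
      rw [indicator_of_mem (by simpa using hw), ← ENNReal.ofReal_mul (by positivity),
        ← Real.mul_rpow hE.le h5, h2]
      congr 2; ring
    · have h4 : r • w ∉ {w : ℂ | m * ‖w‖ ^ 2 < E} := fun h => hw (h3.1 h)
      simp only [F, indicator_of_notMem h4]
      rw [indicator_of_notMem (by simpa using hw), mul_zero]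
  have hmap := Measure.map_addHaar_smul (volume : Measure ℂ) hr0.ne'
  have hemb : MeasurableEmbedding fun w : ℂ => r • w :=
    (Homeomorph.smulOfNeZero r hr0.ne').measurableEmbedding
  have h6 : ∫⁻ w, F (r • w) = ENNReal.ofReal |(r ^ 2)⁻¹| * ∫⁻ w, F w := by
    rw [← hemb.lintegral_map, hmap, lintegral_smul_measure, Complex.finrank_real_complex]
    rfl
  have h7 : ∫⁻ w, F (r • w) = ENNReal.ofReal (E ^ s) *
      ∫⁻ w in ball (0 : ℂ) 1, ENNReal.ofReal ((1 - ‖w‖ ^ 2) ^ s) := by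
    simp_rw [hFr]
    rw [lintegral_const_mul' _ _ ENNReal.ofReal_ne_top, lintegral_indicator measurableSet_ball]
  have h8 : ∫⁻ w, F w = ENNReal.ofReal (r ^ 2) * ∫⁻ w, F (r • w) := by
    rw [h6, ← mul_assoc, ← ENNReal.ofReal_mul (by positivity), abs_of_pos (by positivity),
      mul_inv_cancel₀ (by positivity), ENNReal.ofReal_one, one_mul]
  rw [h1, h8, h7, ← mul_assoc, ← ENNReal.ofReal_mul (by positivity), mul_comm, hr2]
  gcongr
  rw [Real.rpow_add_one hE.ne']
  apply le_of_eq
  ring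

/-- With q replaced by ab + ρ, the left side of `h2` becomes (1 - ab - ρ)² - (a - b)², and `h1`
gives ρ < 1 - ab; hence ρ < 1 - ab - |a - b|. In use, a and b are the moduli of the null coordinates
w₁ and w₂, and ρ is `absSq` of the remaining ones. -/
theorem slice_bounds {a b ρ q : ℝ} (ha : 0 ≤ a) (hb : 0 ≤ b) (hρ : 0 ≤ ρ) (hq0 : 0 ≤ q)
    (hq : q ≤ a * b + ρ) (h1 : a ^ 2 + b ^ 2 + 2 * ρ < 2)
    (h2 : 0 < 1 - (a ^ 2 + b ^ 2 + 2 * ρ) + q ^ 2) : ρ < 1 - b ^ 2 := by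
  by_contra! h
  have h3 : 0 < 1 - (a ^ 2 + b ^ 2 + 2 * ρ) + (a * b + ρ) ^ 2 := by nlinarith
  obtain ⟨δ, hδ⟩ : ∃ δ, ρ = 1 - b ^ 2 + δ := ⟨ρ - (1 - b ^ 2), by ring⟩
  have hδ0 : 0 ≤ δ := by linarith
  by_cases hb1 : b ≤ 1
  · subst hδ
    have hab : a ≤ b := by nlinarith
    have h4 : δ ≤ b * (b - a) := by nlinarith
    nlinarith [mul_nonneg hδ0 (sub_nonneg.2 h4), mul_nonneg (sub_nonneg.2 hb1) (sq_nonneg (a - b)),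
      mul_nonneg hb (mul_nonneg (sub_nonneg.2 hb1) (sq_nonneg (a - b))), mul_nonneg hδ0 (mul_nonneg hb (sub_nonneg.2 hab))]
  · push Not at hb1
    have ha1 : a < 1 := by nlinarith
    nlinarith [sq_nonneg (a - b), mul_nonneg ha hb, mul_nonneg hρ (sq_nonneg (a - b)),
      mul_pos (sub_pos.2 hb1) (sub_pos.2 ha1)]

theorem norm_quad_le {k : ℕ} (z : Fin k → ℂ) : ‖quad z‖ ≤ absSq z :=
  (norm_sum_le _ _).trans (le_of_eq (by simp [absSq]))

theorem absSq_nonneg {k : ℕ} (z : Fin k → ℂ) : 0 ≤ absSq z :=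
  Finset.sum_nonneg fun _ _ => sq_nonneg _

theorem norm_sq_le_absSq {k : ℕ} (z : Fin k → ℂ) (i : Fin k) : ‖z i‖ ^ 2 ≤ absSq z :=
  Finset.single_le_sum (f := fun i => ‖z i‖ ^ 2) (fun _ _ => sq_nonneg _) (Finset.mem_univ i)

theorem D_subset_closedBall (n : ℕ) : D n ⊆ closedBall 0 1 := by
  intro z hz
  rw [mem_closedBall_zero_iff, pi_norm_le_iff_of_nonneg zero_le_one]
  intro i
  have := (norm_sq_le_absSq z i).trans hz.1.le
  exact (sq_le_one_iff₀ (norm_nonneg _)).1 this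

/-- The coordinates `(z₂, …)`, `z₀ - i z₁`, `z₀ + i z₁`. -/
def nullCoord (k : ℕ) : ((Fin k → ℂ) × ℂ × ℂ) ≃ₗ[ℂ] (Fin (k + 2) → ℂ) where
  toFun p := Fin.cons ((p.2.2 + p.2.1) / 2) (Fin.cons (Complex.I * (p.2.1 - p.2.2) / 2) p.1)
  invFun z := (fun i => z i.succ.succ, z 0 - Complex.I * z 1, z 0 + Complex.I * z 1)
  map_add' p q := by
    ext i
    refine Fin.cases ?_ (fun i => Fin.cases ?_ (fun i => ?_) i) i <;> simp <;> ring
  map_smul' c p := by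
    ext i
    refine Fin.cases ?_ (fun i => Fin.cases ?_ (fun i => ?_) i) i <;> simp <;> ring
  left_inv p := by
    refine Prod.ext ?_ (Prod.ext ?_ ?_)
    · ext i; simp
    · simp
      linear_combination (p.2.2 - p.2.1) / 2 * Complex.I_sq
    · simp
      linear_combination (p.2.1 - p.2.2) / 2 * Complex.I_sq
  right_inv z := by
    ext i
    refine Fin.cases ?_ (fun i => Fin.cases ?_ (fun i => ?_) i) i
    · simp
    · simp
      linear_combination (-z 1) * Complex.I_sq
    · simp

theorem quad_nullCoord {k : ℕ} (z : Fin k → ℂ) (w₂ w₁ : ℂ) :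
    quad (nullCoord k (z, w₂, w₁)) = w₁ * w₂ + quad z := by
  simp only [quad, nullCoord, LinearEquiv.coe_mk, LinearMap.coe_mk, AddHom.coe_mk,
    Fin.sum_univ_succ, Fin.cons_zero, Fin.cons_succ]
  linear_combination ((w₂ - w₁) / 2) ^ 2 * Complex.I_sq

theorem absSq_nullCoord {k : ℕ} (z : Fin k → ℂ) (w₂ w₁ : ℂ) :
    2 * absSq (nullCoord k (z, w₂, w₁)) = ‖w₁‖ ^ 2 + ‖w₂‖ ^ 2 + 2 * absSq z := by
  simp only [absSq, nullCoord, LinearEquiv.coe_mk, LinearMap.coe_mk, AddHom.coe_mk,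
    Fin.sum_univ_succ, Fin.cons_zero, Fin.cons_succ, norm_div, norm_mul, Complex.norm_I,
    Complex.norm_ofNat]
  simp only [div_pow, one_mul, ← Complex.normSq_eq_norm_sq, Complex.normSq_apply, Complex.add_re,
    Complex.add_im, Complex.sub_re, Complex.sub_im]
  ring

/-- In null coordinates Δ is a real quadratic polynomial in w₁ with leading coefficient -(1 -
|w₂|²). Completing the square shows that each w₁-slice of the weight has the form handled by
`exists_lintegral_disc_le`. -/
theorem Δ_nullCoord {k : ℕ} (z : Fin k → ℂ) (w₂ w₁ : ℂ) (hm : 1 - ‖w₂‖ ^ 2 ≠ 0) :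
    Δ (nullCoord k (z, w₂, w₁)) =
      (1 - ‖w₂‖ ^ 2 - 2 * absSq z + ‖quad z‖ ^ 2 / (1 - ‖w₂‖ ^ 2)) - (1 - ‖w₂‖ ^ 2) *
        ‖w₁ - ((1 - ‖w₂‖ ^ 2)⁻¹ : ℝ) * (starRingEnd ℂ w₂ * quad z)‖ ^ 2 := by
  rw [Δ, absSq_nullCoord, quad_nullCoord]
  simp only [← Complex.normSq_eq_norm_sq] at hm ⊢
  simp only [Complex.normSq_apply] at hm ⊢
  simp only [Complex.add_re, Complex.add_im, Complex.sub_re, Complex.sub_im, Complex.mul_re,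
    Complex.mul_im, Complex.conj_re, Complex.conj_im, Complex.ofReal_re, Complex.ofReal_im]
  obtain ⟨i, hi⟩ : ∃ i, i = (1 - (w₂.re * w₂.re + w₂.im * w₂.im))⁻¹ := ⟨_, rfl⟩
  have h : (1 - (w₂.re * w₂.re + w₂.im * w₂.im)) * i = 1 := by rw [hi, mul_inv_cancel₀ hm]
  rw [div_eq_mul_inv, ← hi]
  linear_combination (-(2 * (w₁.re * (w₂.re * (quad z).re + w₂.im * (quad z).im) +
    w₁.im * (w₂.re * (quad z).im - w₂.im * (quad z).re)) +
    (1 - i * (w₂.re * w₂.re + w₂.im * w₂.im)) * ((quad z).re ^ 2 + (quad z).im ^ 2))) * h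

/-- Integrating first over w₁ gives at most C E ^ (s + 1) / m with m = 1 - |w₂|² and E ≤ m, hence at
most C m ^ s. What remains is the integrable weight (1 - |w₂|²) ^ s on the disc, times the volume of
a ball in z. -/
theorem lintegral_Δ_rpow_lt_top {k : ℕ} {s : ℝ} (hs : -1 < s) :
    ∫⁻ z in D (k + 2), ENNReal.ofReal (Δ z ^ s) < ∞ := by
  obtain ⟨C, hC, hdisc⟩ := exists_lintegral_disc_le hs
  let F : (Fin (k + 2) → ℂ) → ℝ≥0∞ := (D (k + 2)).indicator fun z => ENNReal.ofReal (Δ z ^ s)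
  have hF : Measurable F :=
    (continuous_Δ.measurable.pow_const s).ennreal_ofReal.indicator (isOpen_D _).measurableSet
  let e := (nullCoord k).toContinuousLinearEquiv
  have hslice : ∀ z w₂, ∫⁻ w₁, F (e (z, w₂, w₁)) ≤ C * ((closedBall (0 : Fin k → ℂ) 1).indicator 1 z *
      (ball (0 : ℂ) 1).indicator (fun w => ENNReal.ofReal ((1 - ‖w‖ ^ 2) ^ s)) w₂) := by
    intro z w₂
    by_cases hex : ∃ w₁, e (z, w₂, w₁) ∈ D (k + 2)
    swap
    · have : ∀ w₁, F (e (z, w₂, w₁)) = 0 := fun w₁ => indicator_of_notMem (fun h => hex ⟨w₁, h⟩) _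
      simp [this]
    have key : ∀ w₁, e (z, w₂, w₁) ∈ D (k + 2) → absSq z < 1 - ‖w₂‖ ^ 2 := by
      intro w₁ hw
      have h1 : 2 * absSq (e (z, w₂, w₁)) = _ := absSq_nullCoord z w₂ w₁
      have h2 : quad (e (z, w₂, w₁)) = _ := quad_nullCoord z w₂ w₁
      have h3 := Δ_pos hw
      rw [Δ, h1, h2] at h3
      refine slice_bounds (norm_nonneg w₁) (norm_nonneg w₂) (absSq_nonneg z) (norm_nonneg _) ?_
        (by linarith [hw.1]) h3
      refine (norm_add_le _ _).trans ?_
      rw [norm_mul]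
      linarith [norm_quad_le z]
    obtain ⟨w₀, hw₀⟩ := hex
    have hρ := key w₀ hw₀
    have hρ0 := absSq_nonneg z
    set m := 1 - ‖w₂‖ ^ 2 with hm
    have hm0 : 0 < m := hρ0.trans_lt hρ
    set E := m - 2 * absSq z + ‖quad z‖ ^ 2 / m with hE
    set c : ℂ := (m⁻¹ : ℝ) * (starRingEnd ℂ w₂ * quad z) with hc
    have hΔ : ∀ w₁, Δ (e (z, w₂, w₁)) = E - m * ‖w₁ - c‖ ^ 2 := fun w₁ =>
      Δ_nullCoord z w₂ w₁ hm0.ne'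
    have hE0 : 0 < E := by
      have := Δ_pos hw₀
      rw [hΔ] at this
      nlinarith [sq_nonneg ‖w₀ - c‖, mul_nonneg hm0.le (sq_nonneg ‖w₀ - c‖)]
    -- From |quad z| ≤ absSq z < m, the term |quad z|² / m is at most absSq z.
    have hEm : E ≤ m := by
      have h1 : ‖quad z‖ ^ 2 / m ≤ absSq z := by
        rw [div_le_iff₀ hm0]
        nlinarith [norm_quad_le z, norm_nonneg (quad z)]
      linarith
    have hz : z ∈ closedBall (0 : Fin k → ℂ) 1 := by
      rw [mem_closedBall_zero_iff, pi_norm_le_iff_of_nonneg zero_le_one]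
      intro i
      refine (sq_le_one_iff₀ (norm_nonneg _)).1 ((norm_sq_le_absSq z i).trans ?_)
      nlinarith [sq_nonneg ‖w₂‖]
    have hw₂ : w₂ ∈ ball (0 : ℂ) 1 := by
      rw [mem_ball_zero_iff, ← sq_lt_one_iff₀ (norm_nonneg _)]
      linarith
    rw [indicator_of_mem hz, indicator_of_mem hw₂, Pi.one_apply, one_mul]
    calc ∫⁻ w₁, F (e (z, w₂, w₁)) ≤ ∫⁻ w, {w : ℂ | m * ‖w - c‖ ^ 2 < E}.indicator
          (fun w => ENNReal.ofReal ((E - m * ‖w - c‖ ^ 2) ^ s)) w := by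
          refine lintegral_mono fun w => ?_
          by_cases hw : e (z, w₂, w) ∈ D (k + 2)
          · have h1 := Δ_pos hw
            rw [hΔ] at h1
            rw [indicator_of_mem (show w ∈ {w : ℂ | m * ‖w - c‖ ^ 2 < E} from sub_pos.1 h1)]
            simp only [F, indicator_of_mem hw, hΔ, le_refl]
          · simp only [F, indicator_of_notMem hw, zero_le]
      _ ≤ C * ENNReal.ofReal (E ^ (s + 1) / m) := hdisc c E m hE0 hm0
      _ ≤ C * ENNReal.ofReal (m ^ s) := by
          gcongr
          rw [div_le_iff₀ hm0, ← Real.rpow_add_one hm0.ne']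
          exact Real.rpow_le_rpow hE0.le hEm (by linarith)
  have : (volume : Measure (ℂ × ℂ)).IsAddHaarMeasure := Measure.prod.instIsAddHaarMeasure _ _
  have : (volume : Measure ((Fin k → ℂ) × ℂ × ℂ)).IsAddHaarMeasure :=
    Measure.prod.instIsAddHaarMeasure _ _
  have : (volume.map e).IsAddHaarMeasure := e.isAddHaarMeasure_map volume
  -- Uniqueness of Haar measure replaces the Jacobian of the change of coordinates: only finiteness
  -- of the constant matters.
  have hsmul := Measure.isAddLeftInvariant_eq_smul (volume : Measure (Fin (k + 2) → ℂ)) (volume.map e)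
  rw [← lintegral_indicator (isOpen_D _).measurableSet, hsmul, lintegral_smul_measure,
    lintegral_map hF e.continuous.measurable]
  refine ENNReal.mul_lt_top ENNReal.coe_lt_top ?_
  have hFe : Measurable fun p => F (e p) := hF.comp e.continuous.measurable
  rw [Measure.volume_eq_prod, lintegral_prod _ hFe.aemeasurable]
  have hw : Measurable fun w₂ : ℂ => (ball (0 : ℂ) 1).indicator
      (fun w => ENNReal.ofReal ((1 - ‖w‖ ^ 2) ^ s)) w₂ :=
    (((measurable_const.sub (measurable_norm.pow_const 2)).pow_const s).ennreal_ofReal).indicator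
      measurableSet_ball
  calc _ ≤ ∫⁻ z, ∫⁻ w₂, C * ((closedBall (0 : Fin k → ℂ) 1).indicator 1 z *
      (ball (0 : ℂ) 1).indicator (fun w => ENNReal.ofReal ((1 - ‖w‖ ^ 2) ^ s)) w₂) := by
        refine lintegral_mono fun z => ?_
        have hz : Measurable fun y : ℂ × ℂ => F (e (z, y)) := hFe.comp measurable_prodMk_left
        rw [Measure.volume_eq_prod, lintegral_prod _ hz.aemeasurable]
        exact lintegral_mono fun w₂ => hslice z w₂
    _ = C * (volume (closedBall (0 : Fin k → ℂ) 1) *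
        ∫⁻ w in ball (0 : ℂ) 1, ENNReal.ofReal ((1 - ‖w‖ ^ 2) ^ s)) := by
        simp_rw [lintegral_const_mul' _ _ hC, lintegral_const_mul _ hw]
        rw [lintegral_mul_const _ (measurable_one.indicator isClosed_closedBall.measurableSet),
          lintegral_indicator_one isClosed_closedBall.measurableSet,
          lintegral_indicator measurableSet_ball]
    _ < ∞ := ENNReal.mul_lt_top hC.lt_top (ENNReal.mul_lt_top
        (isCompact_closedBall _ _).measure_lt_top (lintegral_unit_disc_lt_top hs))

theorem zero_mem_D (n : ℕ) : (0 : Fin n → ℂ) ∈ D n := by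
  simp only [D, absSq, Set.mem_ofPred_eq, Pi.zero_apply, norm_zero]
  norm_num
  positivity

theorem v₀_univ_ne_top {n : ℕ} (hn : 2 ≤ n) {l : ℝ} (hl : (n : ℝ) - 1 < l) :
    v₀ n l univ ≠ ∞ := by
  obtain ⟨k, rfl⟩ : ∃ k, n = k + 2 := ⟨n - 2, by omega⟩
  rw [v₀, withDensity_apply _ MeasurableSet.univ, Measure.restrict_univ]
  exact (lintegral_Δ_rpow_lt_top (by linarith)).ne

theorem v₀_univ_ne_zero (n : ℕ) (l : ℝ) : v₀ n l univ ≠ 0 := by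
  intro h
  have h1 : ∀ᵐ z ∂v₀ n l, False := by rw [Measure.measure_univ_eq_zero.1 h]; simp
  rw [ae_v₀_iff] at h1
  have h2 : volume (D n) = 0 := by simpa [ae_iff] using h1
  exact ((isOpen_D n).measure_pos volume ⟨0, zero_mem_D n⟩).ne' h2

/-- An infinite total mass would make the normalization `v` the zero measure, so finiteness is what
gives the Bergman space its meaning. -/
theorem isProbabilityMeasure_v {n : ℕ} (hn : 2 ≤ n) {l : ℝ} (hl : (n : ℝ) - 1 < l) :
    IsProbabilityMeasure (v n l) :=
  ⟨by rw [v, Measure.smul_apply, smul_eq_mul,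
    ENNReal.inv_mul_cancel (v₀_univ_ne_zero n l) (v₀_univ_ne_top hn hl)]⟩

end FiniteMeasure

/-! ### Measure-preserving symmetries of the domain. -/

section Symmetries

open Metric Set

variable {n : ℕ} {l : ℝ}

theorem measurePreserving_v {φ : (Fin n → ℂ) → Fin n → ℂ} (hφ : MeasurePreserving φ volume volume)
    (hD : ∀ z, φ z ∈ D n ↔ z ∈ D n) (hΔ : ∀ z, Δ (φ z) = Δ z) :
    MeasurePreserving φ (v n l) (v n l) := by
  have hpre : φ ⁻¹' D n = D n := Set.ext hD
  have h : MeasurePreserving φ (v₀ n l) (v₀ n l) := by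
    refine ⟨hφ.measurable, Measure.ext fun s hs => ?_⟩
    have h1 := hφ.restrict_preimage (isOpen_D n).measurableSet
    rw [hpre] at h1
    rw [Measure.map_apply hφ.measurable hs, v₀, withDensity_apply _ hs,
      withDensity_apply _ (hφ.measurable hs),
      ← h1.setLIntegral_comp_preimage hs (measurable_weight n l)]
    simp_rw [hΔ]
  exact h.smul_measure _

/-- The action of a group element as a linear automorphism. -/
def actEquiv (g : G n) : (Fin n → ℂ) ≃L[ℂ] (Fin n → ℂ) :=
  LinearEquiv.toContinuousLinearEquiv
    { toFun := act g
      invFun := act g⁻¹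
      left_inv := fun z => by rw [← act_mul, inv_mul_cancel, act_one]
      right_inv := fun z => by rw [← act_mul, mul_inv_cancel, act_one]
      map_add' := fun z w => by simp [act, Matrix.mulVec_add]
      map_smul' := fun c z => by
        simp only [act, RingHom.id_apply, Matrix.mulVec_smul]
        rw [smul_comm] }

theorem actEquiv_apply (g : G n) (z : Fin n → ℂ) : actEquiv g z = act g z := rfl

theorem differentiable_act (g : G n) : Differentiable ℂ (act g) := (actEquiv g).differentiable

theorem continuous_act (g : G n) : Continuous (act g) := (actEquiv g).continuous

theorem volume_D_ne_top (n : ℕ) : volume (D n) ≠ ∞ :=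
  ((measure_mono (D_subset_closedBall n)).trans_lt (isCompact_closedBall _ _).measure_lt_top).ne

/-- A linear map scales volume by a constant. The constant is 1 because the domain, of finite
positive volume, is mapped onto itself. -/
theorem measurePreserving_act_volume (g : G n) : MeasurePreserving (act g) volume volume := by
  let e : (Fin n → ℂ) ≃L[ℝ] (Fin n → ℂ) := (actEquiv g).restrictScalars ℝ
  have h := fun s => Measure.addHaar_preimage_continuousLinearEquiv
    (volume : Measure (Fin n → ℂ)) e s
  have hD : e ⁻¹' D n = D n := Set.ext fun z => act_mem_D g z
  have h1 := h (D n)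
  rw [hD] at h1
  have h0 : volume (D n) ≠ 0 := ((isOpen_D n).measure_pos volume ⟨0, zero_mem_D n⟩).ne'
  have hc := (ENNReal.mul_eq_right h0 (volume_D_ne_top n)).1 h1.symm
  refine ⟨(continuous_act g).measurable, Measure.ext fun s hs => ?_⟩
  rw [Measure.map_apply (continuous_act g).measurable hs]
  exact (h s).trans (by rw [hc, one_mul])

theorem measurePreserving_act (g : G n) : MeasurePreserving (act g) (v n l) (v n l) :=
  measurePreserving_v (measurePreserving_act_volume g) (act_mem_D g) (Δ_act g)

theorem absSq_star (z : Fin n → ℂ) : absSq (star z) = absSq z := by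
  simp [absSq]

theorem quad_star (z : Fin n → ℂ) : quad (star z) = starRingEnd ℂ (quad z) := by
  simp [quad]

theorem star_mem_D (z : Fin n → ℂ) : star z ∈ D n ↔ z ∈ D n := by
  simp [D, absSq_star, quad_star]

theorem measurePreserving_star : MeasurePreserving (star : (Fin n → ℂ) → Fin n → ℂ) (v n l) (v n l) :=
  measurePreserving_v (volume_preserving_pi fun _ => Complex.conjLIE.measurePreserving) star_mem_D
    fun z => by simp [Δ, absSq_star, quad_star]

end Symmetries

/-! ### Reproducing kernels, the unitary representation, the conjugation, and Toeplitz operators. -/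

section Bergman

open Metric Set

variable {n : ℕ} {l : ℝ}

/-- The holomorphic function in a class in the Bergman space. -/
def rep (f : bergman n l) : (Fin n → ℂ) → ℂ := f.2.choose

theorem differentiableOn_rep (f : bergman n l) : DifferentiableOn ℂ (rep f) (D n) :=
  f.2.choose_spec.1

theorem coeFn_ae_eq_rep (f : bergman n l) : (f : Lp ℂ 2 (v n l)) =ᵐ[v n l] rep f :=
  f.2.choose_spec.2

variable [IsProbabilityMeasure (v n l)]

theorem v_const_ne : (v₀ n l univ)⁻¹ ≠ 0 ∧ (v₀ n l univ)⁻¹ ≠ ∞ :=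
  (v_eq_zero_or n l).resolve_left (IsProbabilityMeasure.ne_zero _)

theorem ae_v_iff {p : (Fin n → ℂ) → Prop} :
    (∀ᵐ z ∂v n l, p z) ↔ ∀ᵐ z, z ∈ D n → p z := by
  rw [v, Measure.ae_ennreal_smul_measure_iff v_const_ne.1, ae_v₀_iff]

theorem ae_mem_D : ∀ᵐ z ∂v n l, z ∈ D n :=
  ae_v_iff.2 (Filter.Eventually.of_forall fun _ h => h)

theorem eqOn_of_ae_eq {F K : (Fin n → ℂ) → ℂ} (hF : ContinuousOn F (D n))
    (hK : ContinuousOn K (D n)) (h : F =ᵐ[v n l] K) : EqOn F K (D n) := by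
  refine Measure.eqOn_open_of_ae_eq (μ := volume) ?_ (isOpen_D n) hF hK
  exact (ae_restrict_iff' (isOpen_D n).measurableSet).2 (ae_v_iff.1 h)

theorem ae_eq_of_eqOn {F K : (Fin n → ℂ) → ℂ} (h : EqOn F K (D n)) : F =ᵐ[v n l] K := by
  filter_upwards [ae_mem_D] with z hz using h hz

theorem rep_eqOn {f : bergman n l} {F : (Fin n → ℂ) → ℂ} (hF : DifferentiableOn ℂ F (D n))
    (h : (f : Lp ℂ 2 (v n l)) =ᵐ[v n l] F) : EqOn (rep f) F (D n) :=
  eqOn_of_ae_eq (differentiableOn_rep f).continuousOn hF.continuousOn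
    ((coeFn_ae_eq_rep f).symm.trans h)

theorem bergman_ext {f g : bergman n l} (h : EqOn (rep f) (rep g) (D n)) : f = g :=
  Subtype.ext (Lp.ext ((coeFn_ae_eq_rep f).trans ((ae_eq_of_eqOn h).trans (coeFn_ae_eq_rep g).symm)))

theorem rep_add (f g : bergman n l) : EqOn (rep (f + g)) (rep f + rep g) (D n) :=
  rep_eqOn ((differentiableOn_rep f).add (differentiableOn_rep g))
    ((Lp.coeFn_add _ _).trans ((coeFn_ae_eq_rep f).add (coeFn_ae_eq_rep g)))

theorem rep_smul (c : ℂ) (f : bergman n l) : EqOn (rep (c • f)) (c • rep f) (D n) :=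
  rep_eqOn ((differentiableOn_rep f).const_smul c)
    ((Lp.coeFn_smul _ _).trans ((coeFn_ae_eq_rep f).const_smul c))

/-- Point evaluations are bounded, locally uniformly. Boundedness gives the reproducing kernels;
uniformity bounds their norms near a point. -/
theorem rep_bound {z : Fin n → ℂ} (hz : z ∈ D n) : ∃ r > 0, ∃ A ≥ (0 : ℝ), ball z r ⊆ D n ∧
    ∀ f : bergman n l, ∀ x ∈ ball z r, ‖rep f x‖ ≤ A * ‖f‖ := by
  obtain ⟨R, hR, hRD⟩ := Metric.isOpen_iff.1 (isOpen_D n) z hz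
  have hb : closedBall z (2 * (R / 4)) ⊆ D n :=
    (closedBall_subset_ball (by linarith)).trans hRD
  obtain ⟨A, hA, h⟩ := local_bound (ν := v n l) (fun K hK hc => by
    obtain ⟨C, hC, hle⟩ := restrict_le_v₀ n l hK hc
    have h0 := v_const_ne (n := n) (l := l)
    refine ⟨C * v₀ n l univ, ENNReal.mul_ne_top hC (ENNReal.inv_ne_zero.1 h0.1), ?_⟩
    rw [v, smul_smul, mul_assoc,
      ENNReal.mul_inv_cancel (ENNReal.inv_ne_top.1 h0.2) (ENNReal.inv_ne_zero.1 h0.1), mul_one]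
    exact hle) (by positivity : 0 < R / 4) hb
  refine ⟨R / 4, by positivity, A.toReal, ENNReal.toReal_nonneg,
    (ball_subset_ball (by linarith)).trans hRD, fun f x hx => ?_⟩
  have h1 := h (rep f) (differentiableOn_rep f) x hx
  rw [← eLpNorm_congr_ae (coeFn_ae_eq_rep f), ← Lp.enorm_def] at h1
  have h2 := ENNReal.toReal_mono (ENNReal.mul_ne_top hA enorm_ne_top) h1
  rwa [ENNReal.toReal_mul, toReal_enorm, toReal_enorm] at h2

theorem exists_kernel {z : Fin n → ℂ} (hz : z ∈ D n) :
    ∃ k : bergman n l, ∀ f : bergman n l, inner ℂ k f = rep f z := by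
  obtain ⟨r, hr, A, -, -, h⟩ := rep_bound (l := l) hz
  let ev : bergman n l →ₗ[ℂ] ℂ :=
    { toFun := fun f => rep f z
      map_add' := fun f g => rep_add f g hz
      map_smul' := fun c f => rep_smul c f hz }
  refine ⟨(InnerProductSpace.toDual ℂ _).symm
    (ev.mkContinuous A fun f => h f z (mem_ball_self hr)), fun f => ?_⟩
  rw [InnerProductSpace.toDual_symm_apply]
  rfl

open Classical in
/-- The reproducing kernel of the Bergman space at a point of the domain. -/
def kernel (n : ℕ) (l : ℝ) [IsProbabilityMeasure (v n l)] (z : Fin n → ℂ) : bergman n l :=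
  if hz : z ∈ D n then (exists_kernel hz).choose else 0

theorem inner_kernel {z : Fin n → ℂ} (hz : z ∈ D n) (f : bergman n l) :
    inner ℂ (kernel n l z) f = rep f z := by
  rw [kernel, dif_pos hz]
  exact (exists_kernel hz).choose_spec f

theorem eq_zero_of_inner_kernel {f : bergman n l} (h : ∀ z ∈ D n, inner ℂ (kernel n l z) f = 0) :
    f = 0 := by
  refine bergman_ext fun z hz => ?_
  rw [← inner_kernel hz, ← inner_kernel hz, h z hz, inner_zero_right]

/-! ### The unitary representation -/

omit [IsProbabilityMeasure (v n l)] in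
theorem comp_act_mem (g : G n) (f : bergman n l) :
    Lp.compMeasurePreservingₗᵢ ℂ (act g) (measurePreserving_act g) (f : Lp ℂ 2 (v n l)) ∈
      bergman n l := by
  refine ⟨rep f ∘ act g, (differentiableOn_rep f).comp (differentiable_act g).differentiableOn
    fun z hz => (act_mem_D g z).2 hz, ?_⟩
  refine (Lp.coeFn_compMeasurePreserving _ (measurePreserving_act g)).trans ?_
  exact (measurePreserving_act g).quasiMeasurePreserving.ae_eq_comp (coeFn_ae_eq_rep f)

/-- Composition with the action of a group element. -/
def compAct (l : ℝ) (g : G n) : bergman n l →L[ℂ] bergman n l :=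
  ((Lp.compMeasurePreservingₗᵢ ℂ (act g) (measurePreserving_act g)).toContinuousLinearMap ∘L
    (bergman n l).subtypeL).codRestrict (bergman n l) (comp_act_mem g)

omit [IsProbabilityMeasure (v n l)] in
theorem compAct_ae (g : G n) (f : bergman n l) :
    (compAct l g f : Lp ℂ 2 (v n l)) =ᵐ[v n l] (f : Lp ℂ 2 (v n l)) ∘ act g :=
  Lp.coeFn_compMeasurePreserving _ (measurePreserving_act g)

theorem rep_compAct (g : G n) (f : bergman n l) {z : Fin n → ℂ} (hz : z ∈ D n) :
    rep (compAct l g f) z = rep f (act g z) := by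
  refine rep_eqOn (F := rep f ∘ act g) ((differentiableOn_rep f).comp
    (differentiable_act g).differentiableOn fun z hz => (act_mem_D g z).2 hz) ?_ hz
  exact (compAct_ae g f).trans
    ((measurePreserving_act g).quasiMeasurePreserving.ae_eq_comp (coeFn_ae_eq_rep f))

omit [IsProbabilityMeasure (v n l)] in
theorem inner_compAct (g : G n) (f f' : bergman n l) :
    inner ℂ (compAct l g f) (compAct l g f') = inner ℂ f f' :=
  (Lp.compMeasurePreservingₗᵢ ℂ (act g) (measurePreserving_act g)).inner_map_map
    (f : Lp ℂ 2 (v n l)) (f' : Lp ℂ 2 (v n l))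

theorem compAct_compAct_inv (g : G n) (f : bergman n l) : compAct l g (compAct l g⁻¹ f) = f := by
  refine bergman_ext fun z hz => ?_
  rw [rep_compAct g _ hz, rep_compAct _ _ ((act_mem_D g z).2 hz), ← act_mul, inv_mul_cancel, act_one]

/-- Composition with g is unitary and intertwines evaluation at z with evaluation at g z, so it must
carry one kernel to the other. -/
theorem compAct_kernel (g : G n) {z : Fin n → ℂ} (hz : z ∈ D n) :
    compAct l g (kernel n l (act g z)) = kernel n l z := by
  refine ext_inner_right ℂ fun f => ?_
  rw [inner_kernel hz, ← compAct_compAct_inv g f, inner_compAct, inner_kernel ((act_mem_D g z).2 hz),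
    rep_compAct g _ hz]

/-! ### The conjugation -/

omit [IsProbabilityMeasure (v n l)] in
theorem differentiableOn_conj_comp_star {F : (Fin n → ℂ) → ℂ} (hF : DifferentiableOn ℂ F (D n)) :
    DifferentiableOn ℂ (fun z => starRingEnd ℂ (F (star z))) (D n) := by
  intro z hz
  have hz' := (star_mem_D z).2 hz
  have h1 := ((hF.differentiableAt ((isOpen_D n).mem_nhds hz')).hasFDerivAt).restrictScalars ℝ
  let s : (Fin n → ℂ) →L[ℝ] (Fin n → ℂ) :=
    ContinuousLinearMap.pi fun i => (Complex.conjCLE : ℂ →L[ℝ] ℂ) ∘L ContinuousLinearMap.proj i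
  let c : ℂ →L[ℝ] ℂ := Complex.conjCLE
  have h2 : HasFDerivAt (fun z => starRingEnd ℂ (F (star z)))
      (c ∘L (fderiv ℂ F (star z)).restrictScalars ℝ ∘L s) z :=
    c.hasFDerivAt.comp z (h1.comp z s.hasFDerivAt)
  let L : (Fin n → ℂ) →L[ℂ] ℂ :=
    { toFun := fun w => starRingEnd ℂ (fderiv ℂ F (star z) (star w))
      map_add' := fun w w' => by simp
      map_smul' := fun a w => by simp
      cont := by fun_prop }
  -- The real derivative is conj ∘ (complex linear) ∘ conj, which is complex linear.
  exact (hasFDerivAt_of_restrictScalars ℝ h2 (f' := L) rfl).differentiableAt.differentiableWithinAt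

/-- The conjugation `f ↦ conj (f (conj z))` of `L²`. -/
def conjLp (f : Lp ℂ 2 (v n l)) : Lp ℂ 2 (v n l) :=
  star (Lp.compMeasurePreserving star measurePreserving_star f)

omit [IsProbabilityMeasure (v n l)] in
theorem conjLp_ae (f : bergman n l) :
    conjLp (f : Lp ℂ 2 (v n l)) =ᵐ[v n l] fun z => starRingEnd ℂ (rep f (star z)) := by
  refine (Lp.coeFn_star _).trans ?_
  filter_upwards [Lp.coeFn_compMeasurePreserving (f : Lp ℂ 2 (v n l)) measurePreserving_star,
    measurePreserving_star.quasiMeasurePreserving.ae_eq_comp (coeFn_ae_eq_rep f)] with z h1 h2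
  rw [Pi.star_apply, h1, h2]
  rfl

/-- The conjugation `f ↦ conj (f (conj z))` of the Bergman space. -/
def conjOp (f : bergman n l) : bergman n l :=
  ⟨conjLp f, _, differentiableOn_conj_comp_star (differentiableOn_rep f), conjLp_ae f⟩

theorem rep_conjOp (f : bergman n l) {z : Fin n → ℂ} (hz : z ∈ D n) :
    rep (conjOp f) z = starRingEnd ℂ (rep f (star z)) := by
  have h : (conjOp f : Lp ℂ 2 (v n l)) =ᵐ[v n l] fun z => starRingEnd ℂ (rep f (star z)) :=
    conjLp_ae f
  exact rep_eqOn (F := fun z => starRingEnd ℂ (rep f (star z)))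
    (differentiableOn_conj_comp_star (differentiableOn_rep f)) h hz

theorem conjOp_conjOp (f : bergman n l) : conjOp (conjOp f) = f := by
  refine bergman_ext fun z hz => ?_
  rw [rep_conjOp _ hz, rep_conjOp _ ((star_mem_D z).2 hz), star_star, Complex.conj_conj]

omit [IsProbabilityMeasure (v n l)] in
theorem inner_eq_integral (f g : bergman n l) :
    inner ℂ f g = ∫ z, starRingEnd ℂ (rep f z) * rep g z ∂v n l := by
  change inner ℂ (f : Lp ℂ 2 (v n l)) (g : Lp ℂ 2 (v n l)) = _
  rw [L2.inner_def]
  refine integral_congr_ae ?_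
  filter_upwards [coeFn_ae_eq_rep f, coeFn_ae_eq_rep g] with z h1 h2
  rw [h1, h2, RCLike.inner_apply, mul_comm]

theorem inner_conjOp_conjOp (f g : bergman n l) : inner ℂ (conjOp f) (conjOp g) = inner ℂ g f := by
  have hemb : MeasurableEmbedding (star : (Fin n → ℂ) → Fin n → ℂ) :=
    (Homeomorph.mk (Equiv.mk star star star_star star_star) continuous_star
      continuous_star).measurableEmbedding
  rw [inner_eq_integral, inner_eq_integral, ← measurePreserving_star.integral_comp hemb
    fun z => starRingEnd ℂ (rep g z) * rep f z]
  refine integral_congr_ae ?_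
  filter_upwards [ae_mem_D] with z hz
  rw [rep_conjOp f hz, rep_conjOp g hz, Complex.conj_conj, mul_comm]

theorem inner_conjOp (f g : bergman n l) : inner ℂ (conjOp f) g = inner ℂ (conjOp g) f := by
  conv_lhs => rw [← conjOp_conjOp g]
  exact inner_conjOp_conjOp _ _

theorem conjOp_kernel {z : Fin n → ℂ} (hz : z ∈ D n) :
    conjOp (kernel n l z) = kernel n l (star z) := by
  refine ext_inner_right ℂ fun f => ?_
  rw [inner_conjOp, inner_kernel ((star_mem_D z).2 hz), ← inner_conj_symm (conjOp f), inner_kernel hz,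
    rep_conjOp f hz, Complex.conj_conj]

/-! ### Toeplitz operators -/

omit [IsProbabilityMeasure (v n l)] in
theorem inner_toeplitz (a : Linf n l) (f g : bergman n l) :
    inner ℂ g (toeplitz a f) = ∫ z, a z * (starRingEnd ℂ (rep g z) * rep f z) ∂v n l := by
  change inner ℂ g ((bergman n l).orthogonalProjectionOnto (mulOp a f)) = _
  rw [Submodule.inner_orthogonalProjectionOnto_eq_of_mem_left, L2.inner_def]
  refine integral_congr_ae ?_
  have h1 := ContinuousLinearMap.coeFn_holder (r := 2) (ContinuousLinearMap.mul ℂ ℂ) a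
    (f : Lp ℂ 2 (v n l))
  filter_upwards [h1, coeFn_ae_eq_rep f, coeFn_ae_eq_rep g] with z h1 h2 h3
  have h1' : (mulOp a f : Lp ℂ 2 (v n l)) z = _ := h1
  rw [h1', h2, h3]
  simp
  ring

theorem toeplitz_compAct {a : Linf n l} {H : Subgroup (G n)} (ha : a ∈ invSymbols l H) {g : G n}
    (hg : g ∈ H) (f : bergman n l) :
    toeplitz a (compAct l g f) = compAct l g (toeplitz a f) := by
  refine ext_inner_left ℂ fun f' => ?_
  obtain ⟨f', rfl⟩ : ∃ f'', f' = compAct l g f'' := ⟨_, (compAct_compAct_inv g f').symm⟩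
  rw [inner_compAct, inner_toeplitz, inner_toeplitz, ← (measurePreserving_act g).integral_comp
    (actEquiv g).toHomeomorph.measurableEmbedding fun z => a z * (starRingEnd ℂ (rep f' z) * rep f z)]
  refine integral_congr_ae ?_
  have h := ha g⁻¹ (H.inv_mem hg)
  rw [inv_inv] at h
  filter_upwards [ae_mem_D, h] with z hz h1
  rw [h1, rep_compAct g _ hz, rep_compAct g _ hz]

/-- Commuting with a fixed operator defines a closed subalgebra, so it suffices to check the
generators. -/
theorem mul_compAct_of_mem_toeplitzAlgebra {H : Subgroup (G n)}
    {T : bergman n l →L[ℂ] bergman n l} (hT : T ∈ toeplitzAlgebra l H) {g : G n} (hg : g ∈ H)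
    (f : bergman n l) : T (compAct l g f) = compAct l g (T f) := by
  have h1 : (Algebra.adjoin ℂ (toeplitz '' invSymbols l H)).topologicalClosure ≤
      Subalgebra.centralizer ℂ {compAct l g} := by
    refine Subalgebra.topologicalClosure_minimal (Algebra.adjoin_le ?_)
      (Set.isClosed_centralizer _)
    rintro _ ⟨a, ha, rfl⟩
    rw [SetLike.mem_coe, Subalgebra.mem_centralizer_iff]
    rintro _ rfl
    ext1 f
    exact (toeplitz_compAct ha hg f).symm
  have h2 := (Subalgebra.mem_centralizer_iff ℂ).1 (h1 hT) _ rfl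
  exact (DFunLike.congr_fun h2 f).symm

end Bergman

/-! ### Weak holomorphy, and vanishing on a diagonal. -/

section Holomorphy

open Metric Set

/-- A bounded function into a Banach space is holomorphic if its compositions with a norming family
of functionals are. -/
theorem differentiableOn_of_norming {F ι : Type*} [NormedAddCommGroup F] [NormedSpace ℂ F]
    [CompleteSpace F] {ℓ : ι → F →L[ℂ] ℂ} {N : ι → ℝ} (hN : ∀ i, ‖ℓ i‖ ≤ N i)
    (hnorm : ∀ x C, 0 ≤ C → (∀ i, ‖ℓ i x‖ ≤ C * N i) → ‖x‖ ≤ C)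
    {p : ℂ → F} {c : ℂ} {R M : ℝ} (hM : ∀ ζ ∈ ball c R, ‖p ζ‖ ≤ M)
    (hp : ∀ i, DifferentiableOn ℂ (fun ζ => ℓ i (p ζ)) (ball c R)) :
    DifferentiableOn ℂ p (ball c R) := by
  have hcont : ContinuousOn p (ball c R) := by
    intro ζ hζ
    obtain ⟨r, hr, hsub⟩ := Metric.isOpen_iff.1 isOpen_ball ζ hζ
    have hM0 : 0 ≤ M := (norm_nonneg _).trans (hM ζ hζ)
    -- The Schwarz lemma for each scalar function ℓ_i ∘ p gives a Lipschitz bound proportional to `N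
    -- i`; the norming property turns these into a bound for p itself.
    have hlip : ∀ w ∈ ball ζ r, ‖p w - p ζ‖ ≤ 2 * M / r * dist w ζ := by
      intro w hw
      refine hnorm _ _ (by positivity) fun i => ?_
      have h1 := Complex.dist_le_div_mul_dist_of_mapsTo_ball (R₂ := 2 * M * N i)
        ((hp i).mono hsub) (fun x hx => by
          rw [mem_closedBall, dist_eq_norm, ← map_sub]
          have h2 : ‖p x - p ζ‖ ≤ 2 * M := by
            linarith [norm_sub_le (p x) (p ζ), hM x (hsub hx), hM ζ hζ]
          calc _ ≤ ‖ℓ i‖ * ‖p x - p ζ‖ := (ℓ i).le_opNorm _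
            _ ≤ N i * (2 * M) := by
                gcongr
                · exact (norm_nonneg _).trans (hN i)
                · exact hN i
            _ = _ := by ring) hw
      rw [dist_eq_norm, ← map_sub] at h1
      refine h1.trans (le_of_eq ?_)
      ring
    refine ContinuousAt.continuousWithinAt ?_
    rw [ContinuousAt, tendsto_iff_norm_sub_tendsto_zero]
    refine squeeze_zero' (Filter.Eventually.of_forall fun _ => norm_nonneg _)
      (Filter.mem_of_superset (ball_mem_nhds ζ hr) hlip) ?_
    have : Filter.Tendsto (fun w => 2 * M / r * dist w ζ) (nhds ζ) (nhds (2 * M / r * dist ζ ζ)) :=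
      (continuous_const.mul (continuous_id.dist continuous_const)).tendsto ζ
    simpa using this
  intro ζ hζ
  obtain ⟨r', hr', hsub'⟩ := Metric.isOpen_iff.1 isOpen_ball ζ hζ
  obtain ⟨r, hr, hrr⟩ := exists_between hr'
  have hsub : closedBall ζ r ⊆ ball c R := (closedBall_subset_ball hrr).trans hsub'
  lift r to NNReal using hr.le
  have hci : CircleIntegrable p ζ r :=
    (hcont.mono (sphere_subset_closedBall.trans hsub)).circleIntegrable r.2
  have hq := hasFPowerSeriesOn_cauchy_integral hci (by exact_mod_cast hr)
  -- The vector-valued Cauchy formula: every ℓ_i annihilates the difference of the two sides by the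
  -- scalar formula, and the family is norming. It makes p analytic near ζ.
  have heq : ∀ w ∈ ball ζ r, (2 * ↑Real.pi * Complex.I)⁻¹ • ∮ z in C(ζ, r), (z - w)⁻¹ • p z =
      p w := by
    intro w hw
    have hint : IntervalIntegrable (fun θ => deriv (circleMap ζ r) θ •
        ((circleMap ζ r θ - w)⁻¹ • p (circleMap ζ r θ))) volume 0 (2 * Real.pi) := by
      refine CircleIntegrable.out (f := fun z => (z - w)⁻¹ • p z) ?_
      refine ContinuousOn.circleIntegrable r.2 ?_
      refine ContinuousOn.smul (ContinuousOn.inv₀ (by fun_prop) fun z hz h => ?_)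
        (hcont.mono (sphere_subset_closedBall.trans hsub))
      rw [sub_eq_zero.1 h] at hz
      exact (mem_ball.1 hw).ne (mem_sphere.1 hz)
    have hzero : ∀ i, ℓ i ((2 * ↑Real.pi * Complex.I)⁻¹ • (∮ z in C(ζ, r), (z - w)⁻¹ • p z) - p w) =
        0 := by
      intro i
      have h1 := DiffContOnCl.two_pi_i_inv_smul_circleIntegral_sub_inv_smul
        (DifferentiableOn.diffContOnCl (((hp i).mono hsub).mono closure_ball_subset_closedBall)) hw
      rw [map_sub, map_smul, ← h1, sub_eq_zero]
      congr 1
      rw [circleIntegral, circleIntegral, ← ContinuousLinearMap.intervalIntegral_comp_comm _ hint]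
      simp
    rw [← sub_eq_zero, ← norm_le_zero_iff]
    exact hnorm _ 0 le_rfl fun i => by rw [hzero i]; simp
  refine DifferentiableAt.differentiableWithinAt ?_
  refine (hq.analyticAt.differentiableAt).congr_of_eventuallyEq ?_
  filter_upwards [ball_mem_nhds ζ hr] with w hw using (heq w hw).symm

theorem eq_zero_of_forall_real {g : ℂ → ℂ} {R : ℝ} (hg : DifferentiableOn ℂ g (ball 0 R))
    (h : ∀ t : ℝ, |t| < R → g t = 0) : ∀ ζ ∈ ball (0 : ℂ) R, g ζ = 0 := by
  intro ζ hζ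
  have hR : 0 < R := pos_of_mem_ball hζ
  refine (hg.analyticOnNhd isOpen_ball).eqOn_zero_of_preconnected_of_frequently_eq_zero
    (convex_ball 0 R).isPreconnected (mem_ball_self hR) ?_ hζ
  have h1 : Filter.Tendsto (fun t : ℝ => (t : ℂ)) (nhdsWithin 0 {0}ᶜ) (nhdsWithin 0 {0}ᶜ) := by
    refine tendsto_nhdsWithin_iff.2 ⟨?_, ?_⟩
    · exact (Complex.continuous_ofReal.tendsto' 0 0 (by simp)).mono_left nhdsWithin_le_nhds
    · filter_upwards [self_mem_nhdsWithin] with t ht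
      simpa using ht
  refine h1.frequently (Filter.Eventually.frequently ?_)
  filter_upwards [mem_nhdsWithin_of_mem_nhds (ball_mem_nhds (0 : ℝ) hR)] with t ht
  exact h t (by simpa using ht)

theorem eq_zero_of_eventually_zero {g : ℂ → ℂ} {R : ℝ} (hg : DifferentiableOn ℂ g (ball 0 R))
    (h : ∀ᶠ ζ in nhds 0, g ζ = 0) : ∀ ζ ∈ ball (0 : ℂ) R, g ζ = 0 := fun _ hζ =>
  (hg.analyticOnNhd isOpen_ball).eqOn_zero_of_preconnected_of_eventuallyEq_zero
    (convex_ball 0 R).isPreconnected (mem_ball_self (pos_of_mem_ball hζ)) h hζ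

theorem norm_le_of_norm_inner_self {E : Type*} [NormedAddCommGroup E] [InnerProductSpace ℂ E]
    {y : E} {C : ℝ} (hC : 0 ≤ C) (h : ‖inner ℂ y y‖ ≤ C * ‖y‖) : ‖y‖ ≤ C := by
  rw [inner_self_eq_norm_sq_to_K, norm_pow, RCLike.norm_ofReal, abs_norm, sq] at h
  by_contra! hlt
  nlinarith

/-- Polarization for holomorphic functions: (ζ, η) ↦ ⟨a ζ, R (b η)⟩ is holomorphic in both
variables, since a is antiholomorphic and b holomorphic. Vanishing on the totally real set η = conj
ζ forces it to vanish. -/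
theorem inner_eq_zero_of_diagonal {E : Type*} [NormedAddCommGroup E] [InnerProductSpace ℂ E]
    [CompleteSpace E] {a b : ℂ → E} {M : ℝ} {R : E →L[ℂ] E}
    (haM : ∀ ζ ∈ ball (0 : ℂ) 2, ‖a ζ‖ ≤ M) (hbM : ∀ ζ ∈ ball (0 : ℂ) 2, ‖b ζ‖ ≤ M)
    (ha : ∀ f, DifferentiableOn ℂ (fun ζ => inner ℂ (a ζ) f) (ball 0 2))
    (hb : ∀ f, DifferentiableOn ℂ (fun ζ => inner ℂ f (b ζ)) (ball 0 2))
    (h : ∀ ζ ∈ ball (0 : ℂ) 2, inner ℂ (a ζ) (R (b (starRingEnd ℂ ζ))) = 0) :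
    inner ℂ (a 1) (R (b 0)) = 0 := by
  let p : ℂ → StrongDual ℂ E := fun ζ => InnerProductSpace.toDual ℂ E (a ζ)
  have hp : DifferentiableOn ℂ p (ball 0 2) := by
    refine differentiableOn_of_norming (M := M)
      (ℓ := fun f : E => ContinuousLinearMap.apply ℂ ℂ f) (N := fun f => ‖f‖)
      (fun f => ContinuousLinearMap.opNorm_le_bound _ (norm_nonneg f) fun φ => ?_)
      (fun φ C hC hφ => ContinuousLinearMap.opNorm_le_bound φ hC hφ) (fun ζ hζ => ?_) ha
    · rw [mul_comm]; exact φ.le_opNorm f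
    · rw [LinearIsometryEquiv.norm_map]
      exact haM _ hζ
  have hq : DifferentiableOn ℂ b (ball 0 2) :=
    differentiableOn_of_norming (ℓ := fun f : E => innerSL ℂ f) (N := fun f => ‖f‖)
      (fun f => (innerSL_apply_norm ℂ f).le)
      (fun y C hC hy => norm_le_of_norm_inner_self hC (hy y)) hbM hb
  -- In these variables the set η = conj ζ is the real plane, so the one-variable identity theorem
  -- applies first in u and then in w. For u and w in the unit disc both arguments stay in the disc
  -- of radius 2.
  let Φ : ℂ → ℂ → ℂ := fun u w => p (u + Complex.I * w) (R (b (u - Complex.I * w)))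
  have hmem : ∀ a ∈ ball (0 : ℂ) 1, ∀ b ∈ ball (0 : ℂ) 1, a + Complex.I * b ∈ ball (0 : ℂ) 2 ∧
      a - Complex.I * b ∈ ball (0 : ℂ) 2 := by
    intro a ha b hb
    simp only [mem_ball_zero_iff] at *
    have h1 := norm_add_le a (Complex.I * b)
    have h2 := norm_sub_le a (Complex.I * b)
    rw [norm_mul, Complex.norm_I, one_mul] at h1 h2
    constructor <;> linarith
  have hreal : ∀ s t : ℝ, |s| < 1 → |t| < 1 → Φ s t = 0 := by
    intro s t hs ht
    have h1 : (s : ℂ) - Complex.I * t = starRingEnd ℂ (s + Complex.I * t) := by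
      simp [sub_eq_add_neg]
    change inner ℂ (a (s + Complex.I * t)) (R (b (s - Complex.I * t))) = 0
    rw [h1]
    exact h _ (hmem s (by simpa using hs) t (by simpa using ht)).1
  have hΦ : ∀ f g : ℂ → ℂ, Differentiable ℂ f → Differentiable ℂ g →
      (∀ ζ ∈ ball (0 : ℂ) 1, f ζ ∈ ball (0 : ℂ) 2 ∧ g ζ ∈ ball (0 : ℂ) 2) →
      DifferentiableOn ℂ (fun ζ => p (f ζ) (R (b (g ζ)))) (ball 0 1) := by
    intro f g hf hg hfg
    have h1 : DifferentiableOn ℂ (fun ζ => p (f ζ)) (ball 0 1) :=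
      hp.comp hf.differentiableOn fun ζ hζ => (hfg ζ hζ).1
    have h2 : DifferentiableOn ℂ (fun ζ => R (b (g ζ))) (ball 0 1) :=
      R.differentiable.comp_differentiableOn (hq.comp hg.differentiableOn
        fun ζ hζ => (hfg ζ hζ).2)
    exact h1.clm_apply h2
  have hstep : ∀ t : ℝ, |t| < 1 → ∀ u ∈ ball (0 : ℂ) 1, Φ u t = 0 := fun t ht =>
    eq_zero_of_forall_real (hΦ (fun u => u + Complex.I * t) (fun u => u - Complex.I * t)
      (by fun_prop) (by fun_prop) fun u hu => hmem u hu t (by simpa using ht))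
      fun s hs => hreal s t hs ht
  -- The values u = 1/2 and w = -i/2 correspond to ζ = 1 and η = 0.
  have hfin := eq_zero_of_forall_real (hΦ (fun b => 1 / 2 + Complex.I * b)
    (fun b => 1 / 2 - Complex.I * b) (by fun_prop) (by fun_prop)
    fun b hb => hmem (1 / 2) (by simp; norm_num) b hb)
    (fun t ht => hstep t ht (1 / 2) (by simp; norm_num)) (-Complex.I / 2) (by simp; norm_num)
  have e1 : (1 : ℂ) / 2 + Complex.I * (-Complex.I / 2) = 1 := by
    linear_combination (-1 / 2 : ℂ) * Complex.I_sq
  have e2 : (1 : ℂ) / 2 - Complex.I * (-Complex.I / 2) = 0 := by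
    linear_combination (1 / 2 : ℂ) * Complex.I_sq
  simp only [e1, e2] at hfin
  exact hfin

end Holomorphy

/-! ### The domain is balanced. -/

section Domain

open Metric Set

theorem absSq_smul {n : ℕ} (c : ℂ) (z : Fin n → ℂ) : absSq (c • z) = ‖c‖ ^ 2 * absSq z := by
  simp [absSq, mul_pow, Finset.mul_sum]

theorem quad_smul {n : ℕ} (c : ℂ) (z : Fin n → ℂ) : quad (c • z) = c ^ 2 * quad z := by
  simp [quad, mul_pow, Finset.mul_sum]

theorem smul_mem_D {n : ℕ} {z : Fin n → ℂ} (hz : z ∈ D n) {c : ℂ} (hc : ‖c‖ ≤ 1) :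
    c • z ∈ D n := by
  have h0 := absSq_nonneg z
  have h1 := hz.1
  have h2 := hz.2
  have h3 := norm_quad_le z
  have hc2 : ‖c‖ ^ 2 ≤ 1 := (sq_le_one_iff₀ (norm_nonneg _)).2 hc
  have hc0 : 0 ≤ ‖c‖ ^ 2 := sq_nonneg _
  have hq : ‖quad z‖ ^ 2 ≤ absSq z := by nlinarith [norm_nonneg (quad z)]
  refine ⟨?_, ?_⟩
  · rw [absSq_smul]; nlinarith
  · rw [absSq_smul, quad_smul, norm_mul, norm_pow, mul_pow]
    nlinarith [mul_nonneg (sub_nonneg.2 hc2) (sub_nonneg.2 hq),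
      mul_nonneg (mul_nonneg (sub_nonneg.2 hc2) (sub_nonneg.2 hc2)) (sq_nonneg ‖quad z‖)]

/-- Openness allows a real factor slightly above 1, and balancedness fills the disc. It provides an
open disc containing both 0 and 1 for the one-variable identity theorem. -/
theorem exists_smul_mem_D {n : ℕ} {z : Fin n → ℂ} (hz : z ∈ D n) :
    ∃ R > 1, ∀ ζ ∈ ball (0 : ℂ) R, ζ • z ∈ D n := by
  have h1 : ∀ᶠ t : ℝ in nhds 1, (t : ℂ) • z ∈ D n := by
    have : Continuous fun t : ℝ => (t : ℂ) • z := by fun_prop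
    exact this.continuousAt.eventually_mem ((isOpen_D n).mem_nhds (by simpa using hz))
  obtain ⟨ε, hε, h⟩ := Metric.eventually_nhds_iff.1 h1
  refine ⟨1 + ε / 2, by linarith, fun ζ hζ => ?_⟩
  have hR : ((1 + ε / 2 : ℝ) : ℂ) ≠ 0 := by
    exact_mod_cast (by linarith : (1 + ε / 2 : ℝ) ≠ 0)
  have h2 := h (y := 1 + ε / 2) (by
    rw [Real.dist_eq, add_sub_cancel_left, abs_of_pos (by positivity)]
    linarith)
  have h3 := smul_mem_D h2 (c := ζ / ((1 + ε / 2 : ℝ) : ℂ)) (by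
    rw [norm_div, Complex.norm_of_nonneg (by positivity), div_le_one (by positivity)]
    exact (mem_ball_zero_iff.1 hζ).le)
  rwa [smul_smul, div_mul_cancel₀ _ hR] at h3

end Domain

/-! ### Injectivity of the Berezin transform. -/

section Berezin

open Metric Set

variable {n : ℕ} {l : ℝ} [IsProbabilityMeasure (v n l)]

theorem eq_zero_of_rep_ball {f : bergman n l} {δ : ℝ} (hδ : 0 < δ)
    (h : ∀ x ∈ ball (0 : Fin n → ℂ) δ, rep f x = 0) : f = 0 := by
  refine eq_zero_of_inner_kernel fun z hz => ?_
  rw [inner_kernel hz]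
  obtain ⟨R, hR, hRD⟩ := exists_smul_mem_D hz
  have h1 : DifferentiableOn ℂ (fun ζ : ℂ => rep f (ζ • z)) (ball 0 R) :=
    (differentiableOn_rep f).comp (f := fun ζ : ℂ => ζ • z) (by fun_prop) hRD
  have h2 : ∀ᶠ ζ : ℂ in nhds 0, rep f (ζ • z) = 0 := by
    have : Continuous fun ζ : ℂ => ζ • z := by fun_prop
    filter_upwards [this.continuousAt.eventually_mem (x := 0) (s := ball 0 δ)
      (by rw [zero_smul]; exact ball_mem_nhds 0 hδ)] with ζ hζ using h _ hζ
  simpa using eq_zero_of_eventually_zero h1 h2 1 (by simpa using hR)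

/-- An operator on the Bergman space is determined by its Berezin transform. -/
theorem eq_zero_of_berezin {R : bergman n l →L[ℂ] bergman n l}
    (h : ∀ z ∈ D n, inner ℂ (kernel n l z) (R (kernel n l z)) = 0) : R = 0 := by
  obtain ⟨r, hr, A, hA0, hrD, hA⟩ := rep_bound (l := l) (zero_mem_D n)
  have hker : ∀ x ∈ ball (0 : Fin n → ℂ) r, ‖kernel n l x‖ ≤ A := by
    intro x hx
    have h1 := hA (kernel n l x) x hx
    rw [← inner_kernel (hrD hx)] at h1
    exact norm_le_of_norm_inner_self hA0 h1
  -- Polarization along the complex line x from w to z, with x 0 = w and x 1 = z. The radius r / 5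
  -- keeps x in the ball of radius r for parameters of modulus below 2, as ‖w‖ + 2 (‖z‖ + ‖w‖) < r.
  have key : ∀ z ∈ ball (0 : Fin n → ℂ) (r / 5), ∀ w ∈ ball (0 : Fin n → ℂ) (r / 5),
      inner ℂ (kernel n l z) (R (kernel n l w)) = 0 := by
    intro z hz w hw
    rw [mem_ball_zero_iff] at hz hw
    let x : ℂ → Fin n → ℂ := fun ζ => w + ζ • (z - w)
    have hx : ∀ ζ ∈ ball (0 : ℂ) 2, x ζ ∈ ball (0 : Fin n → ℂ) r := by
      intro ζ hζ
      rw [mem_ball_zero_iff] at hζ ⊢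
      calc ‖w + ζ • (z - w)‖ ≤ ‖w‖ + ‖ζ‖ * (‖z‖ + ‖w‖) := by
            refine (norm_add_le _ _).trans ?_
            rw [norm_smul]
            gcongr
            exact norm_sub_le _ _
        _ ≤ ‖w‖ + 2 * (‖z‖ + ‖w‖) := by gcongr
        _ < r := by linarith
    have hx' : ∀ η ∈ ball (0 : ℂ) 2, x (starRingEnd ℂ η) ∈ ball (0 : Fin n → ℂ) r :=
      fun η hη => hx _ (by simpa using hη)
    have hfin := inner_eq_zero_of_diagonal (a := fun ζ => kernel n l (x ζ))
      (b := fun η => kernel n l (x (starRingEnd ℂ η))) (M := A) (R := R)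
      (fun ζ hζ => hker _ (hx ζ hζ)) (fun η hη => hker _ (hx' η hη)) (fun f => ?_) (fun f => ?_)
      (fun ζ hζ => ?_)
    · simpa [x] using hfin
    · refine DifferentiableOn.congr (f := fun ζ => rep f (x ζ)) ?_ fun ζ hζ =>
        inner_kernel (hrD (hx ζ hζ)) f
      exact (differentiableOn_rep f).comp (f := x) (by fun_prop) fun ζ hζ => hrD (hx ζ hζ)
    -- The pairing ⟨f, k_{x(conj η)}⟩ is conj (f (x (conj η))), which is `conjOp f` along the
    -- conjugate line and hence holomorphic in η.
    · have hxs : ∀ η : ℂ, star w + η • (star z - star w) = star (x (starRingEnd ℂ η)) := by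
        simp [x]
      refine DifferentiableOn.congr
        (f := fun η => rep (conjOp f) (star w + η • (star z - star w))) ?_ fun η hη => ?_
      · refine (differentiableOn_rep _).comp (f := fun η : ℂ => star w + η • (star z - star w))
          (by fun_prop) fun η hη => ?_
        change star w + η • (star z - star w) ∈ D n
        rw [hxs]
        exact (star_mem_D _).2 (hrD (hx' η hη))
      · have h0 := hrD (hx' η hη)
        rw [hxs, rep_conjOp f ((star_mem_D _).2 h0), star_star, ← inner_conj_symm f,
          inner_kernel h0]
    · simp only [Complex.conj_conj]
      exact h _ (hrD (hx ζ hζ))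
  have hsub : ball (0 : Fin n → ℂ) (r / 5) ⊆ D n :=
    (ball_subset_ball (by linarith)).trans hrD
  have hR : ∀ w ∈ ball (0 : Fin n → ℂ) (r / 5), R (kernel n l w) = 0 := fun w hw =>
    eq_zero_of_rep_ball (by positivity : 0 < r / 5) fun z hz => by
      rw [← inner_kernel (hsub hz)]
      exact key z hz w hw
  -- R kills only the kernels near 0 so far; this says that the functions in the range of the
  -- adjoint vanish near 0, hence identically.
  have hadj : ∀ f, ContinuousLinearMap.adjoint R f = 0 := fun f =>
    eq_zero_of_rep_ball (by positivity : 0 < r / 5) fun z hz => by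
      rw [← inner_kernel (hsub hz), ContinuousLinearMap.adjoint_inner_right, hR z hz,
        inner_zero_left]
  ext1 f
  refine ext_inner_left ℂ fun g => ?_
  rw [← ContinuousLinearMap.adjoint_inner_left, hadj, inner_zero_left]
  simp

end Berezin

/-! ### Conjugate points lie in the same orbit. -/

section Orbits

open Matrix

theorem exists_phase_eq {c : ℂ} (hc : ‖c‖ = 1) : ∃ t : SO 2, phase t = c := by
  refine ⟨⟨!![c.re, c.im; -c.im, c.re], ?_⟩, ?_⟩
  · rw [of_mem_specialOrthogonalGroup_fin_two_iff]
    refine ⟨rfl, by simp, ?_⟩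
    have h : ‖c‖ ^ 2 = 1 := by rw [hc, one_pow]
    rw [← Complex.normSq_eq_norm_sq, Complex.normSq_apply] at h
    rw [← h]; ring
  · simp [phase]

theorem act_one_left {n : ℕ} (t : SO 2) (z : Fin n → ℂ) : act (1, t) z = phase t • z := by
  have : ((1 : Matrix (Fin n) (Fin n) ℝ).map Complex.ofReal) = 1 :=
    Matrix.map_one _ Complex.ofReal_zero Complex.ofReal_one
  simp [act, this]

theorem act_one_right_re {n : ℕ} (A : SO n) (z : Fin n → ℂ) (i : Fin n) :
    (act (A, 1) z i).re = ((A : Matrix (Fin n) (Fin n) ℝ) *ᵥ fun j => (z j).re) i := by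
  simp [act, phase_one, mulVec, dotProduct, Complex.re_sum]

theorem act_one_right_im {n : ℕ} (A : SO n) (z : Fin n → ℂ) (i : Fin n) :
    (act (A, 1) z i).im = ((A : Matrix (Fin n) (Fin n) ℝ) *ᵥ fun j => (z j).im) i := by
  simp [act, phase_one, mulVec, dotProduct, Complex.im_sum]

/-- Reflecting along the imaginary part y negates y and fixes the real part x ⟂ y. A second
reflection along some f orthogonal to both makes the determinant 1; such an f is available because n
≥ 3. -/
theorem exists_act_eq_star_of_orthogonal {n : ℕ} (hn : 3 ≤ n) {u : Fin n → ℂ}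
    (h : (fun j => (u j).re) ⬝ᵥ (fun j => (u j).im) = 0) : ∃ g : G n, act g u = star u := by
  set x : Fin n → ℝ := fun j => (u j).re with hx
  set y : Fin n → ℝ := fun j => (u j).im with hy
  suffices hA : ∃ A : SO n, (A : Matrix (Fin n) (Fin n) ℝ) *ᵥ x = x ∧
      (A : Matrix (Fin n) (Fin n) ℝ) *ᵥ y = -y by
    obtain ⟨A, h1, h2⟩ := hA
    refine ⟨(A, 1), funext fun i => Complex.ext ?_ ?_⟩
    · rw [act_one_right_re, ← hx, h1]; rfl
    · rw [act_one_right_im, ← hy, h2]; rfl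
  by_cases hy0 : y = 0
  · exact ⟨1, by simp, by simp [hy0]⟩
  obtain ⟨f, hf, hfo⟩ := exists_orthogonal (show 2 < n by omega) ![x, y]
  have hfx : f ⬝ᵥ x = 0 := by rw [dotProduct_comm]; exact hfo 0
  have hfy : f ⬝ᵥ y = 0 := by rw [dotProduct_comm]; exact hfo 1
  have hyy : y ⬝ᵥ y ≠ 0 := fun h => hy0 (dotProduct_self_eq_zero.1 h)
  have hyx : y ⬝ᵥ x = 0 := by rw [dotProduct_comm]; exact h
  refine ⟨rotation₂ hy0 hf, ?_, ?_⟩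
  · change (householder y * householder f) *ᵥ x = x
    rw [← mulVec_mulVec, householder_mulVec f, hfx, mul_zero, zero_smul, sub_zero,
      householder_mulVec, hyx, mul_zero, zero_smul, sub_zero]
  · change (householder y * householder f) *ᵥ y = -y
    rw [← mulVec_mulVec, householder_mulVec f, hfy, mul_zero, zero_smul, sub_zero,
      householder_mulVec, div_mul_cancel₀ _ hyy, two_smul]
    abel

/-- The conjugate of a point lies in its orbit. -/
theorem exists_act_eq_star {n : ℕ} (hn : 3 ≤ n) (z : Fin n → ℂ) :
    ∃ g : G n, act g z = star z := by
  -- This phase makes quad (c z) real; its imaginary part is twice the scalar product of the real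
  -- and imaginary parts of c z, so these become orthogonal.
  set c : ℂ := Complex.exp (-(Complex.arg (quad z) / 2 : ℝ) * Complex.I) with hc
  have hc1 : ‖c‖ = 1 := by
    rw [hc, ← Complex.ofReal_neg, Complex.norm_exp_ofReal_mul_I]
  have hq : quad (c • z) = ‖quad z‖ := by
    rw [quad_smul]
    conv_lhs => rw [← Complex.norm_mul_exp_arg_mul_I (quad z)]
    rw [hc, ← Complex.exp_nat_mul, mul_left_comm, ← Complex.exp_add]
    have : ((2 : ℕ) : ℂ) * (-(Complex.arg (quad z) / 2 : ℝ) * Complex.I) +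
        Complex.arg (quad z) * Complex.I = 0 := by
      push_cast; ring
    rw [this, Complex.exp_zero, mul_one]
  obtain ⟨t, ht⟩ := exists_phase_eq hc1
  obtain ⟨g, hg⟩ := exists_act_eq_star_of_orthogonal hn (u := c • z) (by
    have h1 : (quad (c • z)).im = 0 := by rw [hq, Complex.ofReal_im]
    have h2 : (quad (c • z)).im =
        2 * ((fun j => ((c • z) j).re) ⬝ᵥ (fun j => ((c • z) j).im)) := by
      rw [quad, Complex.im_sum, dotProduct, Finset.mul_sum]
      refine Finset.sum_congr rfl fun j _ => ?_
      rw [sq, Complex.mul_im]; ring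
    linarith)
  -- The same phase is applied again, not its inverse: conjugation has inverted it, and c · conj (c
  -- z) = conj z.
  refine ⟨(1, t) * (g * (1, t)), ?_⟩
  have hcc : c * starRingEnd ℂ c = 1 := by
    rw [Complex.mul_conj, Complex.normSq_eq_norm_sq, hc1]; simp
  rw [act_mul, act_mul, act_one_left t z, ht, hg, act_one_left, ht, star_smul, smul_smul]
  change (c * starRingEnd ℂ c) • star z = star z
  rw [hcc, one_smul]

end Orbits

/-! ### Commutativity for the full group. -/

section Commutative

open Metric Set

variable {n : ℕ} {l : ℝ} [IsProbabilityMeasure (v n l)]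

theorem conjOp_add (f g : bergman n l) : conjOp (f + g) = conjOp f + conjOp g := by
  refine ext_inner_left ℂ fun u => ?_
  rw [inner_add_right, ← inner_conj_symm u, inner_conjOp, ← inner_conj_symm u, inner_conjOp f,
    ← inner_conj_symm u (conjOp g), inner_conjOp g, inner_add_right, map_add]

theorem conjOp_smul (c : ℂ) (f : bergman n l) :
    conjOp (c • f) = starRingEnd ℂ c • conjOp f := by
  refine bergman_ext fun z hz => ?_
  rw [rep_conjOp _ hz, rep_smul c f ((star_mem_D z).2 hz), rep_smul _ _ hz, Pi.smul_apply,
    Pi.smul_apply, rep_conjOp _ hz, smul_eq_mul, smul_eq_mul, map_mul]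

theorem norm_conjOp (f : bergman n l) : ‖conjOp f‖ = ‖f‖ := by
  rw [@norm_eq_sqrt_re_inner ℂ, @norm_eq_sqrt_re_inner ℂ, inner_conjOp_conjOp]

/-- The conjugate of an operator by the conjugation. -/
def conjConj (T : bergman n l →L[ℂ] bergman n l) : bergman n l →L[ℂ] bergman n l :=
  LinearMap.mkContinuous
    { toFun := fun f => conjOp (T (conjOp f))
      map_add' := fun f g => by rw [conjOp_add, map_add, conjOp_add]
      map_smul' := fun c f => by
        rw [conjOp_smul, map_smul, conjOp_smul, Complex.conj_conj, RingHom.id_apply] }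
    ‖T‖ fun f => by
      rw [LinearMap.coe_mk, AddHom.coe_mk, norm_conjOp]
      exact (T.le_opNorm _).trans_eq (by rw [norm_conjOp])

theorem conjConj_apply (T : bergman n l →L[ℂ] bergman n l) (f : bergman n l) :
    conjConj T f = conjOp (T (conjOp f)) := rfl

theorem conjConj_mul (S T : bergman n l →L[ℂ] bergman n l) :
    conjConj (S * T) = conjConj S * conjConj T := by
  ext1 f
  simp only [mul_apply_eq_comp, conjConj_apply, conjOp_conjOp]

/-- On operators that commute with the group, the adjoint is conjugation. -/
theorem star_eq_conjConj (hn : 3 ≤ n) {T : bergman n l →L[ℂ] bergman n l}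
    (hT : ∀ (g : G n) (f : bergman n l), T (compAct l g f) = compAct l g (T f)) :
    star T = conjConj T := by
  rw [ContinuousLinearMap.star_eq_adjoint, ← sub_eq_zero]
  -- At z the Berezin transform of the adjoint is ⟨T k_z, k_z⟩, and that of the conjugated operator
  -- is ⟨T k_{conj z}, k_{conj z}⟩. They agree because T commutes with the group and conj z lies in
  -- the orbit of z.
  refine eq_zero_of_berezin fun z hz => ?_
  obtain ⟨g, hg⟩ := exists_act_eq_star hn z
  have hz' := (star_mem_D z).2 hz
  have h1 : inner ℂ (T (kernel n l z)) (kernel n l z) =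
      inner ℂ (T (kernel n l (star z))) (kernel n l (star z)) := by
    rw [← compAct_kernel g hz, hT, inner_compAct, hg]
  rw [sub_apply, inner_sub_right, ContinuousLinearMap.adjoint_inner_right,
    conjConj_apply, conjOp_kernel hz, ← inner_conj_symm (kernel n l z) (conjOp _), inner_conjOp,
    conjOp_kernel hz, inner_conj_symm (T _), h1, sub_self]

theorem mul_comm_of_star_mul {E : Type*} [NormedAddCommGroup E] [InnerProductSpace ℂ E]
    [CompleteSpace E] {S T : E →L[ℂ] E}
    (h : star (star S * star T) = star (star S) * star (star T)) : S * T = T * S := by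
  rw [star_mul, star_star, star_star] at h
  exact h.symm

/-- On this algebra the adjoint, which reverses products, equals conjugation by `conjOp`, which
preserves them. -/
theorem toeplitzAlgebra_top_comm (hn : 3 ≤ n) {S T : bergman n l →L[ℂ] bergman n l}
    (hS : S ∈ toeplitzAlgebra l (⊤ : Subgroup (G n)))
    (hT : T ∈ toeplitzAlgebra l (⊤ : Subgroup (G n))) : S * T = T * S := by
  have h : ∀ R ∈ toeplitzAlgebra l (⊤ : Subgroup (G n)), star R = conjConj R := fun R hR =>
    star_eq_conjConj hn fun g f =>
      mul_compAct_of_mem_toeplitzAlgebra hR (Subgroup.mem_top g) f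
  have hS' : star S ∈ toeplitzAlgebra l (⊤ : Subgroup (G n)) := star_mem hS
  have hT' : star T ∈ toeplitzAlgebra l (⊤ : Subgroup (G n)) := star_mem hT
  have h1 := h _ (mul_mem hS' hT')
  rw [conjConj_mul, ← h _ hS', ← h _ hT'] at h1
  exact mul_comm_of_star_mul h1

end Commutative

/-! ### Homogeneous extensions and invariant quadratic forms. -/

section QuadraticForms

open Metric Set Filter Topology

/-- An entire function that is quadratic at infinity is a quadratic polynomial. -/
theorem eq_quadratic_of_inversion {g h : ℂ → ℂ} (hg : Differentiable ℂ g) (hh : ContinuousAt h 0)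
    (hgh : ∀ ζ ≠ 0, g ζ = ζ ^ 2 * h ζ⁻¹) :
    ∀ ζ, g ζ = g 0 + deriv g 0 * ζ + h 0 * ζ ^ 2 := by
  have hd : ∀ f : ℂ → ℂ, Differentiable ℂ f → Differentiable ℂ (dslope f 0) := fun f hf =>
    differentiableOn_univ.1 ((Complex.differentiableOn_dslope univ_mem).2 hf.differentiableOn)
  -- The second divided difference at 0 is entire. The inversion formula shows that it tends to h 0
  -- at infinity, so it is constant by Liouville.
  set q := dslope (dslope g 0) 0 with hq
  have hq' : ∀ ζ ≠ 0, q ζ = h ζ⁻¹ - g 0 * ζ⁻¹ ^ 2 - deriv g 0 * ζ⁻¹ := by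
    intro ζ hζ
    rw [hq, dslope_of_ne _ hζ, slope_def_field, dslope_of_ne _ hζ, slope_def_field, dslope_same,
      hgh ζ hζ]
    field_simp
    ring
  have hlim : Tendsto q (cocompact ℂ) (𝓝 (h 0)) := by
    have h1 : Tendsto (fun ζ : ℂ => ζ⁻¹) (cocompact ℂ) (𝓝 0) := by
      rw [← Metric.cobounded_eq_cocompact]
      exact tendsto_inv₀_cobounded
    have h2 : ContinuousAt (fun η => h η - g 0 * η ^ 2 - deriv g 0 * η) 0 := by fun_prop
    have h3 := h2.tendsto.comp h1
    simp only [ne_eq, OfNat.ofNat_ne_zero, not_false_eq_true, zero_pow, mul_zero, sub_zero] at h3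
    refine h3.congr' ?_
    have h4 : ∀ᶠ ζ : ℂ in cocompact ℂ, ζ ≠ 0 := isCompact_singleton.compl_mem_cocompact
    filter_upwards [h4] with ζ hζ using (hq' ζ hζ).symm
  intro ζ
  by_cases hζ : ζ = 0
  · simp [hζ]
  have h5 := (hd _ (hd g hg)).apply_eq_of_tendsto_cocompact ζ hlim
  have h6 : h ζ⁻¹ - g 0 * ζ⁻¹ ^ 2 - deriv g 0 * ζ⁻¹ = h 0 := (hq' ζ hζ).symm.trans h5
  rw [← h6, hgh ζ hζ]
  field_simp
  ring

/-- A function on the domain that is homogeneous of degree two under the circle extends to a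
homogeneous entire function. -/
theorem exists_homogeneous_extension {n : ℕ} {F : (Fin n → ℂ) → ℂ}
    (hF : DifferentiableOn ℂ F (D n))
    (hc : ∀ c : ℂ, ‖c‖ = 1 → ∀ z ∈ D n, F (c • z) = c ^ 2 * F z) :
    ∃ Φ : (Fin n → ℂ) → ℂ, Differentiable ℂ Φ ∧ (∀ (c : ℂ) z, Φ (c • z) = c ^ 2 * Φ z) ∧
      EqOn F Φ (D n) := by
  -- Both sides are holomorphic in c and agree on the unit circle, so the maximum principle extends
  -- the identity to the disc.
  have hdisc : ∀ c : ℂ, ‖c‖ ≤ 1 → ∀ z ∈ D n, F (c • z) = c ^ 2 * F z := by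
    intro c hc1 z hz
    obtain ⟨R, hR, hRD⟩ := exists_smul_mem_D hz
    have h1 : DifferentiableOn ℂ (fun ζ : ℂ => F (ζ • z)) (ball 0 R) :=
      hF.comp (f := fun ζ : ℂ => ζ • z) (by fun_prop) hRD
    have hsub : closure (ball (0 : ℂ) 1) ⊆ ball 0 R :=
      closure_ball_subset_closedBall.trans (closedBall_subset_ball hR)
    have h2 := Complex.eqOn_closure_of_eqOn_frontier (f := fun ζ : ℂ => F (ζ • z))
      (g := fun ζ => ζ ^ 2 * F z) isBounded_ball (h1.mono hsub).diffContOnCl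
      (Differentiable.diffContOnCl (by fun_prop)) (fun ζ hζ => by
        rw [frontier_ball _ one_ne_zero, mem_sphere_zero_iff_norm] at hζ
        exact hc ζ hζ z hz)
    exact h2 (by rw [closure_ball _ one_ne_zero]; simpa using hc1)
  obtain ⟨δ, hδ, hδD⟩ := Metric.isOpen_iff.1 (isOpen_D n) 0 (zero_mem_D n)
  let τ : (Fin n → ℂ) → ℝ := fun z => δ / (1 + ‖z‖)
  have hτ : ∀ z, 0 < τ z := fun z => by positivity
  have hτz : ∀ z, (τ z : ℂ) • z ∈ D n := by
    intro z
    apply hδD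
    rw [mem_ball_zero_iff, norm_smul, Complex.norm_of_nonneg (hτ z).le, div_mul_eq_mul_div,
      div_lt_iff₀ (by positivity)]
    linarith
  let Φ : (Fin n → ℂ) → ℂ := fun z => F ((τ z : ℂ) • z) / (τ z : ℂ) ^ 2
  -- The extension does not depend on the scaling factor used to reach the domain. Hence, near any
  -- point, the nonholomorphic factor τ can be replaced by a constant t.
  have hΦ : ∀ (c : ℂ) z, c • z ∈ D n → F (c • z) = c ^ 2 * Φ z := by
    intro c z hz
    have hτ0 : (τ z : ℂ) ≠ 0 := by exact_mod_cast (hτ z).ne'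
    have hΦz : F ((τ z : ℂ) • z) = (τ z : ℂ) ^ 2 * Φ z := by
      simp only [Φ]; field_simp
    by_cases hle : ‖c‖ ≤ τ z
    · have h1 := hdisc (c / τ z) (by
        rw [norm_div, Complex.norm_of_nonneg (hτ z).le]
        exact (div_le_one (hτ z)).2 hle) _ (hτz z)
      rw [smul_smul, div_mul_cancel₀ _ hτ0, hΦz] at h1
      rw [h1]; field_simp
    · have hc0 : c ≠ 0 := by rintro rfl; simp [(hτ z).le] at hle
      have h1 := hdisc (τ z / c) (by
        rw [norm_div, Complex.norm_of_nonneg (hτ z).le]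
        exact (div_le_one (norm_pos_iff.2 hc0)).2 (le_of_not_ge hle)) _ hz
      rw [smul_smul, div_mul_cancel₀ _ hc0, hΦz] at h1
      field_simp at h1 ⊢
      exact h1.symm
  have hexists : ∀ c : ℂ, ∀ z : Fin n → ℂ, ∃ t : ℂ, t ≠ 0 ∧ t • z ∈ D n ∧ t • c • z ∈ D n := by
    intro c z
    have h1 : ∀ᶠ t : ℂ in 𝓝[≠] 0, t • z ∈ D n := by
      refine Filter.Eventually.filter_mono nhdsWithin_le_nhds ?_
      have : Continuous fun t : ℂ => t • z := by fun_prop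
      exact this.continuousAt.eventually_mem ((isOpen_D n).mem_nhds (by simpa using zero_mem_D n))
    have h2 : ∀ᶠ t : ℂ in 𝓝[≠] 0, t • c • z ∈ D n := by
      refine Filter.Eventually.filter_mono nhdsWithin_le_nhds ?_
      have : Continuous fun t : ℂ => t • c • z := by fun_prop
      exact this.continuousAt.eventually_mem ((isOpen_D n).mem_nhds (by simpa using zero_mem_D n))
    obtain ⟨t, ⟨h3, h4⟩, h5⟩ := ((h1.and h2).and self_mem_nhdsWithin).exists
    exact ⟨t, h5, h3, h4⟩
  refine ⟨Φ, fun z => ?_, fun c z => ?_, fun z hz => ?_⟩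
  · obtain ⟨t, ht, htz, -⟩ := hexists 1 z
    have hcont : Continuous fun w : Fin n → ℂ => t • w := by fun_prop
    have h0 : DifferentiableAt ℂ (fun w => F (t • w)) z :=
      (hF.differentiableAt ((isOpen_D n).mem_nhds htz)).comp z
        (f := fun w : Fin n → ℂ => t • w) (by fun_prop)
    have h1 : DifferentiableAt ℂ (fun w => F (t • w) / t ^ 2) z := by
      simpa only [div_eq_mul_inv] using h0.mul_const _
    refine h1.congr_of_eventuallyEq ?_
    filter_upwards [hcont.continuousAt.eventually_mem ((isOpen_D n).mem_nhds htz)] with w hw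
    rw [hΦ t w hw]
    field_simp
  · obtain ⟨t, ht, htz, htc⟩ := hexists c z
    have h1 := hΦ t (c • z) htc
    rw [smul_smul] at h1 htc
    have h2 := hΦ (t * c) z htc
    rw [h1, mul_pow, mul_assoc] at h2
    exact mul_left_cancel₀ (pow_ne_zero 2 ht) h2
  · simpa using hΦ 1 z (by simpa using hz)

/-- The sum of the squares of all coordinates but the last one. -/
def quadInit {k : ℕ} (z : Fin (k + 1) → ℂ) : ℂ := quad fun i : Fin k => z i.castSucc

/-- The square of the last coordinate. -/
def sqLast {k : ℕ} (z : Fin (k + 1) → ℂ) : ℂ := z (Fin.last k) ^ 2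

theorem quad_eq_quadInit_add {k : ℕ} (z : Fin (k + 1) → ℂ) : quad z = quadInit z + sqLast z :=
  Fin.sum_univ_castSucc _

open Matrix in
theorem exists_corner_mulVec {k : ℕ} (hk : 2 ≤ k) {x y : Fin (k + 1) → ℝ}
    (hlast : x (Fin.last k) = y (Fin.last k)) (h : x ⬝ᵥ x = y ⬝ᵥ y) :
    ∃ A ∈ cornerSO (k + 1), (A : Matrix (Fin (k + 1)) (Fin (k + 1)) ℝ) *ᵥ x = y := by
  obtain ⟨B, hB⟩ := exists_SO_mulVec hk (x := fun i => x i.castSucc) (y := fun i => y i.castSucc)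
    (by
      rw [dotProduct, dotProduct, Fin.sum_univ_castSucc, Fin.sum_univ_castSucc, hlast] at h
      exact add_right_cancel h)
  refine ⟨cornerSOEmb B, (mem_cornerSO _).2 ⟨B, rfl⟩, ?_⟩
  ext i
  change (corner (B : Matrix (Fin k) (Fin k) ℝ) *ᵥ x) i = y i
  rw [mulVec, dotProduct, Fin.sum_univ_castSucc]
  induction i using Fin.lastCases with
  | last => simp [corner_apply_last, hlast, (Fin.castSucc_lt_last _).ne]
  | cast i =>
    rw [← congrFun hB i]
    simp [corner_apply_castSucc, corner_apply_last', (Fin.castSucc_lt_last _).ne, mulVec, dotProduct]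

open Matrix in
theorem act_ofReal {n : ℕ} (A : SO n) (x : Fin n → ℝ) :
    act (A, 1) (fun i => (x i : ℂ)) = fun i => ((((A : Matrix (Fin n) (Fin n) ℝ) *ᵥ x) i : ℝ) : ℂ) := by
  funext i
  refine Complex.ext ?_ ?_
  · rw [act_one_right_re]; simp
  · rw [act_one_right_im]
    have : (fun j => ((x j : ℂ)).im) = (0 : Fin n → ℝ) := by ext; simp
    rw [this]; simp

/-- Quadratic forms that are invariant under `SO(k)`. -/
theorem exists_eq_of_invariant {k : ℕ} (hk : 2 ≤ k) {Φ : (Fin (k + 1) → ℂ) → ℂ}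
    (hd : Differentiable ℂ Φ) (hhom : ∀ (c : ℂ) z, Φ (c • z) = c ^ 2 * Φ z)
    (hinv : ∀ A ∈ cornerSO (k + 1), ∀ z, Φ (act (A, 1) z) = Φ z) :
    ∃ α β : ℂ, ∀ z, Φ z = α * quadInit z + β * sqLast z := by
  -- On real vectors Φ depends only on the length and the last coordinate, so it is determined by
  -- its values on the plane of the first and last basis vectors.
  have hreal : ∀ x y : Fin (k + 1) → ℝ, x (Fin.last k) = y (Fin.last k) → x ⬝ᵥ x = y ⬝ᵥ y →
      Φ (fun i => (x i : ℂ)) = Φ (fun i => (y i : ℂ)) := by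
    intro x y h1 h2
    obtain ⟨A, hA, hAx⟩ := exists_corner_mulVec hk h1 h2
    rw [← hinv A hA, act_ofReal, hAx]
  have h0l : Fin.last k ≠ 0 := by simp [Fin.ext_iff]; omega
  let e : ℂ → ℂ → Fin (k + 1) → ℂ := fun a b => Pi.single 0 a + Pi.single (Fin.last k) b
  have he : ∀ a b : ℝ, e a b = fun i =>
      (((Pi.single 0 a + Pi.single (Fin.last k) b : Fin (k + 1) → ℝ) i : ℝ) : ℂ) := by
    intro a b
    funext i
    simp only [e, Pi.add_apply, Pi.single_apply]
    push_cast
    simp only [apply_ite Complex.ofReal, Complex.ofReal_zero]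
  have hlast : ∀ a b : ℝ, (Pi.single 0 a + Pi.single (Fin.last k) b : Fin (k + 1) → ℝ)
      (Fin.last k) = b := fun a b => by simp [h0l]
  have hdot : ∀ a b : ℝ, (Pi.single 0 a + Pi.single (Fin.last k) b : Fin (k + 1) → ℝ) ⬝ᵥ
      (Pi.single 0 a + Pi.single (Fin.last k) b) = a ^ 2 + b ^ 2 := fun a b => by
    simp [h0l, h0l.symm, sq]
  have hse : ∀ c a b, c • e a b = e (c * a) (c * b) := by
    intro c a b
    simp [e, ← Pi.single_smul]
  have hde : ∀ f g : ℂ → ℂ, Differentiable ℂ f → Differentiable ℂ g →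
      Differentiable ℂ fun ζ => Φ (e (f ζ) (g ζ)) := by
    intro f g hf hg
    refine hd.comp (differentiable_pi.2 fun i => ?_)
    simp only [e, Pi.add_apply, Pi.single_apply]
    refine Differentiable.add ?_ ?_ <;> split_ifs <;> fun_prop
  -- Homogeneity gives Φ(ζ, 1) = ζ² Φ(1, 1/ζ), so the restriction to an affine line of the plane is
  -- a quadratic polynomial. Its linear term vanishes because Φ(1, 1) = Φ(-1, 1).
  have hquad := eq_quadratic_of_inversion (g := fun ζ => Φ (e ζ 1)) (h := fun ζ => Φ (e 1 ζ))
    (hde _ _ differentiable_id (differentiable_const 1))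
    ((hde _ _ (differentiable_const 1) differentiable_id).continuous.continuousAt) (fun ζ hζ => by
      rw [← hhom, hse, mul_one, mul_inv_cancel₀ hζ])
  have hsymm : Φ (e 1 1) = Φ (e (-1) 1) := by
    have h1 := he 1 1
    have h2 := he (-1) 1
    push_cast at h1 h2
    rw [h1, h2]
    exact hreal _ _ (by rw [hlast, hlast]) (by rw [hdot, hdot]; norm_num)
  have hderiv : deriv (fun ζ => Φ (e ζ 1)) 0 = 0 := by
    have h1 := hquad 1
    have h2 := hquad (-1)
    rw [← hsymm] at h2
    have h3 : (2 : ℂ) * deriv (fun ζ => Φ (e ζ 1)) 0 = 0 := by linear_combination h2 - h1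
    simpa using h3
  refine ⟨Φ (e 1 0), Φ (e 0 1), ?_⟩
  have hform : ∀ a b : ℂ, Φ (e a b) = Φ (e 1 0) * a ^ 2 + Φ (e 0 1) * b ^ 2 := by
    intro a b
    by_cases hb : b = 0
    · have h1 : e a b = a • e 1 0 := by rw [hse, hb]; simp
      rw [h1, hhom, hb]; ring
    · have h1 : e a b = b • e (a / b) 1 := by rw [hse, mul_one, mul_div_cancel₀ _ hb]
      have h2 := hquad (a / b)
      simp only [hderiv, zero_mul, add_zero] at h2
      rw [h1, hhom, h2]
      field_simp
      ring
  have hR : ∀ x : Fin (k + 1) → ℝ, Φ (fun i => (x i : ℂ)) =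
      Φ (e 1 0) * quadInit (fun i => (x i : ℂ)) + Φ (e 0 1) * sqLast (fun i => (x i : ℂ)) := by
    intro x
    have hnn : 0 ≤ ∑ i : Fin k, x i.castSucc ^ 2 := Finset.sum_nonneg fun _ _ => sq_nonneg _
    have h1 := hreal x (Pi.single 0 (Real.sqrt (∑ i : Fin k, x i.castSucc ^ 2)) +
      Pi.single (Fin.last k) (x (Fin.last k))) (by rw [hlast]) (by
        rw [hdot, Real.sq_sqrt hnn, dotProduct, Fin.sum_univ_castSucc]
        simp only [sq])
    rw [h1, ← he, hform, ← Complex.ofReal_pow, Real.sq_sqrt hnn]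
    simp [quadInit, quad, sqLast]
  intro z
  -- A complex line through z, attained at ζ = i, whose points with real parameter are real vectors:
  -- the identity theorem carries the formula from real vectors to z.
  let w : ℂ → Fin (k + 1) → ℂ := fun ζ i => ((z i).re : ℂ) + ζ * (z i).im
  have hw : Differentiable ℂ w := differentiable_pi.2 fun i => by fun_prop
  have h1 : Differentiable ℂ fun ζ => Φ (w ζ) - (Φ (e 1 0) * quadInit (w ζ) +
      Φ (e 0 1) * sqLast (w ζ)) := by
    have h2 := hd.comp hw
    have h3 : Differentiable ℂ fun ζ => Φ (w ζ) := h2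
    simp only [quadInit, sqLast, quad]
    fun_prop
  have h2 := eq_zero_of_forall_real (R := 2) h1.differentiableOn (fun t _ => by
    have h3 : w t = fun i => (((z i).re + t * (z i).im : ℝ) : ℂ) := by
      funext i; simp [w]
    rw [h3, sub_eq_zero]
    exact hR _) Complex.I (by simp)
  have h3 : w Complex.I = z := by
    funext i
    simp only [w]
    rw [mul_comm, Complex.re_add_im]
  simp only [h3] at h2
  exact sub_eq_zero.1 h2

end QuadraticForms

/-! ### Noncommutativity for the corner subgroup. -/

section Noncommutative

open Metric Set

variable {n k : ℕ} {l : ℝ}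

/-! ### The action on the invariant quadratic forms -/

theorem quad_act (g : G n) (z : Fin n → ℂ) : quad (act g z) = phase g.2 ^ 2 * quad z := by
  rw [quad_eq, quad_eq, act, smul_dotProduct, dotProduct_smul, Matrix.dotProduct_mulVec,
    ← Matrix.mulVec_transpose, Matrix.mulVec_mulVec, map_gram, Matrix.one_mulVec, smul_eq_mul,
    smul_eq_mul]
  ring

theorem sqLast_act {g : G (k + 1)} (hg : g ∈ cornerProd (k + 1)) (z : Fin (k + 1) → ℂ) :
    sqLast (act g z) = phase g.2 ^ 2 * sqLast z := by
  obtain ⟨A, t⟩ := g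
  obtain ⟨B, rfl⟩ := (mem_cornerSO A).1 hg.1
  have h : act (cornerSOEmb B, t) z (Fin.last k) = phase t * z (Fin.last k) := by
    have h1 : ∀ j, ((cornerSOEmb B : SO (k + 1)) : Matrix (Fin (k + 1)) (Fin (k + 1)) ℝ)
        (Fin.last k) j = if j = Fin.last k then 1 else 0 := fun j => corner_apply_last _ j
    simp only [act, Pi.smul_apply, Matrix.mulVec, dotProduct, Matrix.map_apply, h1, smul_eq_mul,
      apply_ite Complex.ofReal, Complex.ofReal_one, Complex.ofReal_zero, ite_mul, one_mul, zero_mul,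
      Finset.sum_ite_eq', Finset.mem_univ, if_true]
  rw [sqLast, sqLast, h, mul_pow]

theorem quadInit_act {g : G (k + 1)} (hg : g ∈ cornerProd (k + 1)) (z : Fin (k + 1) → ℂ) :
    quadInit (act g z) = phase g.2 ^ 2 * quadInit z := by
  have h1 := quad_act g z
  rw [quad_eq_quadInit_add, quad_eq_quadInit_add, sqLast_act hg] at h1
  linear_combination h1

theorem differentiable_sqLast : Differentiable ℂ (sqLast (k := k)) := by
  unfold sqLast; fun_prop

theorem differentiable_quadInit : Differentiable ℂ (quadInit (k := k)) := by
  unfold quadInit quad; fun_prop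

/-! ### Functions and symbols from continuous functions -/

variable [IsProbabilityMeasure (v n l)]

theorem exists_bound_ae {E : Type*} [NormedAddCommGroup E] {F : (Fin n → ℂ) → E}
    (hF : Continuous F) : ∃ C, ∀ᵐ z ∂v n l, ‖F z‖ ≤ C := by
  obtain ⟨C, hC⟩ := (isCompact_closedBall (0 : Fin n → ℂ) 1).exists_bound_of_continuousOn
    hF.continuousOn
  exact ⟨C, ae_mem_D.mono fun z hz => hC z (D_subset_closedBall n hz)⟩

theorem memLp_of_continuous {F : (Fin n → ℂ) → ℂ} (hF : Continuous F) (q : ℝ≥0∞) :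
    MemLp F q (v n l) := by
  obtain ⟨C, hC⟩ := exists_bound_ae (l := l) hF
  exact MemLp.of_bound hF.aestronglyMeasurable C hC

/-- The class of an entire function in the Bergman space. -/
def ofEntire (l : ℝ) [IsProbabilityMeasure (v n l)] {F : (Fin n → ℂ) → ℂ}
    (hF : Differentiable ℂ F) : bergman n l :=
  ⟨(memLp_of_continuous hF.continuous 2).toLp F, F, hF.differentiableOn,
    MemLp.coeFn_toLp (memLp_of_continuous hF.continuous 2)⟩

theorem rep_ofEntire {F : (Fin n → ℂ) → ℂ} (hF : Differentiable ℂ F) :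
    EqOn (rep (ofEntire l hF)) F (D n) :=
  rep_eqOn hF.differentiableOn (MemLp.coeFn_toLp (memLp_of_continuous hF.continuous 2))

/-- The symbol of a continuous function. -/
def symbol (l : ℝ) [IsProbabilityMeasure (v n l)] {F : (Fin n → ℂ) → ℂ} (hF : Continuous F) :
    Linf n l :=
  (memLp_of_continuous hF ∞).toLp F

theorem symbol_ae {F : (Fin n → ℂ) → ℂ} (hF : Continuous F) : symbol l hF =ᵐ[v n l] F :=
  MemLp.coeFn_toLp (memLp_of_continuous hF ∞)

theorem symbol_mem_invSymbols {F : (Fin n → ℂ) → ℂ} (hF : Continuous F) {H : Subgroup (G n)}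
    (h : ∀ g ∈ H, ∀ z, F (act g z) = F z) : symbol l hF ∈ invSymbols l H := by
  intro g hg
  filter_upwards [ae_act g⁻¹ (symbol_ae (l := l) hF), symbol_ae hF] with z h1 h2
  rw [h1, h2, h _ (H.inv_mem hg)]

theorem integrable_mul_continuous (a : Linf n l) {K : (Fin n → ℂ) → ℂ} (hK : Continuous K) :
    Integrable (fun z => a z * K z) (v n l) := by
  obtain ⟨C, hC⟩ := exists_bound_ae (l := l) hK
  exact ((Lp.memLp a).integrable le_top).mul_bdd hK.aestronglyMeasurable hC

/-- A continuous invariant function that is orthogonal to all invariant symbols vanishes. -/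
theorem eq_zero_of_forall_integral {H : Subgroup (G n)} {K : (Fin n → ℂ) → ℂ} (hK : Continuous K)
    (hinv : ∀ g ∈ H, ∀ z, K (act g z) = K z)
    (h : ∀ a ∈ invSymbols l H, ∫ z, a z * K z ∂v n l = 0) : ∀ z ∈ D n, K z = 0 := by
  have hK' : Continuous fun z => starRingEnd ℂ (K z) := Complex.continuous_conj.comp hK
  -- The conjugate of K is itself an invariant symbol, so the hypothesis says that the L² norm of K
  -- is zero.
  have h1 := h (symbol l hK') (symbol_mem_invSymbols hK' fun g hg z => by rw [hinv g hg])
  have h2 : ∫ z, ((‖K z‖ ^ 2 : ℝ) : ℂ) ∂v n l = 0 := by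
    rw [← h1]
    refine integral_congr_ae ?_
    filter_upwards [symbol_ae (l := l) hK'] with z hz
    rw [hz, Complex.conj_mul']
    push_cast; rfl
  have h3 : ∫ z, ‖K z‖ ^ 2 ∂v n l = 0 := by
    rw [integral_complex_ofReal] at h2
    exact Complex.ofReal_eq_zero.1 h2
  have hint : Integrable (fun z => ‖K z‖ ^ 2) (v n l) := by
    have hc : Continuous fun z => ‖K z‖ ^ 2 := by fun_prop
    obtain ⟨C, hC⟩ := exists_bound_ae (l := l) hc
    exact Integrable.of_bound hc.aestronglyMeasurable C hC
  rw [integral_eq_zero_iff_of_nonneg (fun z => by positivity) hint] at h3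
  have h4 : K =ᵐ[v n l] 0 := h3.mono fun z hz => by simpa using hz
  exact eqOn_of_ae_eq hK.continuousOn continuousOn_const h4

theorem inner_ofEntire_toeplitz (a : Linf n l) {F K : (Fin n → ℂ) → ℂ} (hF : Differentiable ℂ F)
    (hK : Differentiable ℂ K) : inner ℂ (ofEntire l hK) (toeplitz a (ofEntire l hF)) =
      ∫ z, a z * (starRingEnd ℂ (K z) * F z) ∂v n l := by
  rw [inner_toeplitz]
  refine integral_congr_ae ?_
  filter_upwards [ae_mem_D] with z hz
  rw [rep_ofEntire hF hz, rep_ofEntire hK hz]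

/-! ### The plane of invariant quadratic forms -/

/-- The operator commutes with the group, so the image transforms like F. The circle factor makes it
homogeneous of degree two, and `SO(k)` invariance then leaves only the plane of the two quadratic
forms. -/
theorem exists_toeplitz_eq [IsProbabilityMeasure (v (k + 1) l)] (hk : 2 ≤ k)
    {a : Linf (k + 1) l} (ha : a ∈ invSymbols l (cornerProd (k + 1)))
    {F : (Fin (k + 1) → ℂ) → ℂ} (hF : Differentiable ℂ F)
    (hact : ∀ g ∈ cornerProd (k + 1), ∀ z, F (act g z) = phase g.2 ^ 2 * F z) :
    ∃ α β : ℂ, toeplitz a (ofEntire l hF) =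
      α • ofEntire l differentiable_quadInit + β • ofEntire l differentiable_sqLast := by
  set f := toeplitz a (ofEntire l hF) with hf
  have hrep : ∀ g ∈ cornerProd (k + 1), ∀ z ∈ D (k + 1),
      rep f (act g z) = phase g.2 ^ 2 * rep f z := by
    intro g hg z hz
    have h1 : compAct l g (ofEntire l hF) = phase g.2 ^ 2 • ofEntire l hF := by
      refine bergman_ext fun w hw => ?_
      rw [rep_compAct g _ hw, rep_smul _ _ hw, Pi.smul_apply, rep_ofEntire hF hw,
        rep_ofEntire hF ((act_mem_D g w).2 hw), hact g hg, smul_eq_mul]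
    rw [← rep_compAct g f hz, hf, ← toeplitz_compAct ha hg, h1, map_smul, rep_smul _ _ hz]
    rfl
  obtain ⟨Φ, hΦd, hΦh, hΦ⟩ := exists_homogeneous_extension (differentiableOn_rep f)
    (fun c hc z hz => by
      obtain ⟨t, rfl⟩ := exists_phase_eq hc
      rw [← act_one_left]
      exact hrep (1, t) ⟨Subgroup.one_mem _, trivial⟩ z hz)
  obtain ⟨α, β, hαβ⟩ := exists_eq_of_invariant hk hΦd hΦh (fun A hA z => by
    obtain ⟨t, ht0, ht⟩ : ∃ t : ℂ, t ≠ 0 ∧ t • z ∈ D (k + 1) := by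
      have h1 : ∀ᶠ t : ℂ in nhdsWithin 0 {0}ᶜ, t • z ∈ D (k + 1) := by
        refine Filter.Eventually.filter_mono nhdsWithin_le_nhds ?_
        have : Continuous fun t : ℂ => t • z := by fun_prop
        exact this.continuousAt.eventually_mem
          ((isOpen_D _).mem_nhds (by simpa using zero_mem_D (k + 1)))
      obtain ⟨t, h2, h3⟩ := (h1.and self_mem_nhdsWithin).exists
      exact ⟨t, h3, h2⟩
    have h1 := hrep (A, 1) ⟨hA, trivial⟩ _ ht
    rw [hΦ ((act_mem_D _ _).2 ht), hΦ ht, phase_one, one_pow, one_mul, ← actEquiv_apply, map_smul,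
      actEquiv_apply, hΦh, hΦh] at h1
    exact mul_left_cancel₀ (pow_ne_zero 2 ht0) h1)
  refine ⟨α, β, bergman_ext fun z hz => ?_⟩
  rw [hΦ hz, hαβ, rep_add _ _ hz, Pi.add_apply, rep_smul _ _ hz, rep_smul _ _ hz, Pi.smul_apply,
    Pi.smul_apply, rep_ofEntire _ hz, rep_ofEntire _ hz, smul_eq_mul, smul_eq_mul]

/-- A point of the domain where the two quadratic forms are in a given ratio. -/
theorem exists_mem_D_quadInit (hk : 2 ≤ k) (c : ℂ) :
    ∃ z ∈ D (k + 1), sqLast z ≠ 0 ∧ quadInit z = c * sqLast z := by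
  obtain ⟨y, hy⟩ : ∃ y : ℂ, y ^ 2 = c := IsAlgClosed.exists_pow_nat_eq c two_pos
  have h0l : (Fin.last k) ≠ 0 := by simp [Fin.ext_iff]; omega
  let w : Fin (k + 1) → ℂ := Pi.single 0 y + Pi.single (Fin.last k) 1
  have h1 : ∀ᶠ t : ℂ in nhdsWithin 0 {0}ᶜ, t • w ∈ D (k + 1) := by
    refine Filter.Eventually.filter_mono nhdsWithin_le_nhds ?_
    have : Continuous fun t : ℂ => t • w := by fun_prop
    exact this.continuousAt.eventually_mem
      ((isOpen_D _).mem_nhds (by simpa using zero_mem_D (k + 1)))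
  obtain ⟨t, h2, h3⟩ := (h1.and self_mem_nhdsWithin).exists
  have hs : sqLast (t • w) = t ^ 2 := by simp [sqLast, w, h0l]
  have hq : quad (t • w) = t ^ 2 * (c + 1) := by
    rw [quad_smul, quad_eq]
    simp [w, h0l, h0l.symm, ← hy, sq]
  refine ⟨t • w, h2, by rw [hs]; exact pow_ne_zero 2 h3, ?_⟩
  have := quad_eq_quadInit_add (t • w)
  rw [hq, hs] at this
  rw [hs]
  linear_combination -this

/-- This is ⟨f₁, (S T - T S) f₂⟩ = 0, expanded in the orthogonal pair f₁, f₂ and arranged to be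
linear in the matrix entries of T. -/
theorem inner_relation_of_commute {E : Type*} [NormedAddCommGroup E] [InnerProductSpace ℂ E]
    {f₁ f₂ : E} (h₁ : f₁ ≠ 0) (h₂ : f₂ ≠ 0) (h₁₂ : inner ℂ f₁ f₂ = 0) {S T : E →L[ℂ] E}
    (hS : ∃ α β : ℂ, S f₂ = α • f₁ + β • f₂) (hT : ∃ α β : ℂ, T f₂ = α • f₁ + β • f₂)
    (hST : S * T = T * S) :
    (inner ℂ f₁ (S f₁) / inner ℂ f₁ f₁ - inner ℂ f₂ (S f₂) / inner ℂ f₂ f₂) * inner ℂ f₁ (T f₂) -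
      inner ℂ f₁ (S f₂) / inner ℂ f₁ f₁ * inner ℂ f₁ (T f₁) +
      inner ℂ f₁ (S f₂) / inner ℂ f₂ f₂ * inner ℂ f₂ (T f₂) = 0 := by
  have h₂₁ : inner ℂ f₂ f₁ = 0 := by rw [← inner_conj_symm f₂, h₁₂, map_zero]
  have hN₁ : inner ℂ f₁ f₁ ≠ 0 := inner_self_ne_zero.2 h₁
  have hN₂ : inner ℂ f₂ f₂ ≠ 0 := inner_self_ne_zero.2 h₂
  have h := congrArg (fun R : E →L[ℂ] E => inner ℂ f₁ (R f₂)) hST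
  obtain ⟨α, β, hS⟩ := hS
  obtain ⟨γ, δ, hT⟩ := hT
  simp only [mul_apply_eq_comp, hS, hT, map_add, map_smul, inner_add_right,
    inner_smul_right, h₁₂, mul_zero, add_zero] at h
  simp only [hS, hT, inner_add_right, inner_smul_right, h₁₂, h₂₁, mul_zero, add_zero, zero_add]
  field_simp
  linear_combination h

theorem conj_mul_act {F K : (Fin n → ℂ) → ℂ} {g : G n} {z : Fin n → ℂ}
    (hF : F (act g z) = phase g.2 ^ 2 * F z) (hK : K (act g z) = phase g.2 ^ 2 * K z) :
    starRingEnd ℂ (F (act g z)) * K (act g z) = starRingEnd ℂ (F z) * K z := by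
  have h1 : starRingEnd ℂ (phase g.2) * phase g.2 = 1 := by
    rw [Complex.conj_mul', norm_phase]; simp
  rw [hF, hK, map_mul, map_pow]
  linear_combination (starRingEnd ℂ (phase g.2) * phase g.2 + 1) * starRingEnd ℂ (F z) * K z * h1

/-- The relation says that one fixed combination of conj F₁ · F₂, |F₁|² and |F₂|² integrates to zero
against every invariant symbol. The phases cancel, so the combination is itself invariant and must
vanish on the domain. -/
theorem conj_mul_relation {H : Subgroup (G n)} {F₁ F₂ : (Fin n → ℂ) → ℂ}
    (hF₁ : Differentiable ℂ F₁) (hF₂ : Differentiable ℂ F₂)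
    (hact₁ : ∀ g ∈ H, ∀ z, F₁ (act g z) = phase g.2 ^ 2 * F₁ z)
    (hact₂ : ∀ g ∈ H, ∀ z, F₂ (act g z) = phase g.2 ^ 2 * F₂ z) {A B C : ℂ}
    (h : ∀ b ∈ invSymbols l H, A * inner ℂ (ofEntire l hF₁) (toeplitz b (ofEntire l hF₂)) -
      B * inner ℂ (ofEntire l hF₁) (toeplitz b (ofEntire l hF₁)) +
      C * inner ℂ (ofEntire l hF₂) (toeplitz b (ofEntire l hF₂)) = 0) :
    ∀ z ∈ D n, A * (starRingEnd ℂ (F₁ z) * F₂ z) - B * (starRingEnd ℂ (F₁ z) * F₁ z) +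
      C * (starRingEnd ℂ (F₂ z) * F₂ z) = 0 := by
  have hK₁ : Continuous fun z => starRingEnd ℂ (F₁ z) * F₂ z :=
    (Complex.continuous_conj.comp hF₁.continuous).mul hF₂.continuous
  have hK₂ : Continuous fun z => starRingEnd ℂ (F₁ z) * F₁ z :=
    (Complex.continuous_conj.comp hF₁.continuous).mul hF₁.continuous
  have hK₃ : Continuous fun z => starRingEnd ℂ (F₂ z) * F₂ z :=
    (Complex.continuous_conj.comp hF₂.continuous).mul hF₂.continuous
  refine eq_zero_of_forall_integral (l := l) (H := H)
    (((hK₁.const_mul A).sub (hK₂.const_mul B)).add (hK₃.const_mul C)) (fun g hg z => ?_)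
    (fun b hb => ?_)
  · rw [conj_mul_act (hact₁ g hg z) (hact₁ g hg z), conj_mul_act (hact₁ g hg z) (hact₂ g hg z),
      conj_mul_act (hact₂ g hg z) (hact₂ g hg z)]
  · have i₁ := (integrable_mul_continuous (l := l) b hK₁).const_mul A
    have i₂ := (integrable_mul_continuous (l := l) b hK₂).const_mul B
    have i₃ := (integrable_mul_continuous (l := l) b hK₃).const_mul C
    have i₁₂ : Integrable (fun z => A * (b z * (starRingEnd ℂ (F₁ z) * F₂ z)) -
      B * (b z * (starRingEnd ℂ (F₁ z) * F₁ z))) (v n l) := i₁.sub i₂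
    rw [← h b hb, inner_ofEntire_toeplitz, inner_ofEntire_toeplitz, inner_ofEntire_toeplitz,
      ← integral_const_mul, ← integral_const_mul, ← integral_const_mul, ← integral_sub i₁ i₂,
      ← integral_add i₁₂ i₃]
    refine integral_congr_ae (Filter.Eventually.of_forall fun z => ?_)
    ring

theorem ofEntire_ne_zero {F : (Fin n → ℂ) → ℂ} (hF : Differentiable ℂ F) {z : Fin n → ℂ}
    (hz : z ∈ D n) (hFz : F z ≠ 0) : ofEntire l hF ≠ 0 := by
  intro h0
  have h1 := rep_ofEntire (l := l) hF hz
  rw [h0, ← inner_kernel hz, inner_zero_right] at h1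
  exact hFz h1.symm

theorem sub_const_mul_act {F K : (Fin n → ℂ) → ℂ} {g : G n} {z : Fin n → ℂ} (c : ℂ)
    (hF : F (act g z) = phase g.2 ^ 2 * F z) (hK : K (act g z) = phase g.2 ^ 2 * K z) :
    F (act g z) - c * K (act g z) = phase g.2 ^ 2 * (F z - c * K z) := by
  rw [hF, hK]; ring

theorem ofEntire_sub_const_mul {F K : (Fin n → ℂ) → ℂ} (hF : Differentiable ℂ F)
    (hK : Differentiable ℂ K) (c : ℂ) :
    ofEntire l (hF.sub (hK.const_mul c)) = ofEntire l hF - c • ofEntire l hK := by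
  rw [eq_sub_iff_add_eq]
  refine bergman_ext fun z hz => ?_
  rw [rep_add _ _ hz, Pi.add_apply, rep_smul _ _ hz, Pi.smul_apply, rep_ofEntire _ hz,
    rep_ofEntire _ hz, rep_ofEntire _ hz, smul_eq_mul, Pi.sub_apply, sub_add_cancel]

theorem exists_inner_sub_smul_eq_zero {E : Type*} [NormedAddCommGroup E] [InnerProductSpace ℂ E]
    {f : E} (hf : f ≠ 0) (p : E) : ∃ c : ℂ, inner ℂ f (p - c • f) = 0 :=
  ⟨inner ℂ f p / inner ℂ f f, by
    rw [inner_sub_right, inner_smul_right, div_mul_cancel₀ _ (inner_self_ne_zero.2 hf), sub_self]⟩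

/-- If all operators commuted, the coefficient ⟨f₁, T_a f₂⟩ would vanish for every a, and testing
against all symbols would give conj F₁ · F₂ = 0. The ratio of the two quadratic forms takes every
value on the domain, which excludes this. -/
theorem exists_toeplitz_not_commute [IsProbabilityMeasure (v (k + 1) l)] (hk : 2 ≤ k) :
    ∃ a ∈ invSymbols l (cornerProd (k + 1)), ∃ b ∈ invSymbols l (cornerProd (k + 1)),
      toeplitz a * toeplitz b ≠ toeplitz b * toeplitz a := by
  by_contra! hcomm
  obtain ⟨z₀, hz₀, hs₀, -⟩ := exists_mem_D_quadInit (k := k) hk 0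
  have hf₁ := ofEntire_ne_zero (l := l) (differentiable_sqLast (k := k)) hz₀ hs₀
  obtain ⟨c, hc⟩ := exists_inner_sub_smul_eq_zero hf₁ (ofEntire l differentiable_quadInit)
  rw [← ofEntire_sub_const_mul] at hc
  -- With F₂ = quadInit - c · sqLast, the ratio c + 1 gives F₂ = sqLast ≠ 0 at z₁, and the ratio c
  -- gives F₂ = 0 ≠ sqLast at z₂.
  obtain ⟨z₁, hz₁, hs₁, hq₁⟩ := exists_mem_D_quadInit (k := k) hk (c + 1)
  obtain ⟨z₂, hz₂, hs₂, hq₂⟩ := exists_mem_D_quadInit (k := k) hk c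
  obtain ⟨F₂, hF₂, hval, hc, hsum⟩ : ∃ (F₂ : (Fin (k + 1) → ℂ) → ℂ) (hF₂ : Differentiable ℂ F₂),
      (∀ z, F₂ z = quadInit z - c * sqLast z) ∧
      inner ℂ (ofEntire l differentiable_sqLast) (ofEntire l hF₂) = 0 ∧
      ofEntire l differentiable_quadInit =
        ofEntire l hF₂ + c • ofEntire l (differentiable_sqLast (k := k)) :=
    ⟨_, _, fun _ => rfl, hc, by
      rw [ofEntire_sub_const_mul differentiable_quadInit differentiable_sqLast, sub_add_cancel]⟩
  have hF₂z₁ : F₂ z₁ = sqLast z₁ := by rw [hval, hq₁]; ring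
  have hF₂z₂ : F₂ z₂ = 0 := by rw [hval, hq₂, sub_self]
  have hf₂ := ofEntire_ne_zero (l := l) hF₂ hz₁ (by rwa [hF₂z₁])
  have hact₁ : ∀ g ∈ cornerProd (k + 1), ∀ z, sqLast (act g z) = phase g.2 ^ 2 * sqLast z :=
    fun g hg z => sqLast_act hg z
  have hact₂ : ∀ g ∈ cornerProd (k + 1), ∀ z, F₂ (act g z) = phase g.2 ^ 2 * F₂ z := by
    intro g hg z
    rw [hval, hval]
    exact sub_const_mul_act c (quadInit_act hg z) (sqLast_act hg z)
  have hspan : ∀ a ∈ invSymbols l (cornerProd (k + 1)), ∃ α β : ℂ, toeplitz a (ofEntire l hF₂) =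
      α • ofEntire l differentiable_sqLast + β • ofEntire l hF₂ := by
    intro a ha
    obtain ⟨α, β, h⟩ := exists_toeplitz_eq hk ha hF₂ hact₂
    refine ⟨β + α * c, α, ?_⟩
    rw [h, hsum]
    module
  -- At z₂ only the |F₁|² term of the pointwise relation survives; its coefficient is ⟨f₁, T_a f₂⟩ /
  -- ⟨f₁, f₁⟩.
  have hzero : ∀ a ∈ invSymbols l (cornerProd (k + 1)),
      inner ℂ (ofEntire l differentiable_sqLast) (toeplitz a (ofEntire l hF₂)) = 0 := by
    intro a ha
    have h := conj_mul_relation differentiable_sqLast hF₂ hact₁ hact₂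
      (fun b hb => inner_relation_of_commute hf₁ hf₂ hc (hspan a ha) (hspan b hb)
        (hcomm a ha b hb)) z₂ hz₂
    simpa [hF₂z₂, hs₂, hf₁] using h
  -- These coefficients reduce the relation to conj F₁ · F₂ = 0, which fails at z₁, where F₁ = F₂ ≠
  -- 0.
  have h := conj_mul_relation (A := 1) (B := 0) (C := 0) differentiable_sqLast hF₂ hact₁ hact₂
    (fun b hb => by rw [hzero b hb]; ring) z₁ hz₁
  simp [hF₂z₁, hs₁] at h

end Noncommutative

end TypeIV

end

theorem corollary3p13 (n : ℕ) (hn : 3 ≤ n) :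
    TypeIV.IsMaximalConnected (TypeIV.cornerProd n) ∧
    ∀ l : ℝ, (n : ℝ) - 1 < l →
      (∀ S ∈ TypeIV.toeplitzAlgebra l (⊤ : Subgroup (TypeIV.G n)),
        ∀ T ∈ TypeIV.toeplitzAlgebra l (⊤ : Subgroup (TypeIV.G n)), S * T = T * S) ∧
      ¬ (∀ S ∈ TypeIV.toeplitzAlgebra l (TypeIV.cornerProd n),
        ∀ T ∈ TypeIV.toeplitzAlgebra l (TypeIV.cornerProd n), S * T = T * S) := by
  refine ⟨TypeIV.isMaximalConnected_cornerProd n hn, fun l hl => ?_⟩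
  have := TypeIV.isProbabilityMeasure_v (by omega : 2 ≤ n) hl
  refine ⟨fun S hS T hT => TypeIV.toeplitzAlgebra_top_comm hn hS hT, fun h => ?_⟩
  obtain ⟨k, rfl⟩ : ∃ k, n = k + 1 := ⟨n - 1, by omega⟩
  obtain ⟨a, ha, b, hb, hne⟩ := TypeIV.exists_toeplitz_not_commute (l := l) (by omega : 2 ≤ k)
  exact hne (h _ (Subalgebra.le_topologicalClosure _ (Algebra.subset_adjoin ⟨a, ha, rfl⟩)) _
    (Subalgebra.le_topologicalClosure _ (Algebra.subset_adjoin ⟨b, hb, rfl⟩)))
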